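/- Let $N\ge 1$, $d,m\ge 0$ be integers and $c_i^{(j)}\in\mathbb R$ for $1\le i\le m$, $1\le j\le N$. Let $\Omega=C_0(\mathbb R,\mathbb R^m)=\{\omega\in C(\mathbb R,\mathbb R^m):\omega(0)=0\}$ with the Borel $\sigma$-algebra of the compact-open topology, let $\mathbb P$ be the two-sided Wiener measure on $\Omega$ (so that $W^{(i)}_t(\omega)=\omega_i(t)$, $1\le i\le m$, are independent two-sided standard scalar Wiener processes), let $\theta_t\omega=\omega(\cdot+t)-\omega(t)$, and let $$O^{(j)}_t=\sum_{i=1}^m c_i^{(j)}e^{-t}\int_{-\infty}^t e^{\tau}\,dW^{(i)}_\tau ,\qquad j=1,\dots,N,$$ be the associated stationary Ornstein--Uhlenbeck processes, where $\int_{-\infty}^te^\tau dW_\tau=e^tW_t-\int_{-\infty}^te^\tau W_\tau d\tau$ pathwise. Then there is a measurable set $\overline\Omega\subset\Omega$ with $\mathbb P(\overline\Omega)=1$ and $\theta_t^{-1}\overline\Omega=\overline\Omega$ for all $t\in\mathbb R$, with $\lim_{t\to\pm\infty}\|\omega(t)\|/t=0$ for all $\omega\in\overline\Omega$, such that the following holds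 for every $L>0$ and all continuous maps $f^{(1)},\dots,f^{(N)}:\mathbb R^d\to\mathbb R^d$ satisfying the one-sided dissipative Lipschitz conditions $$\langle x_1-x_2,\,f^{(j)}(x_1)-f^{(j)}(x_2)\rangle\le -L\|x_1-x_2\|^2\qquad(x_1,x_2\in\mathbb R^d,\ j=1,\dots,N).$$ Consider, for $\omega\in\overline\Omega$ and $\nu>0$, the coupled RODEs $$\frac{dx^{(j)}}{dt}=e^{-O^{(j)}_t}f^{(j)}\big(e^{O^{(j)}_t}x^{(j)}\big)+O^{(j)}_t x^{(j)}+\nu\big(x^{(j-1)}-2x^{(j)}+x^{(j+1)}\big),\qquad j=1,\dots,N,\tag{1}$$ with $x^{(0)}=x^{(N)}$, $x^{(N+1)}=x^{(1)}$, and the averaged RODE $$\frac{dz}{dt}=\frac1N\sum_{j=1}^N\Big(e^{-O^{(j)}_t}f^{(j)}\big(e^{O^{(j)}_t}z\big)+O^{(j)}_t z\Big).\tag{2}$$ A *random attractor* of $\varphi$ (where $\varphi(t,\omega)x_0$ denotes the solution at time $t\ge0$ with value $x_0$ at time $0$) is a random set $A(\omega)$, $\omega\in\overline\Omega$ (that is,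 $\omega\mapsto\mathrm{dist}(x,A(\omega))$ is measurable on $\overline\Omega$ for each $x$), which is nonempty and compact, is invariant, $\varphi(t,\omega)A(\omega)=A(\theta_t\omega)$ for $t\ge 0$, and satisfies $\lim_{t\to\infty}\sup_{u\in D(\theta_{-t}\omega)}\mathrm{dist}\big(\varphi(t,\theta_{-t}\omega)u,A(\omega)\big)=0$ for every tempered random bounded set $D$, i.e. every random set $D$ with bounded values such that $\lim_{t\to\infty}e^{-kt}\sup_{u\in D(\theta_{-t}\omega)}\|u\|=0$ for all $k>0$ (all for every $\omega\in\overline\Omega$). It is a *singleton* random attractor, identified with the map $a$, if $A(\omega)=\{a(\omega)\}$. 1. For every $\omega\in\overline\Omega$, equation (1) (for every $\nu>0$) and equation (2) have, for every initial value at time $0$, a unique solution on $[0,\infty)$. 2. There is $\nu_0>0$ such that for every $\nu\ge\nu_0$ the system generated by (1) has a singleton random attractor $\bar x_\nu(\omega)=(\bar x^{(1)}_\nu(\omega),\dots,\bar x^{(N)}_\nu(\omega))$; the system generated by (2) has a singleton random attractor $\bar z(\omega)$. 3. If $\bar z$ is the singleton random attractor of the system generated by (2), then for every $\omega\in\overline\Omega$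 the function $t\mapsto\bar z(\theta_t\omega)$ solves (2) on $\mathbb R$. Moreover, for any sequence $\nu_n\to\infty$, if for all sufficiently large $n$ the map $\bar x_{\nu_n}$ is the singleton random attractor of the system generated by (1) with $\nu=\nu_n$, then for every $\omega\in\overline\Omega$, every bounded interval $[T_1,T_2]$ and every $j\in\{1,\dots,N\}$, $$\bar x^{(j)}_{\nu_n}(\theta_t\omega)\longrightarrow\bar z(\theta_t\omega)\quad\text{as }n\to\infty,\ \text{uniformly for }t\in[T_1,T_2].$$ -/

import Mathlib

open MeasureTheory ProbabilityTheory Filter Topology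
open scoped ENNReal

noncomputable section

namespace CoupledRODE

/-! ### The canonical Wiener space -/

/-- The space `C₀(ℝ, ℝᵐ)` of continuous paths `ω : ℝ → ℝᵐ` with `ω 0 = 0`. -/
def WienerSpace (m : ℕ) : Type := {ω : C(ℝ, Fin m → ℝ) // ω 0 = 0}

/-- The compact-open topology on `C₀(ℝ, ℝᵐ)`. -/
instance (m : ℕ) : TopologicalSpace (WienerSpace m) :=
  inferInstanceAs (TopologicalSpace {ω : C(ℝ, Fin m → ℝ) // ω 0 = 0})

/-- The Borel `σ`-algebra of the compact-open topology. -/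
instance (m : ℕ) : MeasurableSpace (WienerSpace m) := borel (WienerSpace m)

instance (m : ℕ) : BorelSpace (WienerSpace m) := ⟨rfl⟩

/-- The Wiener shift `(θ_t ω)(s) = ω(s + t) - ω(t)`. -/
def shift {m : ℕ} (t : ℝ) (ω : WienerSpace m) : WienerSpace m :=
  ⟨⟨fun s => ω.1 (s + t) - ω.1 t, by fun_prop⟩, by simp⟩

/-- `P` is the (two-sided, `m`-dimensional) Wiener measure: under `P` the coordinates
`W^{(i)}_t(ω) = ω(t)_i` are independent two-sided standard Wiener processes, i.e. they form a
centred Gaussian family with covariance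
`E[W^{(i)}_s W^{(k)}_t] = δ_{ik} (|s| + |t| - |t - s|) / 2`. -/
structure IsWienerMeasure {m : ℕ} (P : Measure (WienerSpace m)) : Prop where
  isProbabilityMeasure : IsProbabilityMeasure P
  gaussian : IsGaussianProcess (fun (p : Fin m × ℝ) (ω : WienerSpace m) => ω.1 p.2 p.1) P
  mean : ∀ (i : Fin m) (t : ℝ), ∫ ω, ω.1 t i ∂P = 0
  covariance : ∀ (i k : Fin m) (s t : ℝ),
    ∫ ω, ω.1 s i * ω.1 t k ∂P = if i = k then (|s| + |t| - |t - s|) / 2 else 0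

/-- The stationary Ornstein-Uhlenbeck processes
`O_t^{(j)} = ∑ i, c_i^{(j)} e^{-t} ∫_{-∞}^t e^τ dW_τ^{(i)}`. The integrand `e^τ` is smooth, so the
Wiener integral is the pathwise one obtained by integration by parts,
`∫_{-∞}^t e^τ dW_τ = e^t W_t - ∫_{-∞}^t e^τ W_τ dτ`; the last integral converges absolutely on
every path of sublinear growth. -/
def ouProcess {m N : ℕ} (c : Fin N → Fin m → ℝ) (j : Fin N) (t : ℝ) (ω : WienerSpace m) : ℝ :=
  ∑ i, c j i * (Real.exp (-t) *
    (Real.exp t * ω.1 t i - ∫ τ in Set.Iic t, Real.exp τ * ω.1 τ i))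

/-! ### The random differential equations -/

/-- `F(x, o) = e^{-o} f(e^o x) + o x`. -/
def conjugateField {d : ℕ} (f : EuclideanSpace ℝ (Fin d) → EuclideanSpace ℝ (Fin d))
    (o : ℝ) (x : EuclideanSpace ℝ (Fin d)) : EuclideanSpace ℝ (Fin d) :=
  Real.exp (-o) • f (Real.exp o • x) + o • x

/-- The right-hand side of the coupled system
`dx^{(j)}/dt = F^{(j)}(x^{(j)}, O_t^{(j)}(ω)) + ν (x^{(j-1)} - 2 x^{(j)} + x^{(j+1)})`; addition in
`Fin N` is cyclic, which is the convention `x^{(0)} = x^{(N)}`, `x^{(N+1)} = x^{(1)}`. -/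
def coupledField {m N d : ℕ} [NeZero N] (c : Fin N → Fin m → ℝ)
    (f : Fin N → EuclideanSpace ℝ (Fin d) → EuclideanSpace ℝ (Fin d)) (ν : ℝ)
    (ω : WienerSpace m) (t : ℝ) (x : Fin N → EuclideanSpace ℝ (Fin d)) :
    Fin N → EuclideanSpace ℝ (Fin d) :=
  fun j => conjugateField (f j) (ouProcess c j t ω) (x j)
    + ν • (x (j - 1) - (2 : ℝ) • x j + x (j + 1))

/-- The right-hand side of the averaged equation
`dz/dt = (1/N) ∑ j, (e^{-O_t^{(j)}} f^{(j)}(e^{O_t^{(j)}} z) + O_t^{(j)} z)`. -/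
def averagedField {m N d : ℕ} (c : Fin N → Fin m → ℝ)
    (f : Fin N → EuclideanSpace ℝ (Fin d) → EuclideanSpace ℝ (Fin d))
    (ω : WienerSpace m) (t : ℝ) (z : EuclideanSpace ℝ (Fin d)) : EuclideanSpace ℝ (Fin d) :=
  (1 / (N : ℝ)) • ∑ j, conjugateField (f j) (ouProcess c j t ω) z

/-- `x` is a (classical) solution of `dx/dt = G t x` on the time set `S`; the derivative is
one-sided at an end point of `S`. -/
def IsSolutionOn {V : Type*} [NormedAddCommGroup V] [NormedSpace ℝ V]
    (G : ℝ → V → V) (S : Set ℝ) (x : ℝ → V) : Prop :=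
  ∀ t ∈ S, HasDerivWithinAt x (G t (x t)) S t

/-- Global existence and uniqueness of forward solutions of `dx/dt = G t x`, `x 0 = x₀`. -/
def IsWellPosed {V : Type*} [NormedAddCommGroup V] [NormedSpace ℝ V] (G : ℝ → V → V) : Prop :=
  ∀ x₀ : V, ∃ x : ℝ → V, (x 0 = x₀ ∧ IsSolutionOn G (Set.Ici 0) x) ∧
    ∀ y : ℝ → V, y 0 = x₀ → IsSolutionOn G (Set.Ici 0) y → Set.EqOn y x (Set.Ici 0)

/-- The map `(t, ω, x₀) ↦ x(t, ω)`, `t ≥ 0`, generated by the solutions of the random differential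
equation `dx/dt = G ω t x`, `x 0 = x₀`. -/
def solutionFlow {m : ℕ} {V : Type*} [NormedAddCommGroup V] [NormedSpace ℝ V]
    (G : WienerSpace m → ℝ → V → V) (t : ℝ) (ω : WienerSpace m) (x₀ : V) : V :=
  Classical.epsilon (fun x : ℝ → V => x 0 = x₀ ∧ IsSolutionOn (G ω) (Set.Ici 0) x) t

/-! ### Random attractors -/

/-- `A` is a random set over `Ω'` (with the trace `σ`-algebra): all distance functions
`ω ↦ dist(x, A(ω))` are measurable. -/
def IsRandomSet {m : ℕ} {V : Type*} [NormedAddCommGroup V]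
    (Ω' : Set (WienerSpace m)) (A : WienerSpace m → Set V) : Prop :=
  ∀ x : V, Measurable fun ω : Ω' => Metric.infDist x (A ω)

/-- The class of tempered random bounded sets:
`lim_{t → ∞} e^{-kt} sup_{u ∈ D(θ_{-t} ω)} ‖u‖ = 0` for all `k > 0`. -/
structure IsTempered {m : ℕ} {V : Type*} [NormedAddCommGroup V]
    (Ω' : Set (WienerSpace m)) (D : WienerSpace m → Set V) : Prop where
  randomSet : IsRandomSet Ω' D
  bounded : ∀ ω ∈ Ω', Bornology.IsBounded (D ω)
  tempered : ∀ ω ∈ Ω', ∀ k : ℝ, 0 < k →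
    Tendsto (fun t : ℝ => Real.exp (-k * t) * sSup ((fun u => ‖u‖) '' D (shift (-t) ω)))
      atTop (𝓝 0)

/-- The Hausdorff semi-distance `H*(A, B) = sup_{a ∈ A} dist(a, B)`. -/
def hausdorffSemidist {V : Type*} [NormedAddCommGroup V] (A B : Set V) : ℝ≥0∞ :=
  ⨆ a ∈ A, Metric.infEDist a B

/-- `A` is a random attractor of `φ` (over `Ω'`): a compact nonempty random set that is
`φ`-invariant and pullback-attracts every tempered random bounded set. -/
structure IsRandomAttractor {m : ℕ} {V : Type*} [NormedAddCommGroup V]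
    (Ω' : Set (WienerSpace m)) (φ : ℝ → WienerSpace m → V → V)
    (A : WienerSpace m → Set V) : Prop where
  randomSet : IsRandomSet Ω' A
  nonempty : ∀ ω ∈ Ω', (A ω).Nonempty
  compact : ∀ ω ∈ Ω', IsCompact (A ω)
  invariant : ∀ ω ∈ Ω', ∀ t : ℝ, 0 ≤ t → φ t ω '' A ω = A (shift t ω)
  attracting : ∀ D : WienerSpace m → Set V, IsTempered Ω' D → ∀ ω ∈ Ω',
    Tendsto (fun t : ℝ =>
      hausdorffSemidist (φ t (shift (-t) ω) '' D (shift (-t) ω)) (A ω)) atTop (𝓝 0)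

/-- The random attractor of `φ` consists of the single points `a ω`. -/
def IsSingletonAttractor {m : ℕ} {V : Type*} [NormedAddCommGroup V]
    (Ω' : Set (WienerSpace m)) (φ : ℝ → WienerSpace m → V → V) (a : WienerSpace m → V) : Prop :=
  IsRandomAttractor Ω' φ fun ω => {a ω}

end CoupledRODE

end

/-! The conjugated field `e^{-o} f(e^o x) + o x` is one-sided Lipschitz with constant `-L + o`, so
the noise can spoil dissipativity at times but enters linearly. In the coupled system the Dirichlet
form of the cycle penalises differences of components. A large coupling therefore replaces the
individual noises by their mean over `j`, at the cost of a quadratic term of size `2 N² / ν * ∑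
o_j²` (`sum_mul_norm_sq_le`). Hence the averaged system and all coupled systems with `ν ≥ ν₀` obey
energy inequalities with one and the same rate `pathRate` and source `pathSource`.

Suppose the rate `α`, with primitive `A`, is negative on average in the past and the source is
subexponential there (`PastDecay`). Then solutions started from `0` at time `s` form a Cauchy family
as `s → -∞`, by Gronwall's inequality. Their limit is an entire solution with energy at most
`e^{A(t)}` times a convergent tail integral (`RateBounds.exists_entire`), and it attracts tempered
sets. This is the singleton attractor, and every singleton attractor is this limit because `{0}` is
tempered.

Averages of the noise are controlled path by path. The integral of an Ornstein-Uhlenbeck path is a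
difference of exponentially weighted past means, which grow sublinearly with the driving path, so
the mean term is negligible. The integral of its square grows at most linearly with a deterministic
slope, so the quadratic term is beaten by taking `ν₀` large. Both properties define the set
`regularPaths`, which depends on neither `f`, `L` nor `c`. Sublinear growth of Brownian motion
follows from time inversion. The bound on the squares follows from Isserlis' formula, which gives a
variance linear in the length of the time window, with Chebyshev's inequality and the Borel-Cantelli
lemma along windows of length `2^n`.

The `f^{(j)}` are merely continuous, so existence rests on the one-sided Lipschitz bound: it makes
Euler polygons of truncated fields Cauchy in energy. Limits of Euler polygons also depend measurably
on `ω`, which makes the attractors random sets.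

For synchronization, the common energy bound confines all attractor trajectories to one ball on each
bounded time interval. There the deviations from the mean over `j` contract at a rate of order `ν`,
and the mean solves the averaged equation up to a small defect, since the Laplacian sums to zero.
Comparison with `z̄` starts far in the past, where the tail integral makes the weighted initial
distance small (`tendstoUniformlyOn_entire`). -/

noncomputable section

namespace CoupledRODE

/-! ### A Gronwall inequality for right derivatives -/

/-- Gronwall's inequality with variable coefficients: if `u' ≤ α u + β` for the right derivative
`u'` of `u` and `A` is a primitive of `α`, then `e^{-A} u - ∫ e^{-A} β` does not increase. -/
theorem gronwall_right {u u' α β A : ℝ → ℝ} {s T : ℝ} (hu : ContinuousOn u (Set.Icc s T))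
    (hu' : ∀ t ∈ Set.Ico s T, HasDerivWithinAt u (u' t) (Set.Ici t) t)
    (hA : ∀ t, HasDerivAt A (α t) t) (hβ : Continuous β)
    (h : ∀ t ∈ Set.Ico s T, u' t ≤ α t * u t + β t) {t : ℝ} (ht : t ∈ Set.Icc s T) :
    Real.exp (-A t) * u t ≤
      Real.exp (-A s) * u s + ∫ r in s..t, Real.exp (-A r) * β r := by
  have hAc : Continuous A := continuous_iff_continuousAt.2 fun t => (hA t).continuousAt
  have hE : ∀ t, HasDerivAt (fun t => Real.exp (-A t)) (Real.exp (-A t) * -α t) t :=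
    fun t => (hA t).neg.exp
  have hc : Continuous fun r => Real.exp (-A r) * β r := by fun_prop
  have hI : ∀ t, HasDerivAt (fun t => Real.exp (-A s) * u s +
      ∫ r in s..t, Real.exp (-A r) * β r) (Real.exp (-A t) * β t) t := fun t =>
    (hc.integral_hasStrictDerivAt s t).hasDerivAt.const_add _
  -- Only right derivatives are compared, so the inequality applies to Euler polygons, which have
  -- corners, as well as to solutions.
  refine image_le_of_deriv_right_le_deriv_boundary
    (f := fun t => Real.exp (-A t) * u t)
    (f' := fun t => Real.exp (-A t) * -α t * u t + Real.exp (-A t) * u' t)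
    (by fun_prop) (fun x hx => (hE x).hasDerivWithinAt.mul (hu' x hx)) (by simp)
    (fun x _ => (hI x).continuousAt.continuousWithinAt)
    (fun x _ => (hI x).hasDerivWithinAt) (fun x hx => ?_) ht
  have := mul_le_mul_of_nonneg_left (h x hx) (Real.exp_pos (-A x)).le
  linarith

/-! ### Energy forms -/

/-- A symmetric coercive bounded bilinear form. -/
structure EnergyForm (V : Type*) [NormedAddCommGroup V] [NormedSpace ℝ V] where
  /-- the underlying bilinear form -/
  form : V →L[ℝ] V →L[ℝ] ℝ
  symm : ∀ x y, form x y = form y x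
  /-- the coercivity constant -/
  const : ℝ
  const_pos : 0 < const
  coercive : ∀ x, const * ‖x‖ ^ 2 ≤ form x x

namespace EnergyForm

variable {V : Type*} [NormedAddCommGroup V] [NormedSpace ℝ V] (E : EnergyForm V)

theorem nonneg (x : V) : 0 ≤ E.form x x :=
  (mul_nonneg E.const_pos.le (sq_nonneg _)).trans (E.coercive x)

theorem apply_le (x y : V) : E.form x y ≤ ‖E.form‖ * ‖x‖ * ‖y‖ :=
  (le_abs_self _).trans (E.form.le_opNorm₂ x y)

theorem self_le (x : V) : E.form x x ≤ ‖E.form‖ * ‖x‖ ^ 2 := by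
  have := E.apply_le x x
  nlinarith

theorem norm_sq_le (x : V) : ‖x‖ ^ 2 ≤ E.const⁻¹ * E.form x x := by
  rw [← div_eq_inv_mul, le_div_iff₀ E.const_pos, mul_comm]
  exact E.coercive x

theorem sub_self_le (x y : V) :
    E.form (x - y) (x - y) ≤ 2 * E.form x x + 2 * E.form y y := by
  have := E.nonneg (x + y)
  simp only [map_add, map_sub, add_apply, sub_apply] at this ⊢
  linarith

theorem hasDerivWithinAt {x : ℝ → V} {x' : V} {S : Set ℝ} {t : ℝ}
    (h : HasDerivWithinAt x x' S t) :
    HasDerivWithinAt (fun t => E.form (x t) (x t)) (2 * E.form (x t) x') S t := by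
  have := ContinuousLinearMap.hasDerivWithinAt_of_bilinear (B := E.form) h h
  rwa [E.symm x' (x t), ← two_mul] at this

/-- Convergence in energy implies convergence. -/
theorem tendsto_of_form {ι : Type*} {l : Filter ι} {x : ι → V} {y : V}
    (h : Tendsto (fun i => E.form (x i - y) (x i - y)) l (𝓝 0)) : Tendsto x l (𝓝 y) := by
  rw [tendsto_iff_norm_sub_tendsto_zero]
  have h2 : Tendsto (fun i => ‖x i - y‖ ^ 2) l (𝓝 0) :=
    squeeze_zero (fun _ => sq_nonneg _) (fun i => E.norm_sq_le _) (by simpa using h.const_mul E.const⁻¹)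
  simpa [Real.sqrt_sq (norm_nonneg _)] using h2.sqrt

end EnergyForm

/-! ### The Euler scheme -/

section Euler

variable {V : Type*} [NormedAddCommGroup V] [NormedSpace ℝ V]

/-- The nodes of the explicit Euler scheme with step `h`. -/
def eulerNode (H : ℝ → V → V) (h : ℝ) (x₀ : V) : ℕ → V
  | 0 => x₀
  | k + 1 => eulerNode H h x₀ k + h • H (k * h) (eulerNode H h x₀ k)

/-- The slope of the Euler polygon. -/
def eulerSlope (H : ℝ → V → V) (h : ℝ) (x₀ : V) (t : ℝ) : V :=
  H (⌊t / h⌋₊ * h) (eulerNode H h x₀ ⌊t / h⌋₊)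

/-- The Euler polygon. -/
def eulerPath (H : ℝ → V → V) (h : ℝ) (x₀ : V) (t : ℝ) : V :=
  eulerNode H h x₀ ⌊t / h⌋₊ + (t - ⌊t / h⌋₊ * h) • eulerSlope H h x₀ t

variable {H : ℝ → V → V} {h : ℝ} {x₀ : V}

theorem floor_mul_le (hh : 0 < h) {t : ℝ} (ht : 0 ≤ t) : ⌊t / h⌋₊ * h ≤ t := by
  have := Nat.floor_le (div_nonneg ht hh.le)
  rwa [le_div_iff₀ hh] at this

theorem lt_floor_mul (hh : 0 < h) (t : ℝ) : t < (⌊t / h⌋₊ + 1) * h := by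
  have := Nat.lt_floor_add_one (t / h)
  rwa [div_lt_iff₀ hh] at this

theorem floor_div_eq (hh : 0 < h) {t : ℝ} {k : ℕ} (h1 : k * h ≤ t) (h2 : t < (k + 1) * h) :
    ⌊t / h⌋₊ = k := by
  rw [Nat.floor_eq_iff (div_nonneg ((by positivity : 0 ≤ k * h).trans h1) hh.le)]
  exact ⟨by rwa [le_div_iff₀ hh], by rwa [div_lt_iff₀ hh]⟩

theorem eulerPath_zero : eulerPath H h x₀ 0 = x₀ := by simp [eulerPath, eulerNode]

/-- The affine formula persists at the right end of the cell, where the floor has already jumped: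
the affine piece ends exactly at the next node. This is what yields continuity from the left. -/
theorem eulerPath_eq (hh : 0 < h) {t : ℝ} {k : ℕ} (h1 : k * h ≤ t) (h2 : t ≤ (k + 1) * h) :
    eulerPath H h x₀ t =
      eulerNode H h x₀ k + (t - k * h) • H (k * h) (eulerNode H h x₀ k) := by
  rcases h2.lt_or_eq with h2 | rfl
  · simp only [eulerPath, eulerSlope, floor_div_eq hh h1 h2]
  · have : ⌊(k + 1 : ℝ) * h / h⌋₊ = k + 1 :=
      floor_div_eq hh (by push_cast; rfl) (by push_cast; linarith)
    simp only [eulerPath, this, eulerNode]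
    push_cast
    simp only [sub_self, zero_smul, add_zero]
    congr 2
    ring

/-- The floor is constant on a right neighbourhood of every point, so the polygon is affine there.
At nodes a two-sided derivative need not exist. -/
theorem hasDerivWithinAt_eulerPath (hh : 0 < h) {t : ℝ} (ht : 0 ≤ t) :
    HasDerivWithinAt (eulerPath H h x₀) (eulerSlope H h x₀ t) (Set.Ici t) t := by
  set k := ⌊t / h⌋₊ with hk
  have h1 := floor_mul_le hh ht
  have h2 := lt_floor_mul hh t
  have hd : HasDerivWithinAt (fun t => eulerNode H h x₀ k + (t - k * h) • eulerSlope H h x₀ t)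
      (eulerSlope H h x₀ t) (Set.Ici t) t := by
    have : HasDerivWithinAt (fun r => eulerNode H h x₀ k + (r - k * h) • eulerSlope H h x₀ t)
      ((1 : ℝ) • eulerSlope H h x₀ t) (Set.Ici t) t :=
      (((hasDerivAt_id t).sub_const _).smul_const _).const_add _ |>.hasDerivWithinAt
    rw [one_smul] at this
    refine this.congr_of_eventuallyEq ?_ rfl
    filter_upwards [Ico_mem_nhdsGE h2] with r hr
    simp only [eulerSlope, floor_div_eq hh (h1.trans hr.1) hr.2, ← hk]
  refine hd.congr_of_eventuallyEq ?_ rfl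
  filter_upwards [Ico_mem_nhdsGE h2] with r hr
  simp only [eulerPath, floor_div_eq hh (h1.trans hr.1) hr.2, ← hk]

theorem continuousOn_eulerPath (hh : 0 < h) : ContinuousOn (eulerPath H h x₀) (Set.Ici 0) := by
  intro t ht
  rcases (Set.mem_Ici.1 ht).eq_or_lt with rfl | ht0
  · exact (hasDerivWithinAt_eulerPath hh le_rfl).continuousWithinAt
  refine ContinuousAt.continuousWithinAt (continuousAt_iff_continuous_left_right.2
    ⟨?_, (hasDerivWithinAt_eulerPath hh ht).continuousWithinAt⟩)
  obtain ⟨k, hk⟩ : ∃ k : ℕ, ⌈t / h⌉₊ = k + 1 :=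
    Nat.exists_eq_succ_of_ne_zero (Nat.ceil_pos.2 (div_pos ht0 hh)).ne'
  have h1 : k * h < t := by
    have := Nat.ceil_lt_add_one (div_nonneg ht0.le hh.le)
    rw [hk, ← sub_lt_iff_lt_add, lt_div_iff₀ hh] at this
    simpa using this
  have h2 : t ≤ (k + 1) * h := by
    have := Nat.le_ceil (t / h)
    rw [hk, div_le_iff₀ hh] at this
    exact_mod_cast this
  have hc : ContinuousWithinAt
      (fun t : ℝ => eulerNode H h x₀ k + (t - k * h) • H (k * h) (eulerNode H h x₀ k))
      (Set.Iic t) t := by fun_prop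
  refine hc.congr_of_eventuallyEq ?_ (eulerPath_eq hh h1.le h2)
  filter_upwards [Ioc_mem_nhdsLE h1] with r hr
  exact eulerPath_eq hh hr.1.le (hr.2.trans h2)

theorem norm_eulerNode_sub_le (hh : 0 < h) {M T : ℝ} 
    (hM : ∀ t ∈ Set.Icc 0 T, ∀ x, ‖H t x‖ ≤ M) (k : ℕ) (hk : k * h ≤ T) :
    ‖eulerNode H h x₀ k - x₀‖ ≤ k * h * M := by
  induction k with
  | zero => simp [eulerNode]
  | succ k ih =>
    push_cast at hk
    have hk' : k * h ≤ T := by nlinarith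
    have h1 := ih hk'
    have h2 := hM (k * h) ⟨by positivity, hk'⟩ (eulerNode H h x₀ k)
    calc ‖eulerNode H h x₀ (k + 1) - x₀‖
        = ‖(eulerNode H h x₀ k - x₀) + h • H (k * h) (eulerNode H h x₀ k)‖ := by
          simp only [eulerNode]; congr 1; abel
      _ ≤ k * h * M + h * M := by
          refine (norm_add_le _ _).trans (add_le_add h1 ?_)
          rw [norm_smul, Real.norm_of_nonneg hh.le]
          gcongr
      _ = _ := by push_cast; ring

theorem norm_eulerPath_sub_node_le (hh : 0 < h) {M T : ℝ}
    (hM : ∀ t ∈ Set.Icc 0 T, ∀ x, ‖H t x‖ ≤ M) {t : ℝ} (ht : t ∈ Set.Icc 0 T) :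
    ‖eulerPath H h x₀ t - eulerNode H h x₀ ⌊t / h⌋₊‖ ≤ h * M := by
  have h1 := floor_mul_le hh ht.1
  have h2 := lt_floor_mul hh t
  have h3 := hM (⌊t / h⌋₊ * h) ⟨by positivity, h1.trans ht.2⟩ (eulerNode H h x₀ ⌊t / h⌋₊)
  rw [eulerPath, add_sub_cancel_left, norm_smul, Real.norm_of_nonneg (by linarith)]
  exact mul_le_mul (by linarith) h3 (norm_nonneg _) hh.le

theorem norm_eulerPath_sub_le (hh : 0 < h) {M T : ℝ}
    (hM : ∀ t ∈ Set.Icc 0 T, ∀ x, ‖H t x‖ ≤ M) {t : ℝ} (ht : t ∈ Set.Icc 0 T) :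
    ‖eulerPath H h x₀ t - x₀‖ ≤ T * M := by
  have h1 := floor_mul_le hh ht.1
  have h2 := norm_eulerNode_sub_le (x₀ := x₀) hh hM _ (h1.trans ht.2)
  have h3 := hM (⌊t / h⌋₊ * h) ⟨by positivity, h1.trans ht.2⟩ (eulerNode H h x₀ ⌊t / h⌋₊)
  have hM0 : 0 ≤ M := (norm_nonneg _).trans h3
  calc ‖eulerPath H h x₀ t - x₀‖
      = ‖(eulerNode H h x₀ ⌊t / h⌋₊ - x₀) + (t - ⌊t / h⌋₊ * h) • eulerSlope H h x₀ t‖ := by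
        rw [eulerPath]; congr 1; abel
    _ ≤ ⌊t / h⌋₊ * h * M + (t - ⌊t / h⌋₊ * h) * M := by
        refine (norm_add_le _ _).trans (add_le_add h2 ?_)
        rw [norm_smul, Real.norm_of_nonneg (by linarith)]
        exact mul_le_mul_of_nonneg_left h3 (by linarith)
    _ = t * M := by ring
    _ ≤ T * M := mul_le_mul_of_nonneg_right ht.2 hM0

/-- The slope of the Euler polygon is uniformly close to the field along the polygon. -/
theorem eulerSlope_uniform [FiniteDimensional ℝ V] (hH : Continuous (Function.uncurry H))
    {M T : ℝ} (hM : ∀ t ∈ Set.Icc 0 T, ∀ x, ‖H t x‖ ≤ M) {η : ℝ} (hη : 0 < η) (x₀ : V) :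
    ∃ δ > 0, ∀ h, 0 < h → h < δ → ∀ t ∈ Set.Icc 0 T,
      ‖eulerSlope H h x₀ t - H t (eulerPath H h x₀ t)‖ ≤ η := by
  have : ProperSpace V := FiniteDimensional.proper ℝ V
  have hK : IsCompact (Set.Icc (0 : ℝ) T ×ˢ Metric.closedBall x₀ (T * M)) :=
    isCompact_Icc.prod (isCompact_closedBall _ _)
  have hU := hK.uniformContinuousOn_of_continuous hH.continuousOn
  rw [Metric.uniformContinuousOn_iff_le] at hU
  obtain ⟨δ, hδ, hδ'⟩ := hU η hη
  -- With `h (|M| + 1) < δ` both the time lag `h` and the displacement `h M` from the last node stay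
  -- below `δ`.
  refine ⟨δ / (|M| + 1), by positivity, fun h hh hhδ t ht => ?_⟩
  rw [lt_div_iff₀ (by positivity)] at hhδ
  have h1 := floor_mul_le hh ht.1
  have h2 := lt_floor_mul hh t
  have h3 : h * M ≤ h * |M| := mul_le_mul_of_nonneg_left (le_abs_self M) hh.le
  have hM0 : 0 ≤ M := (norm_nonneg _).trans (hM t ht x₀)
  have h4 : h * (|M| + 1) = h * |M| + h := by ring
  have hmem : (⌊t / h⌋₊ * h : ℝ) ∈ Set.Icc 0 T := ⟨by positivity, h1.trans ht.2⟩
  rw [← dist_eq_norm]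
  refine hδ' (⌊t / h⌋₊ * h, eulerNode H h x₀ ⌊t / h⌋₊) ⟨hmem, ?_⟩ (t, eulerPath H h x₀ t)
    ⟨ht, ?_⟩ ?_
  · rw [mem_closedBall_iff_norm]
    exact (norm_eulerNode_sub_le hh hM _ hmem.2).trans (mul_le_mul_of_nonneg_right hmem.2 hM0)
  · rw [mem_closedBall_iff_norm]
    exact norm_eulerPath_sub_le hh hM ht
  · rw [Prod.dist_eq]
    refine max_le ?_ ?_
    · rw [Real.dist_eq, abs_sub_comm, abs_of_nonneg (by linarith)]
      have : 0 ≤ h * |M| := by positivity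
      dsimp only
      linarith
    · rw [dist_comm, dist_eq_norm]
      exact (norm_eulerPath_sub_node_le hh hM ht).trans (by linarith)

end Euler

/-! ### Convergence of the Euler scheme for one-sided Lipschitz fields. -/

section Existence

variable {V : Type*} [NormedAddCommGroup V] [NormedSpace ℝ V]

theorem _root_.ContinuousOn.comp_max_zero {x : ℝ → V} (hx : ContinuousOn x (Set.Ici 0)) :
    Continuous fun t => x (max t 0) :=
  hx.comp_continuous (by fun_prop) fun t => le_max_right t 0

/-- A continuous solution of the integral equation solves the differential equation. -/
theorem isSolutionOn_of_integral_eq [CompleteSpace V] {H : ℝ → V → V}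
    (hH : Continuous (Function.uncurry H)) {x : ℝ → V} {x₀ : V}
    (hx : ContinuousOn x (Set.Ici 0))
    (h : ∀ t, 0 ≤ t → x t = x₀ + ∫ r in (0 : ℝ)..t, H r (x r)) :
    IsSolutionOn H (Set.Ici 0) x := by
  intro t ht
  -- The path is frozen to the left of `0`, which makes the integrand continuous on the whole line.
  have hc : Continuous fun r => H r (x (max r 0)) :=
    hH.comp (continuous_id.prodMk hx.comp_max_zero)
  have hd := ((hc.integral_hasStrictDerivAt 0 t).hasDerivAt.const_add x₀).hasDerivWithinAt
    (s := Set.Ici 0)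
  rw [max_eq_left (Set.mem_Ici.1 ht)] at hd
  refine hd.congr_of_mem (fun s hs => ?_) ht
  rw [h s hs]
  congr 1
  refine intervalIntegral.integral_congr fun r hr => ?_
  rw [Set.uIcc_of_le (Set.mem_Ici.1 hs)] at hr
  simp only [max_eq_left hr.1]

variable [FiniteDimensional ℝ V] (E : EnergyForm V)

/-- Two polygons with different steps are compared by Gronwall's inequality. The one-sided Lipschitz
bound controls the difference of the fields along the polygons, and the remainder consists of the
two consistency errors. No Lipschitz constant of the field enters, so the bound serves as a Cauchy
estimate for merely continuous one-sided Lipschitz fields. -/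
theorem eulerPath_energy_le {H : ℝ → V → V} {M C T η h h' : ℝ} (x₀ : V) (hC : 0 ≤ C)
    (hM : ∀ t ∈ Set.Icc 0 T, ∀ x, ‖H t x‖ ≤ M)
    (hm : ∀ t ∈ Set.Icc 0 T, ∀ x y,
      2 * E.form (x - y) (H t x - H t y) ≤ C * E.form (x - y) (x - y))
    (hh : 0 < h) (hh' : 0 < h')
    (hη : ∀ t ∈ Set.Icc 0 T, ‖eulerSlope H h x₀ t - H t (eulerPath H h x₀ t)‖ ≤ η)
    (hη' : ∀ t ∈ Set.Icc 0 T, ‖eulerSlope H h' x₀ t - H t (eulerPath H h' x₀ t)‖ ≤ η)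
    {t : ℝ} (ht : t ∈ Set.Icc 0 T) :
    E.form (eulerPath H h x₀ t - eulerPath H h' x₀ t) (eulerPath H h x₀ t - eulerPath H h' x₀ t)
      ≤ Real.exp (C * T) * (T * (8 * ‖E.form‖ * (T * M))) * η := by
  set x := eulerPath H h x₀
  set y := eulerPath H h' x₀
  -- The factor 8 is `2 * 2 * 2`: the derivative of the energy, two polygons each within `T M` of
  -- `x₀`, and two consistency errors each at most `η`.
  set b : ℝ := 8 * ‖E.form‖ * (T * M) * η with hb
  have hη0 : 0 ≤ η := (norm_nonneg _).trans (hη t ht)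
  have hM0 : 0 ≤ M := (norm_nonneg _).trans (hM t ht x₀)
  have hT : 0 ≤ T := ht.1.trans ht.2
  have hb0 : 0 ≤ b := by positivity
  have key := gronwall_right (s := 0) (T := T) (u := fun t => E.form (x t - y t) (x t - y t))
    (u' := fun t => 2 * E.form (x t - y t) (eulerSlope H h x₀ t - eulerSlope H h' x₀ t))
    (α := fun _ => C) (β := fun _ => b) (A := fun t => C * t) ?_ ?_ ?_ continuous_const ?_ ht
  · simp only [mul_zero, neg_zero, Real.exp_zero, one_mul] at key
    have h0 : x 0 - y 0 = 0 := by simp [x, y, eulerPath_zero]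
    rw [h0, map_zero, zero_add] at key
    have hI : ∫ r in (0 : ℝ)..t, Real.exp (-(C * r)) * b ≤ T * b := by
      have : ∫ r in (0 : ℝ)..t, Real.exp (-(C * r)) * b ≤ ∫ r in (0 : ℝ)..t, b := by
        refine intervalIntegral.integral_mono_on ht.1
          (Continuous.intervalIntegrable (by fun_prop) _ _)
          (Continuous.intervalIntegrable (by fun_prop) _ _) fun r hr => ?_
        refine mul_le_of_le_one_left hb0 (Real.exp_le_one_iff.2 ?_)
        have := mul_nonneg hC hr.1
        linarith
      rw [intervalIntegral.integral_const, smul_eq_mul, sub_zero] at this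
      exact this.trans (mul_le_mul_of_nonneg_right ht.2 hb0)
    have h1 := mul_le_mul_of_nonneg_left (key.trans hI) (Real.exp_pos (C * t)).le
    rw [← mul_assoc, ← Real.exp_add, add_neg_cancel, Real.exp_zero, one_mul] at h1
    refine h1.trans ?_
    have : Real.exp (C * t) ≤ Real.exp (C * T) :=
      Real.exp_le_exp.2 (mul_le_mul_of_nonneg_left ht.2 hC)
    calc _ ≤ Real.exp (C * T) * (T * b) :=
          mul_le_mul_of_nonneg_right this (mul_nonneg hT hb0)
      _ = _ := by rw [hb]; ring
  · have hx : ContinuousOn x (Set.Icc 0 T) := (continuousOn_eulerPath hh).mono Set.Icc_subset_Ici_self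
    have hy : ContinuousOn y (Set.Icc 0 T) := (continuousOn_eulerPath hh').mono Set.Icc_subset_Ici_self
    fun_prop
  · exact fun t ht => E.hasDerivWithinAt
      ((hasDerivWithinAt_eulerPath hh ht.1).sub (hasDerivWithinAt_eulerPath hh' ht.1))
  · intro t
    simpa using (hasDerivAt_id t).const_mul C
  · intro t ht
    have ht' : t ∈ Set.Icc 0 T := ⟨ht.1, ht.2.le⟩
    have h1 := hm t ht' (x t) (y t)
    have h2 : ‖x t - y t‖ ≤ 2 * (T * M) := by
      have e1 := norm_eulerPath_sub_le (x₀ := x₀) hh hM ht'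
      have e2 := norm_eulerPath_sub_le (x₀ := x₀) hh' hM ht'
      calc ‖x t - y t‖ = ‖(x t - x₀) - (y t - x₀)‖ := by congr 1; abel
        _ ≤ _ := (norm_sub_le _ _).trans (by linarith)
    have h3 : ‖(eulerSlope H h x₀ t - H t (x t)) - (eulerSlope H h' x₀ t - H t (y t))‖ ≤ 2 * η :=
      (norm_sub_le _ _).trans (by linarith [hη t ht', hη' t ht'])
    have h4 := E.apply_le (x t - y t)
      ((eulerSlope H h x₀ t - H t (x t)) - (eulerSlope H h' x₀ t - H t (y t)))
    have h5 : ‖E.form‖ * ‖x t - y t‖ *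
      ‖(eulerSlope H h x₀ t - H t (x t)) - (eulerSlope H h' x₀ t - H t (y t))‖
        ≤ ‖E.form‖ * (2 * (T * M)) * (2 * η) := by gcongr
    have h6 : E.form (x t - y t) (eulerSlope H h x₀ t - eulerSlope H h' x₀ t) =
        E.form (x t - y t) (H t (x t) - H t (y t)) + E.form (x t - y t)
          ((eulerSlope H h x₀ t - H t (x t)) - (eulerSlope H h' x₀ t - H t (y t))) := by
      rw [← map_add]; congr 1; abel
    rw [h6]
    linarith

/-- The Euler scheme converges to a solution for a field which is bounded and one-sided
Lipschitz, uniformly on bounded time intervals. -/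
theorem exists_solution_eulerPath_tendsto {H : ℝ → V → V} (hH : Continuous (Function.uncurry H))
    (hM : ∀ T, ∃ M, ∀ t ∈ Set.Icc 0 T, ∀ x, ‖H t x‖ ≤ M)
    (hm : ∀ T, ∃ C, 0 ≤ C ∧ ∀ t ∈ Set.Icc 0 T, ∀ x y,
      2 * E.form (x - y) (H t x - H t y) ≤ C * E.form (x - y) (x - y)) (x₀ : V) :
    ∃ x : ℝ → V, x 0 = x₀ ∧ IsSolutionOn H (Set.Ici 0) x ∧ ∀ t, 0 ≤ t →
      Tendsto (fun n : ℕ => eulerPath H (1 / (n + 1)) x₀ t) atTop (𝓝 (x t)) := by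
  have : CompleteSpace V := FiniteDimensional.complete ℝ V
  have hpos : ∀ n : ℕ, (0 : ℝ) < 1 / (n + 1) := fun n => Nat.one_div_pos_of_nat
  have hslope : ∀ T η : ℝ, 0 < η → ∀ᶠ n : ℕ in atTop, ∀ t ∈ Set.Icc 0 T,
      ‖eulerSlope H (1 / (n + 1)) x₀ t - H t (eulerPath H (1 / (n + 1)) x₀ t)‖ ≤ η := by
    intro T η hη
    obtain ⟨M, hM⟩ := hM T
    obtain ⟨δ, hδ, h⟩ := eulerSlope_uniform hH hM hη x₀
    filter_upwards [tendsto_one_div_add_atTop_nhds_zero_nat.eventually (gt_mem_nhds hδ)] with n hn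
    exact h _ (hpos n) hn
  have hcauchy : ∀ T, UniformCauchySeqOn (fun n : ℕ => eulerPath H (1 / (n + 1)) x₀) atTop
      (Set.Icc 0 T) := by
    intro T
    obtain ⟨M, hM⟩ := hM T
    obtain ⟨C, hC, hm⟩ := hm T
    rw [Metric.uniformCauchySeqOn_iff]
    intro ε hε
    set K := E.const⁻¹ * (Real.exp (C * T) * (T * (8 * ‖E.form‖ * (T * M)))) with hK
    -- Squared distances are at most `K η`, which is below `ε ^ 2` for this tolerance.
    have hη : 0 < ε ^ 2 / (|K| + 1) := by positivity
    obtain ⟨N, hN⟩ := eventually_atTop.1 (hslope T _ hη)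
    refine ⟨N, fun n hn n' hn' t ht => ?_⟩
    have h1 := eulerPath_energy_le E x₀ hC hM hm (hpos n) (hpos n') (hN n hn) (hN n' hn') ht
    have h2 := E.norm_sq_le (eulerPath H (1 / (n + 1)) x₀ t - eulerPath H (1 / (n' + 1)) x₀ t)
    have h3 := mul_le_mul_of_nonneg_left h1 (inv_nonneg.2 E.const_pos.le)
    rw [dist_eq_norm]
    refine lt_of_pow_lt_pow_left₀ 2 hε.le ((h2.trans h3).trans_lt ?_)
    rw [← mul_assoc, ← hK, mul_div_assoc', div_lt_iff₀ (by positivity), mul_comm]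
    have := le_abs_self K
    exact mul_lt_mul_of_pos_left (by linarith) (by positivity)
  have hlim : ∀ t, ∃ y, 0 ≤ t →
      Tendsto (fun n : ℕ => eulerPath H (1 / (n + 1)) x₀ t) atTop (𝓝 y) := by
    intro t
    by_cases ht : 0 ≤ t
    · obtain ⟨y, hy⟩ := cauchySeq_tendsto_of_complete ((hcauchy t).cauchySeq ⟨ht, le_rfl⟩)
      exact ⟨y, fun _ => hy⟩
    · exact ⟨0, fun h => absurd h ht⟩
  choose x hx using hlim
  have hunif : ∀ T, TendstoUniformlyOn (fun n : ℕ => eulerPath H (1 / (n + 1)) x₀) x atTop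
      (Set.Icc 0 T) := fun T =>
    (hcauchy T).tendstoUniformlyOn_of_tendsto fun t ht => hx t ht.1
  have hxc : ContinuousOn x (Set.Ici 0) := by
    intro t ht
    have h1 : ContinuousOn x (Set.Icc 0 (t + 1)) := (hunif (t + 1)).continuousOn
      (Frequently.of_forall fun n => (continuousOn_eulerPath (hpos n)).mono
        Set.Icc_subset_Ici_self)
    have h2 := h1 t ⟨ht, by linarith⟩
    refine h2.mono_of_mem_nhdsWithin ?_
    rw [← Set.Ici_inter_Iic]
    exact inter_mem_nhdsWithin _ (Iic_mem_nhds (by linarith))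
  have h0 : x 0 = x₀ := by
    refine tendsto_nhds_unique (hx 0 le_rfl) ?_
    simp only [eulerPath_zero]
    exact tendsto_const_nhds
  refine ⟨x, h0, isSolutionOn_of_integral_eq hH hxc (x₀ := x₀) fun t ht => ?_, fun t ht => hx t ht⟩
  obtain ⟨M, hM⟩ := hM t
  have hI : Tendsto (fun n : ℕ => ∫ r in (0 : ℝ)..t, H r (eulerPath H (1 / (n + 1)) x₀ r)) atTop
      (𝓝 (∫ r in (0 : ℝ)..t, H r (x r))) := by
    refine intervalIntegral.tendsto_integral_filter_of_dominated_convergence (fun _ => M)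
      (Eventually.of_forall fun n => ?_) (Eventually.of_forall fun n => ?_)
      intervalIntegrable_const (Eventually.of_forall fun r hr => ?_)
    · rw [Set.uIoc_of_le ht]
      refine ContinuousOn.aestronglyMeasurable ?_ measurableSet_Ioc
      exact hH.comp_continuousOn (continuousOn_id.prodMk
        ((continuousOn_eulerPath (hpos n)).mono fun r hr => hr.1.le))
    · refine Eventually.of_forall fun r hr => ?_
      rw [Set.uIoc_of_le ht] at hr
      exact hM r ⟨hr.1.le, hr.2⟩ _
    · rw [Set.uIoc_of_le ht] at hr
      exact ((hH.tendsto (r, x r)).comp (tendsto_const_nhds.prodMk_nhds (hx r hr.1.le)))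
  -- The defect of the polygon in the integral equation has right derivative at most `ε / (t + 1)`
  -- in norm and vanishes at `0`, so it stays below `ε` up to time `t`.
  have hd : Tendsto (fun n : ℕ => eulerPath H (1 / (n + 1)) x₀ t -
      (x₀ + ∫ r in (0 : ℝ)..t, H r (eulerPath H (1 / (n + 1)) x₀ r))) atTop (𝓝 0) := by
    rw [Metric.tendsto_nhds]
    intro ε hε
    filter_upwards [hslope t (ε / (t + 1)) (by positivity)] with n hn
    set y := eulerPath H (1 / (n + 1)) x₀ with hy
    have hyc : ContinuousOn y (Set.Ici 0) := continuousOn_eulerPath (hpos n)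
    have hc : Continuous fun r => H r (y (max r 0)) :=
      hH.comp (continuous_id.prodMk hyc.comp_max_zero)
    have hF : ∀ r, HasDerivAt (fun r => x₀ + ∫ s in (0 : ℝ)..r, H s (y (max s 0)))
        (H r (y (max r 0))) r := fun r => (hc.integral_hasStrictDerivAt 0 r).hasDerivAt.const_add x₀
    have hFc : Continuous fun r => x₀ + ∫ s in (0 : ℝ)..r, H s (y (max s 0)) :=
      continuous_iff_continuousAt.2 fun r => (hF r).continuousAt
    have hB : ∀ r : ℝ, HasDerivAt (fun r => ε / (t + 1) * r) (ε / (t + 1)) r := fun r => by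
      simpa using (hasDerivAt_id r).const_mul (ε / (t + 1))
    have key := image_norm_le_of_norm_deriv_right_le_deriv_boundary' (a := 0) (b := t)
      (f := fun r => y r - (x₀ + ∫ s in (0 : ℝ)..r, H s (y (max s 0))))
      (f' := fun r => eulerSlope H (1 / (n + 1)) x₀ r - H r (y (max r 0)))
      ((hyc.mono Set.Icc_subset_Ici_self).sub hFc.continuousOn)
      (fun r hr => (hasDerivWithinAt_eulerPath (hpos n) hr.1).sub (hF r).hasDerivWithinAt)
      (B := fun r => ε / (t + 1) * r) (B' := fun _ => ε / (t + 1))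
      (by simp [hy, eulerPath_zero]) (by fun_prop) (fun r _ => (hB r).hasDerivWithinAt)
      (fun r hr => by
        rw [max_eq_left hr.1]
        exact hn r ⟨hr.1, hr.2.le⟩) ⟨ht, le_rfl⟩
    have he : ∫ s in (0 : ℝ)..t, H s (y (max s 0)) = ∫ s in (0 : ℝ)..t, H s (y s) := by
      refine intervalIntegral.integral_congr fun r hr => ?_
      rw [Set.uIcc_of_le ht] at hr
      simp only [max_eq_left hr.1]
    rw [he] at key
    rw [dist_zero_right]
    refine key.trans_lt ?_
    rw [div_mul_eq_mul_div, div_lt_iff₀ (by positivity)]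
    nlinarith
  have := ((hx t ht).sub (hI.const_add x₀))
  exact sub_eq_zero.1 (tendsto_nhds_unique this hd)

end Existence

/-! ### Dissipative fields -/

section Dissipative

variable {V : Type*} [NormedAddCommGroup V] [NormedSpace ℝ V]

/-- A continuous time-dependent field which is one-sided Lipschitz with rate `α` and grows
at most linearly with source `β` with respect to an energy form. -/
structure RateBounds (E : EnergyForm V) (G : ℝ → V → V) (α β : ℝ → ℝ) : Prop where
  continuous_field : Continuous (Function.uncurry G)
  continuous_rate : Continuous α
  continuous_source : Continuous β
  source_nonneg : ∀ t, 0 ≤ β t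
  monotone : ∀ t x y,
    2 * E.form (x - y) (G t x - G t y) ≤ α t * E.form (x - y) (x - y)
  growth : ∀ t x, 2 * E.form x (G t x) ≤ α t * E.form x x + β t

theorem EnergyForm.gronwall (E : EnergyForm V) {x x' : ℝ → V} {α β A : ℝ → ℝ} {s T : ℝ}
    (hx : ContinuousOn x (Set.Icc s T))
    (hx' : ∀ t ∈ Set.Ico s T, HasDerivWithinAt x (x' t) (Set.Ici t) t)
    (hA : ∀ t, HasDerivAt A (α t) t) (hβ : Continuous β)
    (h : ∀ t ∈ Set.Ico s T, 2 * E.form (x t) (x' t) ≤ α t * E.form (x t) (x t) + β t)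
    {t : ℝ} (ht : t ∈ Set.Icc s T) :
    Real.exp (-A t) * E.form (x t) (x t) ≤
      Real.exp (-A s) * E.form (x s) (x s) + ∫ r in s..t, Real.exp (-A r) * β r :=
  gronwall_right (u := fun t => E.form (x t) (x t)) (by fun_prop)
    (fun t ht => E.hasDerivWithinAt (hx' t ht)) hA hβ h ht

theorem IsSolutionOn.continuousOn {G : ℝ → V → V} {S : Set ℝ} {x : ℝ → V}
    (h : IsSolutionOn G S x) : ContinuousOn x S := fun t ht => (h t ht).continuousWithinAt

theorem IsSolutionOn.mono {G : ℝ → V → V} {S S' : Set ℝ} {x : ℝ → V}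
    (h : IsSolutionOn G S x) (hS : S' ⊆ S) : IsSolutionOn G S' x :=
  fun t ht => (h t (hS ht)).mono hS

theorem IsSolutionOn.hasDerivWithinAt_Ici {G : ℝ → V → V} {s T t : ℝ} {x : ℝ → V}
    (h : IsSolutionOn G (Set.Icc s T) x) (ht : t ∈ Set.Ico s T) :
    HasDerivWithinAt x (G t (x t)) (Set.Ici t) t :=
  (h t ⟨ht.1, ht.2.le⟩).mono_of_mem_nhdsWithin (by
    filter_upwards [Ico_mem_nhdsGE ht.2] with r hr using ⟨ht.1.trans hr.1, hr.2.le⟩)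

theorem IsSolutionOn.comp_sub {G : ℝ → V → V} {s : ℝ} {x : ℝ → V}
    (h : IsSolutionOn (fun t => G (t + s)) (Set.Ici 0) x) :
    IsSolutionOn G (Set.Ici s) fun t => x (t - s) := by
  intro t ht
  have h1 := h (t - s) (by simpa using ht)
  have h2 : HasDerivWithinAt (fun t => t - s) 1 (Set.Ici s) t :=
    ((hasDerivAt_id t).sub_const s).hasDerivWithinAt
  have := h1.scomp t h2 (fun r hr => by simpa using hr)
  simpa [Function.comp_def] using this

namespace RateBounds

variable {E : EnergyForm V} {G : ℝ → V → V} {α β A : ℝ → ℝ}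

theorem comp_add (h : RateBounds E G α β) (s : ℝ) :
    RateBounds E (fun t => G (t + s)) (fun t => α (t + s)) fun t => β (t + s) where
  continuous_field := h.continuous_field.comp
    ((continuous_fst.add continuous_const).prodMk continuous_snd)
  continuous_rate := h.continuous_rate.comp (by fun_prop)
  continuous_source := h.continuous_source.comp (by fun_prop)
  source_nonneg _ := h.source_nonneg _
  monotone _ := h.monotone _
  growth _ := h.growth _

/-- Two solutions approach each other at the rate `α`. -/
theorem contraction (h : RateBounds E G α β) (hA : ∀ t, HasDerivAt A (α t) t) {x y : ℝ → V}
    {s T : ℝ} (hx : IsSolutionOn G (Set.Icc s T) x) (hy : IsSolutionOn G (Set.Icc s T) y)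
    {t : ℝ} (ht : t ∈ Set.Icc s T) :
    Real.exp (-A t) * E.form (x t - y t) (x t - y t) ≤
      Real.exp (-A s) * E.form (x s - y s) (x s - y s) := by
  have := E.gronwall (x := fun t => x t - y t) (β := fun _ => 0)
    (hx.continuousOn.sub hy.continuousOn)
    (fun t ht => (hx.hasDerivWithinAt_Ici ht).sub (hy.hasDerivWithinAt_Ici ht)) hA
    continuous_const (fun t _ => by simpa using h.monotone t (x t) (y t)) ht
  simpa using this

theorem energy_le (h : RateBounds E G α β) (hA : ∀ t, HasDerivAt A (α t) t) {x : ℝ → V}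
    {s T : ℝ} (hx : IsSolutionOn G (Set.Icc s T) x) {t : ℝ} (ht : t ∈ Set.Icc s T) :
    Real.exp (-A t) * E.form (x t) (x t) ≤
      Real.exp (-A s) * E.form (x s) (x s) + ∫ r in s..t, Real.exp (-A r) * β r :=
  E.gronwall hx.continuousOn (fun _ ht => hx.hasDerivWithinAt_Ici ht) hA h.continuous_source
    (fun t _ => h.growth t (x t)) ht

theorem hasDerivAt_primitive (h : RateBounds E G α β) (t : ℝ) :
    HasDerivAt (fun t => ∫ r in (0 : ℝ)..t, α r) (α t) t :=
  (h.continuous_rate.integral_hasStrictDerivAt 0 t).hasDerivAt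

/-- Contraction preserves distance zero, whatever the sign of the rate; the one-sided bound thus
gives forward uniqueness. -/
theorem eq_of_eq (h : RateBounds E G α β) {x y : ℝ → V} {s T : ℝ}
    (hx : IsSolutionOn G (Set.Icc s T) x) (hy : IsSolutionOn G (Set.Icc s T) y)
    (hs : x s = y s) {t : ℝ} (ht : t ∈ Set.Icc s T) : x t = y t := by
  have h1 := h.contraction h.hasDerivAt_primitive hx hy ht
  rw [hs, sub_self, map_zero, mul_zero] at h1
  have h2 : E.form (x t - y t) (x t - y t) ≤ 0 :=
    nonpos_of_mul_nonpos_right h1 (Real.exp_pos _)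
  have h3 := E.coercive (x t - y t)
  have h4 : ‖x t - y t‖ ^ 2 ≤ 0 := nonpos_of_mul_nonpos_right (h3.trans h2) E.const_pos
  exact sub_eq_zero.1 (norm_eq_zero.1 (pow_eq_zero_iff two_ne_zero |>.1
    (le_antisymm h4 (sq_nonneg _))))

end RateBounds

/-! ### Truncation -/

/-- A Lipschitz cutoff function of the ball of radius `R`. -/
def cutoff (R : ℝ) (x : V) : ℝ := max 0 (min 1 (R + 1 - ‖x‖))

/-- The field truncated outside the ball of radius `R`. -/
def truncField (R : ℝ) (G : ℝ → V → V) (t : ℝ) (x : V) : V := cutoff R x • G t x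

theorem cutoff_nonneg (R : ℝ) (x : V) : 0 ≤ cutoff R x := le_max_left _ _

theorem cutoff_le_one (R : ℝ) (x : V) : cutoff R x ≤ 1 :=
  max_le zero_le_one (min_le_left _ _)

theorem cutoff_eq_one {R : ℝ} {x : V} (h : ‖x‖ ≤ R) : cutoff R x = 1 := by
  rw [cutoff, min_eq_left (by linarith), max_eq_right zero_le_one]

theorem cutoff_eq_zero {R : ℝ} {x : V} (h : R + 1 ≤ ‖x‖) : cutoff R x = 0 :=
  max_eq_left ((min_le_right _ _).trans (by linarith))

theorem abs_cutoff_sub_le (R : ℝ) (x y : V) : |cutoff R x - cutoff R y| ≤ ‖x - y‖ := by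
  have h1 := abs_max_sub_max_le_max 0 (min 1 (R + 1 - ‖x‖)) 0 (min 1 (R + 1 - ‖y‖))
  have h2 := abs_min_sub_min_le_max 1 (R + 1 - ‖x‖) 1 (R + 1 - ‖y‖)
  rw [sub_self, abs_zero, max_eq_right (a := (0 : ℝ)) (b := |_|) (abs_nonneg _)] at h1 h2
  refine (h1.trans h2).trans ?_
  rw [sub_sub_sub_cancel_left, abs_sub_comm]
  exact abs_norm_sub_norm_le x y

theorem continuous_cutoff (R : ℝ) : Continuous (cutoff R : V → ℝ) := by
  unfold cutoff
  fun_prop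

variable [FiniteDimensional ℝ V] {E : EnergyForm V} {G : ℝ → V → V} {α β A : ℝ → ℝ}

theorem exists_norm_le_on_ball (hG : Continuous (Function.uncurry G)) (T R : ℝ) :
    ∃ M, 0 ≤ M ∧ ∀ t ∈ Set.Icc 0 T, ∀ x, ‖x‖ ≤ R → ‖G t x‖ ≤ M := by
  have : ProperSpace V := FiniteDimensional.proper ℝ V
  have hK : IsCompact (Set.Icc (0 : ℝ) T ×ˢ Metric.closedBall (0 : V) R) :=
    isCompact_Icc.prod (isCompact_closedBall _ _)
  obtain ⟨M, hM⟩ := hK.exists_bound_of_continuousOn hG.continuousOn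
  exact ⟨max M 0, le_max_right _ _, fun t ht x hx =>
    (hM (t, x) ⟨ht, by simpa using hx⟩).trans (le_max_left _ _)⟩

theorem norm_truncField_le {M T R : ℝ} (hM0 : 0 ≤ M)
    (hM : ∀ t ∈ Set.Icc 0 T, ∀ x, ‖x‖ ≤ R + 1 → ‖G t x‖ ≤ M) :
    ∀ t ∈ Set.Icc 0 T, ∀ x, ‖truncField R G t x‖ ≤ M := by
  intro t ht x
  rw [truncField, norm_smul, Real.norm_of_nonneg (cutoff_nonneg R x)]
  rcases le_total ‖x‖ (R + 1) with h | h
  · exact (mul_le_of_le_one_left (norm_nonneg _) (cutoff_le_one R x)).trans (hM t ht x h)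
  · rwa [cutoff_eq_zero h, zero_mul]

/-- Truncation keeps a one-sided Lipschitz bound. With `χ` the cutoff, the difference splits as
`χ(x) (G x - G y) + (χ(x) - χ(y)) G y`. The first part inherits the bound of `G` because `0 ≤ χ ≤
1`; in the second, `χ` is Lipschitz and `G y` is bounded when `y` lies in the larger ball. If only
`x` lies there the roles are exchanged, and if neither does both values vanish. -/
theorem truncField_monotone (h : RateBounds E G α β) (T R : ℝ) :
    ∃ C, 0 ≤ C ∧ ∀ t ∈ Set.Icc 0 T, ∀ x y,
      2 * E.form (x - y) (truncField R G t x - truncField R G t y)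
        ≤ C * E.form (x - y) (x - y) := by
  obtain ⟨M, hM0, hM⟩ := exists_norm_le_on_ball h.continuous_field T (R + 1)
  obtain ⟨a, ha⟩ := (isCompact_Icc (a := (0 : ℝ)) (b := T)).exists_bound_of_continuousOn
    h.continuous_rate.continuousOn
  have hin : ∀ t ∈ Set.Icc 0 T, ∀ x y : V, ‖y‖ ≤ R + 1 →
      2 * E.form (x - y) (truncField R G t x - truncField R G t y)
        ≤ (|a| + 2 * ‖E.form‖ * M * E.const⁻¹) * E.form (x - y) (x - y) := by
    intro t ht x y hy
    have e : truncField R G t x - truncField R G t y =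
        cutoff R x • (G t x - G t y) + (cutoff R x - cutoff R y) • G t y := by
      simp only [truncField, smul_sub, sub_smul]; abel
    have h1 : 2 * (cutoff R x * E.form (x - y) (G t x - G t y)) ≤
        |a| * E.form (x - y) (x - y) := by
      have e1 : α t * E.form (x - y) (x - y) ≤ |a| * E.form (x - y) (x - y) :=
        mul_le_mul_of_nonneg_right ((le_abs_self _).trans ((ha t ht).trans (le_abs_self a)))
          (E.nonneg _)
      have e2 := mul_le_mul_of_nonneg_left ((h.monotone t x y).trans e1) (cutoff_nonneg R x)
      have e3 := mul_le_of_le_one_left (mul_nonneg (abs_nonneg a) (E.nonneg (x - y)))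
        (cutoff_le_one R x)
      linarith
    have h2 : (cutoff R x - cutoff R y) * E.form (x - y) (G t y) ≤
        ‖E.form‖ * M * (E.const⁻¹ * E.form (x - y) (x - y)) := by
      calc _ ≤ |cutoff R x - cutoff R y| * |E.form (x - y) (G t y)| := by
            rw [← abs_mul]; exact le_abs_self _
        _ ≤ ‖x - y‖ * (‖E.form‖ * ‖x - y‖ * M) := by
            gcongr
            · exact abs_cutoff_sub_le R x y
            · refine (E.form.le_opNorm₂ _ _).trans ?_
              gcongr
              exact hM t ht y hy
        _ = ‖E.form‖ * M * ‖x - y‖ ^ 2 := by ring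
        _ ≤ _ := by
            gcongr
            exact E.norm_sq_le _
    rw [e, map_add, map_smul, map_smul, smul_eq_mul, smul_eq_mul]
    linarith
  refine ⟨|a| + 2 * ‖E.form‖ * M * E.const⁻¹, ?_, fun t ht x y => ?_⟩
  · have := E.const_pos
    positivity
  rcases le_total ‖y‖ (R + 1) with hy | hy
  · exact hin t ht x y hy
  rcases le_total ‖x‖ (R + 1) with hx | hx
  · have := hin t ht y x hx
    rw [← neg_sub x y, ← neg_sub (truncField R G t x)] at this
    simpa only [map_neg, neg_apply, neg_neg] using this
  · have : 0 ≤ E.form (x - y) (x - y) := E.nonneg _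
    have := E.const_pos
    simp only [truncField, cutoff_eq_zero hx, cutoff_eq_zero hy, zero_smul, sub_self, map_zero,
      mul_zero]
    positivity

/-- Solutions of the truncated equations are bounded independently of the truncation. -/
theorem exists_truncField_bound (h : RateBounds E G α β) (T : ℝ) (x₀ : V) :
    ∃ Q : ℝ, ∀ (R : ℝ) (x : ℝ → V), x 0 = x₀ → IsSolutionOn (truncField R G) (Set.Ici 0) x →
      ∀ t ∈ Set.Icc 0 T, ‖x t‖ ≤ Q := by
  -- With `|α|` in place of `α` the right side of the growth bound is nonnegative, so the bound
  -- survives multiplication by a cutoff with values in `[0, 1]`. This is what makes it independent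
  -- of `R`.
  have hα : Continuous fun t => |α t| := h.continuous_rate.abs
  have hA : ∀ t, HasDerivAt (fun t => ∫ r in (0 : ℝ)..t, |α r|) (|α t|) t := fun t =>
    (hα.integral_hasStrictDerivAt 0 t).hasDerivAt
  set A : ℝ → ℝ := fun t => ∫ r in (0 : ℝ)..t, |α r| with hAdef
  have hAc : Continuous A := continuous_iff_continuousAt.2 fun t => (hA t).continuousAt
  have hβ := h.continuous_source
  have hI : Continuous fun t => ∫ r in (0 : ℝ)..t, Real.exp (-A r) * β r :=
    intervalIntegral.continuous_primitive
      (fun a b => Continuous.intervalIntegrable (by fun_prop) a b) 0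
  have hc : Continuous fun t => E.const⁻¹ * (Real.exp (A t) *
      (E.form x₀ x₀ + ∫ r in (0 : ℝ)..t, Real.exp (-A r) * β r)) := by fun_prop
  obtain ⟨Q, hQ⟩ := (isCompact_Icc (a := (0 : ℝ)) (b := T)).exists_bound_of_continuousOn
    hc.continuousOn
  -- `Q` bounds the squared norm, and `Q ≤ (Q + 1) ^ 2` turns this into a bound of the norm.
  refine ⟨Q + 1, fun R x hx0 hx t ht => ?_⟩
  have hx' := hx.mono (Set.Icc_subset_Ici_self (b := 0) (a := T))
  have h1 := E.gronwall hx'.continuousOn (fun _ ht => hx'.hasDerivWithinAt_Ici ht) hA hβ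
    (fun t _ => ?_) ht
  · have h2 : E.form (x t) (x t) ≤ Real.exp (A t) *
        (E.form x₀ x₀ + ∫ r in (0 : ℝ)..t, Real.exp (-A r) * β r) := by
      have := mul_le_mul_of_nonneg_left h1 (Real.exp_pos (A t)).le
      rw [← mul_assoc, ← Real.exp_add, add_neg_cancel, Real.exp_zero, one_mul] at this
      refine this.trans_eq ?_
      rw [hx0]
      simp [A]
    have h3 := (E.norm_sq_le (x t)).trans
      (mul_le_mul_of_nonneg_left h2 (inv_nonneg.2 E.const_pos.le))
    have h4 := h3.trans ((le_abs_self _).trans (hQ t ht))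
    nlinarith [norm_nonneg (x t), sq_nonneg (Q - 1 / 2)]
  · rw [truncField, map_smul, smul_eq_mul]
    have e1 := mul_le_mul_of_nonneg_left (h.growth t (x t)) (cutoff_nonneg R (x t))
    have e2 : α t * E.form (x t) (x t) ≤ |α t| * E.form (x t) (x t) :=
      mul_le_mul_of_nonneg_right (le_abs_self _) (E.nonneg _)
    have e3 : 0 ≤ |α t| * E.form (x t) (x t) + β t :=
      add_nonneg (mul_nonneg (abs_nonneg _) (E.nonneg _)) (h.source_nonneg t)
    have e4 := mul_le_of_le_one_left e3 (cutoff_le_one R (x t))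
    have e5 := mul_le_mul_of_nonneg_left e2 (cutoff_nonneg R (x t))
    linarith

/-! ### Well-posedness and measurable dependence on parameters. -/

namespace RateBounds

/-- Existence of solutions, which are limits of Euler polygons of truncated fields. -/
theorem exists_solution (h : RateBounds E G α β) (x₀ : V) :
    ∃ x : ℝ → V, x 0 = x₀ ∧ IsSolutionOn G (Set.Ici 0) x ∧ ∀ t, 0 ≤ t → ∃ y : ℕ → V,
      (∀ R : ℕ, Tendsto (fun n : ℕ => eulerPath (truncField R G) (1 / (n + 1)) x₀ t) atTop
        (𝓝 (y R))) ∧ ∀ᶠ R in atTop, y R = x t := by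
  have hex := fun R : ℕ => exists_solution_eulerPath_tendsto E (H := truncField R G)
    (((continuous_cutoff (R : ℝ)).comp continuous_snd).smul h.continuous_field)
    (fun T => by
      obtain ⟨M, hM0, hM⟩ := exists_norm_le_on_ball h.continuous_field T ((R : ℝ) + 1)
      exact ⟨M, norm_truncField_le hM0 hM⟩)
    (fun T => truncField_monotone h T R) x₀
  choose Y hY0 hY hYlim using hex
  -- Once `R` exceeds the a priori bound, the truncation is not felt on `[0, T]`.
  have hR : ∀ T, ∃ R₀ : ℕ, ∀ R ≥ R₀, IsSolutionOn G (Set.Icc 0 T) (Y R) := by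
    intro T
    obtain ⟨Q, hQ⟩ := exists_truncField_bound h T x₀
    refine ⟨⌈Q⌉₊, fun R hR t ht => ?_⟩
    have h1 := hQ R (Y R) (hY0 R) (hY R) t ht
    have h2 : ‖Y R t‖ ≤ R := h1.trans (Nat.ceil_le.1 hR)
    have h3 := hY R t ht.1
    rw [truncField, cutoff_eq_one h2, one_smul] at h3
    exact h3.mono Set.Icc_subset_Ici_self
  choose R₀ hR₀ using hR
  have heq : ∀ T, ∀ R ≥ R₀ T, ∀ R' ≥ R₀ T, ∀ t ∈ Set.Icc 0 T, Y R t = Y R' t :=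
    fun T R hR R' hR' t ht =>
      h.eq_of_eq (hR₀ T R hR) (hR₀ T R' hR') ((hY0 R).trans (hY0 R').symm) ht
  have hx : ∀ T, ∀ t ∈ Set.Icc 0 T, Y (R₀ t) t = Y (R₀ T) t := fun T t ht =>
    (heq t (R₀ t) le_rfl (max (R₀ t) (R₀ T)) (le_max_left _ _) t ⟨ht.1, le_rfl⟩).trans
      (heq T (max (R₀ t) (R₀ T)) (le_max_right _ _) (R₀ T) le_rfl t ht)
  -- The truncation level depends on the time; by uniqueness the pieces agree wherever they are all
  -- genuine solutions.
  refine ⟨fun t => Y (R₀ t) t, hY0 _, fun t ht => ?_, fun t ht =>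
    ⟨fun R => Y R t, fun R => hYlim R t ht, ?_⟩⟩
  · have ht0 : 0 ≤ t := ht
    have hmem : t ∈ Set.Icc 0 (t + 1) := ⟨ht, by linarith⟩
    have h1 := hR₀ (t + 1) _ le_rfl t hmem
    have h2 : Set.Icc 0 (t + 1) ∈ 𝓝[Set.Ici 0] t := by
      rw [← Set.Ici_inter_Iic]
      exact inter_mem_nhdsWithin _ (Iic_mem_nhds (by linarith))
    have h3 := h1.mono_of_mem_nhdsWithin h2
    rw [← hx (t + 1) t hmem] at h3
    refine h3.congr_of_eventuallyEq ?_ (hx (t + 1) t hmem)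
    filter_upwards [h2] with r hr using hx (t + 1) r hr
  · filter_upwards [eventually_ge_atTop (R₀ t)] with R hR
    exact heq t R hR (R₀ t) le_rfl t ⟨ht, le_rfl⟩

theorem isWellPosed (h : RateBounds E G α β) : IsWellPosed G := by
  intro x₀
  obtain ⟨x, hx0, hx, -⟩ := h.exists_solution x₀
  refine ⟨x, ⟨hx0, hx⟩, fun y hy0 hy t ht => ?_⟩
  exact h.eq_of_eq (hy.mono Set.Icc_subset_Ici_self) (hx.mono Set.Icc_subset_Ici_self)
    (hy0.trans hx0.symm) (T := t) ⟨ht, le_rfl⟩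

end RateBounds

/-- A node is a finite composition of evaluations of the field, so it is enough that the field at a
fixed time sends measurable states to measurable values. -/
theorem measurable_eulerPath {Ω : Type*} [MeasurableSpace Ω] [MeasurableSpace V] [BorelSpace V]
    {H : Ω → ℝ → V → V}
    (hH : ∀ t (X : Ω → V), Measurable X → Measurable fun ω => H ω t (X ω)) (h : ℝ) (x₀ : V)
    (t : ℝ) : Measurable fun ω => eulerPath (H ω) h x₀ t := by
  have : ProperSpace V := FiniteDimensional.proper ℝ V
  have hn : ∀ k, Measurable fun ω => eulerNode (H ω) h x₀ k := by
    intro k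
    induction k with
    | zero => exact measurable_const
    | succ k ih => exact ih.add ((hH _ _ ih).const_smul h)
  exact (hn _).add ((hH _ _ (hn _)).const_smul _)

/-- Solutions depend measurably on a parameter on which the field depends measurably. -/
theorem measurable_solution {Ω : Type*} [MeasurableSpace Ω] [MeasurableSpace V] [BorelSpace V]
    {G : Ω → ℝ → V → V}
    (hG : ∀ t (X : Ω → V), Measurable X → Measurable fun ω => G ω t (X ω))
    (h : ∀ ω, ∃ α β, RateBounds E (G ω) α β) (x₀ : V) {x : Ω → ℝ → V} (hx0 : ∀ ω, x ω 0 = x₀)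
    (hx : ∀ ω, IsSolutionOn (G ω) (Set.Ici 0) (x ω)) {t : ℝ} (ht : 0 ≤ t) :
    Measurable fun ω => x ω t := by
  -- By uniqueness any selection of solutions equals the double limit of Euler polygons, first in
  -- the step and then in the truncation level; each limit preserves measurability.
  have hy : ∀ ω, ∃ y : ℕ → V,
      (∀ R : ℕ, Tendsto (fun n : ℕ => eulerPath (truncField R (G ω)) (1 / (n + 1)) x₀ t) atTop
        (𝓝 (y R))) ∧ ∀ᶠ R in atTop, y R = x ω t := by
    intro ω
    obtain ⟨α, β, hω⟩ := h ω
    obtain ⟨x', hx0', hx', hlim⟩ := hω.exists_solution x₀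
    have : x' t = x ω t := hω.eq_of_eq (hx'.mono Set.Icc_subset_Ici_self)
      ((hx ω).mono Set.Icc_subset_Ici_self) (hx0'.trans (hx0 ω).symm) (T := t) ⟨ht, le_rfl⟩
    rw [← this]
    exact hlim t ht
  choose y hy hyx using hy
  have hmy : ∀ R, Measurable fun ω => y ω R := fun R =>
    measurable_of_tendsto_metrizable (fun n => measurable_eulerPath
      (H := fun ω => truncField R (G ω))
      (fun t X hX => ((continuous_cutoff (R : ℝ)).measurable.comp hX).smul (hG t X hX)) _ x₀ t)
      (tendsto_pi_nhds.2 fun ω => hy ω R)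
  exact measurable_of_tendsto_metrizable hmy
    (tendsto_pi_nhds.2 fun ω => tendsto_const_nhds.congr' ((hyx ω).mono fun R h => h.symm))

end Dissipative

/-! ### Entire solutions and pullback attraction -/

/-- The primitive of the rate function vanishing at time `0`. -/
def prim (α : ℝ → ℝ) (t : ℝ) : ℝ := ∫ r in (0 : ℝ)..t, α r

/-- The energy bound of pullback solutions is `e^{A(t)}` times this tail integral. -/
def tail (α β : ℝ → ℝ) (t : ℝ) : ℝ := ∫ r in Set.Iic t, Real.exp (-prim α r) * β r

/-- The rate is negative on average in the past and the source is subexponential. -/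
def PastDecay (α β : ℝ → ℝ) : Prop :=
  ∃ κ C : ℝ, 0 < κ ∧ ∀ s ≤ 0, Real.exp (-prim α s) ≤ C * Real.exp (κ * s) ∧
    Real.exp (-prim α s) * β s ≤ C * Real.exp (κ * s)

/-- The solution of `dx/dt = G t x`, `x 0 = x₀`. -/
def flow {V : Type*} [NormedAddCommGroup V] [NormedSpace ℝ V] (G : ℝ → V → V) (x₀ : V) : ℝ → V :=
  Classical.epsilon fun x : ℝ → V => x 0 = x₀ ∧ IsSolutionOn G (Set.Ici 0) x

/-- The value at time `t` of the solution of `dx/dt = G t x`, `x s = x₀`. -/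
def evolution {V : Type*} [NormedAddCommGroup V] [NormedSpace ℝ V] (G : ℝ → V → V) (t s : ℝ)
    (x₀ : V) : V := flow (fun r => G (r + s)) x₀ (t - s)

theorem hasDerivAt_prim {α : ℝ → ℝ} (hα : Continuous α) (t : ℝ) : HasDerivAt (prim α) (α t) t :=
  (hα.integral_hasStrictDerivAt 0 t).hasDerivAt

theorem continuous_prim {α : ℝ → ℝ} (hα : Continuous α) : Continuous (prim α) :=
  continuous_iff_continuousAt.2 fun t => (hasDerivAt_prim hα t).continuousAt

section Tail

variable {α β : ℝ → ℝ}

theorem continuous_weight (hα : Continuous α) (hβ : Continuous β) :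
    Continuous fun r => Real.exp (-prim α r) * β r :=
  (Real.continuous_exp.comp (continuous_prim hα).neg).mul hβ

theorem integrableOn_tail (hα : Continuous α) (hβ : Continuous β) (hβ0 : ∀ t, 0 ≤ β t)
    (h : PastDecay α β) (t : ℝ) :
    IntegrableOn (fun r => Real.exp (-prim α r) * β r) (Set.Iic t) := by
  obtain ⟨κ, C, hκ, hC⟩ := h
  have hc := continuous_weight hα hβ
  have h0 : IntegrableOn (fun r => Real.exp (-prim α r) * β r) (Set.Iic 0) := by
    refine Integrable.mono' (g := fun r => C * Real.exp (κ * r))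
      ((integrableOn_exp_mul_Iic hκ 0).const_mul C) hc.aestronglyMeasurable ?_
    filter_upwards [ae_restrict_mem measurableSet_Iic] with s hs
    rw [Real.norm_of_nonneg (mul_nonneg (Real.exp_pos _).le (hβ0 s))]
    exact (hC s hs).2
  exact (h0.union (hc.integrableOn_Icc (a := 0) (b := t))).mono_set fun r hr =>
    (le_total r 0).imp id fun h => ⟨h, hr⟩

theorem tail_nonneg (hβ0 : ∀ t, 0 ≤ β t) (t : ℝ) : 0 ≤ tail α β t :=
  setIntegral_nonneg measurableSet_Iic fun r _ => mul_nonneg (Real.exp_pos _).le (hβ0 r)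

theorem intervalIntegral_le_tail (hα : Continuous α) (hβ : Continuous β) (hβ0 : ∀ t, 0 ≤ β t)
    (h : PastDecay α β) {s t : ℝ} (hst : s ≤ t) :
    ∫ r in s..t, Real.exp (-prim α r) * β r ≤ tail α β t := by
  rw [intervalIntegral.integral_of_le hst]
  refine setIntegral_mono_set (integrableOn_tail hα hβ hβ0 h t)
    (Eventually.of_forall fun r => mul_nonneg (Real.exp_pos _).le (hβ0 r))
    (Eventually.of_forall fun r hr => hr.2)

theorem tendsto_tail (hα : Continuous α) (hβ : Continuous β) (hβ0 : ∀ t, 0 ≤ β t)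
    (h : PastDecay α β) : Tendsto (tail α β) atBot (𝓝 0) := by
  obtain ⟨κ, C, hκ, hC⟩ := id h
  refine squeeze_zero' (Eventually.of_forall fun t => tail_nonneg hβ0 t)
    (g := fun t => C * (Real.exp (κ * t) / κ)) ?_ ?_
  · filter_upwards [eventually_le_atBot 0] with t ht
    rw [← integral_exp_mul_Iic hκ t, ← integral_const_mul]
    refine setIntegral_mono_on (integrableOn_tail hα hβ hβ0 h t)
      ((integrableOn_exp_mul_Iic hκ t).const_mul C) measurableSet_Iic fun r hr => ?_
    exact (hC r (le_trans hr ht)).2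
  · have h1 : Tendsto (fun t => Real.exp (κ * t)) atBot (𝓝 0) :=
      Real.tendsto_exp_atBot.comp (tendsto_id.const_mul_atBot hκ)
    simpa using (h1.div_const κ).const_mul C

end Tail

/-! ### Pullback limits of solutions started from zero. -/

section Pullback

variable {V : Type*} [NormedAddCommGroup V] [NormedSpace ℝ V] [FiniteDimensional ℝ V]
  {E : EnergyForm V} {G : ℝ → V → V} {α β : ℝ → ℝ}

namespace RateBounds

theorem flow_spec (h : RateBounds E G α β) (x₀ : V) :
    flow G x₀ 0 = x₀ ∧ IsSolutionOn G (Set.Ici 0) (flow G x₀) :=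
  Classical.epsilon_spec (p := fun x : ℝ → V => x 0 = x₀ ∧ IsSolutionOn G (Set.Ici 0) x)
    (let ⟨x, hx0, hx, _⟩ := h.exists_solution x₀; ⟨x, hx0, hx⟩)

theorem evolution_self (h : RateBounds E G α β) (s : ℝ) (x₀ : V) : evolution G s s x₀ = x₀ := by
  rw [evolution, sub_self]
  exact ((h.comp_add s).flow_spec x₀).1

theorem isSolutionOn_evolution (h : RateBounds E G α β) (s : ℝ) (x₀ : V) :
    IsSolutionOn G (Set.Ici s) fun t => evolution G t s x₀ :=
  ((h.comp_add s).flow_spec x₀).2.comp_sub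

theorem contraction_prim (h : RateBounds E G α β) {x y : ℝ → V} {s : ℝ}
    (hx : IsSolutionOn G (Set.Ici s) x) (hy : IsSolutionOn G (Set.Ici s) y) {t : ℝ}
    (ht : s ≤ t) :
    E.form (x t - y t) (x t - y t) ≤
      Real.exp (prim α t) * (Real.exp (-prim α s) * E.form (x s - y s) (x s - y s)) := by
  have h1 := h.contraction (hasDerivAt_prim h.continuous_rate)
    (hx.mono Set.Icc_subset_Ici_self) (hy.mono Set.Icc_subset_Ici_self) (T := t) ⟨ht, le_rfl⟩
  have h2 := mul_le_mul_of_nonneg_left h1 (Real.exp_pos (prim α t)).le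
  rwa [← mul_assoc, ← Real.exp_add, add_neg_cancel, Real.exp_zero, one_mul] at h2

/-- Starting from `0` leaves only the source in Gronwall's inequality, and extending its integral to
`-∞` removes the dependence on the starting time. -/
theorem evolution_energy_le (h : RateBounds E G α β) (hd : PastDecay α β) {s t : ℝ}
    (hst : s ≤ t) : Real.exp (-prim α t) * E.form (evolution G t s 0) (evolution G t s 0) ≤
      tail α β t := by
  have h1 := h.energy_le (hasDerivAt_prim h.continuous_rate)
    ((h.isSolutionOn_evolution s 0).mono Set.Icc_subset_Ici_self) (T := t) ⟨hst, le_rfl⟩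
  simp only [h.evolution_self, map_zero, mul_zero, zero_add] at h1
  exact h1.trans (intervalIntegral_le_tail h.continuous_rate h.continuous_source
    h.source_nonneg hd hst)

/-- At time `s` the later solution is `0`, so the difference is the earlier solution, whose weighted
energy is at most the tail at `s`; contraction carries this to time `t`. As the tail vanishes at
`-∞`, this is the Cauchy property of the pullback. -/
theorem evolution_sub_energy_le (h : RateBounds E G α β) (hd : PastDecay α β) {s' s t : ℝ}
    (hs : s' ≤ s) (hst : s ≤ t) :
    E.form (evolution G t s' 0 - evolution G t s 0) (evolution G t s' 0 - evolution G t s 0) ≤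
      Real.exp (prim α t) * tail α β s := by
  refine (h.contraction_prim ((h.isSolutionOn_evolution s' 0).mono (Set.Ici_subset_Ici.2 hs))
    (h.isSolutionOn_evolution s 0) hst).trans ?_
  rw [h.evolution_self, sub_zero]
  exact mul_le_mul_of_nonneg_left (h.evolution_energy_le hd hs) (Real.exp_pos _).le

/-- The pullback limit of the solutions starting from `0` is an entire solution. -/
theorem exists_entire (h : RateBounds E G α β) (hd : PastDecay α β) :
    ∃ ξ : ℝ → V, IsSolutionOn G Set.univ ξ ∧
      (∀ t, E.form (ξ t) (ξ t) ≤ Real.exp (prim α t) * tail α β t) ∧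
      ∀ t, Tendsto (fun s => evolution G t s 0) atBot (𝓝 (ξ t)) := by
  have : CompleteSpace V := FiniteDimensional.complete ℝ V
  have htail := tendsto_tail h.continuous_rate h.continuous_source h.source_nonneg hd
  have htail' : ∀ t, Tendsto (fun s => Real.exp (prim α t) * tail α β s) atBot (𝓝 0) := fun t => by
    simpa using htail.const_mul (Real.exp (prim α t))
  have hlim : ∀ t, ∃ y, Tendsto (fun s => evolution G t s 0) atBot (𝓝 y) := by
    intro t
    refine cauchy_map_iff_exists_tendsto.1 (Metric.cauchy_iff.2 ⟨inferInstance, fun ε hε => ?_⟩)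
    have h1 : ∀ᶠ s in atBot, Real.exp (prim α t) * tail α β s < E.const * (ε / 2) ^ 2 :=
      (htail' t).eventually (gt_mem_nhds (by have := E.const_pos; positivity))
    obtain ⟨s, hs, hst⟩ := (h1.and (eventually_le_atBot t)).exists
    have key : ∀ r ≤ s, dist (evolution G t r 0) (evolution G t s 0) < ε / 2 := by
      intro r hr
      have h2 := (E.coercive _).trans_lt ((h.evolution_sub_energy_le hd hr hst).trans_lt hs)
      rw [dist_eq_norm]
      exact lt_of_pow_lt_pow_left₀ 2 (by positivity) (lt_of_mul_lt_mul_left h2 E.const_pos.le)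
    refine ⟨(fun s => evolution G t s 0) '' Set.Iic s, image_mem_map (Iic_mem_atBot s), ?_⟩
    rintro _ ⟨r, hr, rfl⟩ _ ⟨r', hr', rfl⟩
    exact (dist_triangle_right _ _ (evolution G t s 0)).trans_lt
      (by linarith [key r hr, key r' hr'])
  choose ξ hξ using hlim
  have hcE : Continuous fun v : V => E.form v v := by fun_prop
  -- Contraction makes the evolution continuous in its initial value, so it carries the pullback
  -- limit at `s` to the one at `t`.
  have heq : ∀ s t, s ≤ t → evolution G t s (ξ s) = ξ t := by
    intro s t hst
    refine tendsto_nhds_unique (E.tendsto_of_form (l := atBot) (x := fun r => evolution G t r 0) ?_)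
      (hξ t)
    have h1 : Tendsto (fun r => Real.exp (prim α t) * (Real.exp (-prim α s) *
        E.form (evolution G s r 0 - ξ s) (evolution G s r 0 - ξ s))) atBot (𝓝 0) := by
      have := ((hcE.tendsto _).comp ((hξ s).sub_const (ξ s))).const_mul (Real.exp (-prim α s))
        |>.const_mul (Real.exp (prim α t))
      simpa using this
    refine squeeze_zero' (Eventually.of_forall fun r => E.nonneg _) ?_ h1
    filter_upwards [eventually_le_atBot s] with r hr
    have := h.contraction_prim ((h.isSolutionOn_evolution r 0).mono (Set.Ici_subset_Ici.2 hr))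
      (h.isSolutionOn_evolution s (ξ s)) hst
    rwa [h.evolution_self] at this
  refine ⟨ξ, fun t _ => ?_, fun t => ?_, hξ⟩
  · have h1 := h.isSolutionOn_evolution (t - 1) (ξ (t - 1)) t (by simp)
    have h2 : HasDerivAt (fun r => evolution G r (t - 1) (ξ (t - 1)))
        (G t (evolution G t (t - 1) (ξ (t - 1)))) t := h1.hasDerivAt (Ici_mem_nhds (by linarith))
    rw [heq (t - 1) t (by linarith)] at h2
    refine (h2.congr_of_eventuallyEq ?_).hasDerivWithinAt
    filter_upwards [Ici_mem_nhds (show t - 1 < t by linarith)] with r hr using (heq _ _ hr).symm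
  · refine le_of_tendsto ((hcE.tendsto _).comp (hξ t)) ?_
    filter_upwards [eventually_le_atBot t] with s hs
    have h1 := mul_le_mul_of_nonneg_left (h.evolution_energy_le hd hs)
      (Real.exp_pos (prim α t)).le
    rwa [← mul_assoc, ← Real.exp_add, add_neg_cancel, Real.exp_zero, one_mul] at h1

end RateBounds

end Pullback

/-! ### Singleton random attractors of dissipative systems -/

theorem hausdorffSemidist_singleton {V : Type*} [NormedAddCommGroup V] (A : Set V) (b : V) :
    hausdorffSemidist A {b} = ⨆ a ∈ A, edist a b := by
  simp [hausdorffSemidist]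

section Attractor

variable {m : ℕ} {V : Type*} [NormedAddCommGroup V] [NormedSpace ℝ V] [FiniteDimensional ℝ V]

/-- A random differential equation over the Wiener shift with dissipative fields. -/
structure DissipativeRODE (Ω' : Set (WienerSpace m)) (E : EnergyForm V)
    (G : WienerSpace m → ℝ → V → V) (α β : WienerSpace m → ℝ → ℝ) : Prop where
  shift_mem : ∀ ω ∈ Ω', ∀ s, shift s ω ∈ Ω'
  cocycle : ∀ ω ∈ Ω', ∀ s, G (shift s ω) = fun r => G ω (r + s)
  rateBounds : ∀ ω ∈ Ω', RateBounds E (G ω) (α ω) (β ω)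
  pastDecay : ∀ ω ∈ Ω', PastDecay (α ω) (β ω)
  measurable : ∀ [MeasurableSpace V] [BorelSpace V] (t : ℝ) (X : Ω' → V), Measurable X →
    Measurable fun ω : Ω' => G ω t (X ω)

namespace DissipativeRODE

variable {Ω' : Set (WienerSpace m)} {E : EnergyForm V} {G : WienerSpace m → ℝ → V → V}
  {α β : WienerSpace m → ℝ → ℝ}

theorem solutionFlow_shift (h : DissipativeRODE Ω' E G α β) {ω : WienerSpace m} (hω : ω ∈ Ω')
    (r s : ℝ) (x₀ : V) : solutionFlow G r (shift s ω) x₀ = evolution (G ω) (r + s) s x₀ := by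
  rw [evolution, add_sub_cancel_right, ← h.cocycle ω hω s]
  rfl

/-- A singleton attractor is the pullback limit of the solutions starting from `0`. -/
theorem tendsto_evolution (h : DissipativeRODE Ω' E G α β) {a : WienerSpace m → V}
    (ha : IsSingletonAttractor Ω' (solutionFlow G) a) {ω : WienerSpace m} (hω : ω ∈ Ω') (t : ℝ) :
    Tendsto (fun s => evolution (G ω) t s 0) atBot (𝓝 (a (shift t ω))) := by
  have hD : IsTempered Ω' (fun _ : WienerSpace m => ({0} : Set V)) :=
    ⟨fun x => measurable_const, fun _ _ => Bornology.isBounded_singleton, fun _ _ k _ => by simp⟩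
  have h1 := ha.attracting _ hD (shift t ω) (h.shift_mem ω hω t)
  simp only [hausdorffSemidist_singleton, Set.image_singleton, Set.mem_singleton_iff,
    iSup_iSup_eq_left] at h1
  rw [← tendsto_iff_edist_tendsto_0] at h1
  have h2 := h1.comp (tendsto_const_nhds.add_atTop (tendsto_neg_atBot_atTop (G := ℝ)) :
    Tendsto (fun s : ℝ => t + -s) atBot atTop)
  refine h2.congr fun s => ?_
  rw [Function.comp_apply, h.solutionFlow_shift (h.shift_mem ω hω t), h.cocycle ω hω t]
  simp only [evolution]
  congr 1
  · funext r
    congr 1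
    ring
  · ring

/-- The trajectory of a singleton attractor is an entire solution with a pullback energy bound. -/
theorem isSolutionOn_attractor (h : DissipativeRODE Ω' E G α β) {a : WienerSpace m → V}
    (ha : IsSingletonAttractor Ω' (solutionFlow G) a) {ω : WienerSpace m} (hω : ω ∈ Ω') :
    IsSolutionOn (G ω) Set.univ (fun t => a (shift t ω)) ∧
      ∀ t, E.form (a (shift t ω)) (a (shift t ω)) ≤
        Real.exp (prim (α ω) t) * tail (α ω) (β ω) t := by
  obtain ⟨ξ, hξ, hb, hlim⟩ := (h.rateBounds ω hω).exists_entire (h.pastDecay ω hω)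
  have : (fun t => a (shift t ω)) = ξ :=
    funext fun t => tendsto_nhds_unique (h.tendsto_evolution ha hω t) (hlim t)
  refine ⟨this ▸ hξ, fun t => ?_⟩
  have ht : a (shift t ω) = ξ t := congrFun this t
  rw [ht]
  exact hb t

/-- A dissipative random differential equation has a singleton random attractor. -/
theorem exists_attractor (h : DissipativeRODE Ω' E G α β) :
    ∃ a : WienerSpace m → V, IsSingletonAttractor Ω' (solutionFlow G) a := by
  have hent : ∀ ω, ∃ ξ : ℝ → V, ω ∈ Ω' → IsSolutionOn (G ω) Set.univ ξ ∧
      (∀ t, E.form (ξ t) (ξ t) ≤ Real.exp (prim (α ω) t) * tail (α ω) (β ω) t) ∧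
      ∀ t, Tendsto (fun s => evolution (G ω) t s 0) atBot (𝓝 (ξ t)) := by
    intro ω
    by_cases hω : ω ∈ Ω'
    · obtain ⟨ξ, hξ⟩ := (h.rateBounds ω hω).exists_entire (h.pastDecay ω hω)
      exact ⟨ξ, fun _ => hξ⟩
    · exact ⟨0, fun h => absurd h hω⟩
  choose ξ hξ using hent
  -- The cocycle property identifies the pullback limit at `0` over the shifted path with the one at
  -- `t`; invariance of the attractor is then the fact that `ξ ω` is a solution.
  have hshift : ∀ ω ∈ Ω', ∀ t, ξ (shift t ω) 0 = ξ ω t := by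
    intro ω hω t
    have h1 := (hξ _ (h.shift_mem ω hω t)).2.2 0
    have h2 := ((hξ ω hω).2.2 t).comp (tendsto_atBot_add_const_right atBot t tendsto_id)
    refine tendsto_nhds_unique (h1.congr fun s => ?_) h2
    simp only [evolution, h.cocycle ω hω t, Function.comp_apply, id]
    congr 1
    · funext r
      congr 1
      ring
    · ring
  refine ⟨fun ω => ξ ω 0, ?_, fun ω _ => Set.singleton_nonempty _,
    fun ω _ => isCompact_singleton, ?_, ?_⟩
  · intro x
    let : MeasurableSpace V := borel V
    have : BorelSpace V := ⟨rfl⟩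
    -- Measurability passes to the pullback limit along integer starting times.
    have hm : ∀ n : ℕ, Measurable fun ω : Ω' => evolution (G ω) 0 (-(n : ℝ)) 0 := by
      intro n
      have h0 : ∀ ω : Ω', RateBounds E (fun r => G ω (r + -(n : ℝ))) _ _ := fun ω =>
        (h.rateBounds ω ω.2).comp_add (-(n : ℝ))
      refine measurable_solution (E := E) (Ω := Ω') (G := fun ω r => G ω (r + -(n : ℝ)))
        (fun t X hX => h.measurable _ X hX) (fun ω => ⟨_, _, h0 ω⟩) 0
        (fun ω => ((h0 ω).flow_spec 0).1) (fun ω => ((h0 ω).flow_spec 0).2) (by simp)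
    have ha : Measurable fun ω : Ω' => ξ ω 0 :=
      measurable_of_tendsto_metrizable hm (tendsto_pi_nhds.2 fun ω =>
        ((hξ ω ω.2).2.2 0).comp (tendsto_neg_atTop_atBot.comp tendsto_natCast_atTop_atTop))
    simp only [Metric.infDist_singleton]
    exact (continuous_const.dist continuous_id).measurable.comp ha
  · intro ω hω t ht
    rw [Set.image_singleton]
    change _ = {ξ (shift t ω) 0}
    rw [hshift ω hω t]
    congr 1
    have h1 := (h.rateBounds ω hω).flow_spec (ξ ω 0)
    exact (h.rateBounds ω hω).eq_of_eq (h1.2.mono Set.Icc_subset_Ici_self)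
      ((hξ ω hω).1.mono (Set.subset_univ _)) h1.1 (T := t) ⟨ht, le_rfl⟩
  · intro D hD ω hω
    obtain ⟨κ, C, hκ, hC⟩ := h.pastDecay ω hω
    have hr := h.rateBounds ω hω
    set S : ℝ → ℝ := fun t => sSup ((fun u => ‖u‖) '' D (shift (-t) ω)) with hS
    -- The energy is quadratic in the state and carries the weight `e^{-κ t} = (e^{-κ t / 2}) ^ 2`,
    -- so temperedness is needed with exponent `κ / 2`. The tail term accounts for the entire
    -- solution at time `-t`.
    set W : ℝ → ℝ := fun t => Real.sqrt (E.const⁻¹ * (2 * (C * ‖E.form‖ *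
      (Real.exp (-(κ / 2) * t) * S t) ^ 2) + 2 * tail (α ω) (β ω) (-t))) with hW
    have hWlim : Tendsto W atTop (𝓝 0) := by
      have h1 := hD.tempered ω hω (κ / 2) (by positivity)
      have h2 := (tendsto_tail hr.continuous_rate hr.continuous_source hr.source_nonneg
        (h.pastDecay ω hω)).comp tendsto_neg_atTop_atBot
      have := ((((h1.pow 2).const_mul (C * ‖E.form‖)).const_mul 2).add
        (h2.const_mul 2)).const_mul E.const⁻¹ |>.sqrt
      simpa [hW, hS] using this
    have hle : ∀ᶠ t in atTop, hausdorffSemidist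
        (solutionFlow G t (shift (-t) ω) '' D (shift (-t) ω)) {ξ ω 0} ≤ ENNReal.ofReal (W t) := by
      filter_upwards [eventually_ge_atTop 0] with t ht
      rw [hausdorffSemidist_singleton]
      refine iSup₂_le ?_
      rintro _ ⟨u, hu, rfl⟩
      rw [h.solutionFlow_shift hω, add_neg_cancel, edist_dist, dist_eq_norm]
      refine ENNReal.ofReal_le_ofReal (Real.le_sqrt_of_sq_le ((E.norm_sq_le _).trans
        (mul_le_mul_of_nonneg_left ?_ (inv_nonneg.2 E.const_pos.le))))
      have h1 := hr.contraction_prim (hr.isSolutionOn_evolution (-t) u)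
        ((hξ ω hω).1.mono (Set.subset_univ _)) (neg_nonpos.2 ht)
      have hp0 : prim (α ω) 0 = 0 := by simp [prim]
      rw [hp0, Real.exp_zero, one_mul, hr.evolution_self] at h1
      refine h1.trans ?_
      have h2 := E.sub_self_le u (ξ ω (-t))
      have h3 := mul_le_mul_of_nonneg_left h2 (Real.exp_pos (-prim (α ω) (-t))).le
      have h4 : Real.exp (-prim (α ω) (-t)) * E.form (ξ ω (-t)) (ξ ω (-t)) ≤
          tail (α ω) (β ω) (-t) := by
        have := mul_le_mul_of_nonneg_left ((hξ ω hω).2.1 (-t))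
          (Real.exp_pos (-prim (α ω) (-t))).le
        rwa [← mul_assoc, ← Real.exp_add, neg_add_cancel, Real.exp_zero, one_mul] at this
      have hbdd : BddAbove ((fun u => ‖u‖) '' D (shift (-t) ω)) := by
        obtain ⟨R, hR⟩ := (hD.bounded _ (h.shift_mem ω hω (-t))).exists_norm_le
        exact ⟨R, by rintro _ ⟨v, hv, rfl⟩; exact hR v hv⟩
      have h5 : ‖u‖ ≤ S t := le_csSup hbdd ⟨u, hu, rfl⟩
      have h6 : E.form u u ≤ ‖E.form‖ * S t ^ 2 := (E.self_le u).trans (by gcongr)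
      have h7 : Real.exp (-prim (α ω) (-t)) * E.form u u ≤
          (C * Real.exp (κ * -t)) * (‖E.form‖ * S t ^ 2) :=
        mul_le_mul (hC (-t) (neg_nonpos.2 ht)).1 h6 (E.nonneg u)
          ((Real.exp_pos _).le.trans (hC (-t) (neg_nonpos.2 ht)).1)
      have h8 : Real.exp (κ * -t) = Real.exp (-(κ / 2) * t) ^ 2 := by
        rw [← Real.exp_nat_mul]; congr 1; push_cast; ring
      rw [h8] at h7
      calc _ ≤ _ := h3
        _ = 2 * (Real.exp (-prim (α ω) (-t)) * E.form u u) +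
          2 * (Real.exp (-prim (α ω) (-t)) * E.form (ξ ω (-t)) (ξ ω (-t))) := by ring
        _ ≤ 2 * ((C * Real.exp (-(κ / 2) * t) ^ 2) * (‖E.form‖ * S t ^ 2)) +
          2 * tail (α ω) (β ω) (-t) := by linarith
        _ = _ := by ring
    refine tendsto_of_tendsto_of_tendsto_of_le_of_le' tendsto_const_nhds ?_
      (Eventually.of_forall fun _ => zero_le) hle
    simpa using ENNReal.tendsto_ofReal hWlim

end DissipativeRODE

end Attractor

/-! ### Energy forms of inner product spaces and their powers -/

section Forms

variable {H : Type*} [NormedAddCommGroup H] [InnerProductSpace ℝ H]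

/-- The inner product as an energy form. -/
def innerForm (H : Type*) [NormedAddCommGroup H] [InnerProductSpace ℝ H] : EnergyForm H where
  form := innerSL ℝ
  symm x y := real_inner_comm y x
  const := 1
  const_pos := one_pos
  coercive x := by rw [one_mul, ← real_inner_self_eq_norm_sq]; exact le_rfl

theorem innerForm_apply (x y : H) : (innerForm H).form x y = inner ℝ x y := rfl

/-- The sum of the inner products of the components as an energy form. -/
def sumForm (H : Type*) [NormedAddCommGroup H] [InnerProductSpace ℝ H] (ι : Type*) [Fintype ι] :
    EnergyForm (ι → H) where
  form := ∑ j : ι, (innerSL ℝ).bilinearComp (ContinuousLinearMap.proj (R := ℝ) (φ := fun _ => H) j)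
    (ContinuousLinearMap.proj (R := ℝ) (φ := fun _ => H) j)
  symm x y := by simp [sum_apply, real_inner_comm]
  const := 1
  const_pos := one_pos
  coercive x := by
    have h : ‖x‖ ≤ Real.sqrt (∑ j, ‖x j‖ ^ 2) :=
      (pi_norm_le_iff_of_nonneg (Real.sqrt_nonneg _)).2 fun j => Real.le_sqrt_of_sq_le
        (Finset.single_le_sum (f := fun j => ‖x j‖ ^ 2) (fun _ _ => sq_nonneg _)
          (Finset.mem_univ j))
    have h2 := pow_le_pow_left₀ (norm_nonneg x) h 2
    rw [Real.sq_sqrt (Finset.sum_nonneg fun _ _ => sq_nonneg _)] at h2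
    simpa [sum_apply, real_inner_self_eq_norm_sq] using h2

theorem sumForm_apply {ι : Type*} [Fintype ι] (x y : ι → H) :
    (sumForm H ι).form x y = ∑ j, inner ℝ (x j) (y j) := by
  simp [sumForm, sum_apply]

theorem sumForm_self {ι : Type*} [Fintype ι] (x : ι → H) :
    (sumForm H ι).form x x = ∑ j, ‖x j‖ ^ 2 := by
  simp [sumForm_apply]

end Forms

/-- Young's inequality: expand `κ⁻¹ E(κ x - y, κ x - y) ≥ 0`. -/
theorem EnergyForm.two_mul_form_le {V : Type*} [NormedAddCommGroup V] [NormedSpace ℝ V]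
    (E : EnergyForm V) {κ : ℝ} (hκ : 0 < κ) (x y : V) :
    2 * E.form x y ≤ κ * E.form x x + κ⁻¹ * E.form y y := by
  have h := mul_nonneg (inv_nonneg.2 hκ.le) (E.nonneg (κ • x - y))
  have hs := E.symm x y
  simp only [map_sub, map_smul, sub_apply, smul_apply, smul_eq_mul] at h
  have e : κ⁻¹ * (κ * (κ * E.form x x - E.form y x) - (κ * E.form x y - E.form y y)) =
      κ * E.form x x - E.form y x - E.form x y + κ⁻¹ * E.form y y := by
    field_simp
    ring
  linarith

/-- Comparing with the state `0` produces the cross term `2 E(x, G t 0)`. The spare rate `κ` absorbs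
it by Young's inequality and leaves the energy of `G t 0` as the source. -/
theorem RateBounds.of_monotone {V : Type*} [NormedAddCommGroup V] [NormedSpace ℝ V]
    {E : EnergyForm V} {G : ℝ → V → V} {α β : ℝ → ℝ} {κ : ℝ} (hκ : 0 < κ)
    (hG : Continuous (Function.uncurry G)) (hα : Continuous α) (hβ : Continuous β)
    (hm : ∀ t x y, 2 * E.form (x - y) (G t x - G t y) ≤ (α t - κ) * E.form (x - y) (x - y))
    (h0 : ∀ t, κ⁻¹ * E.form (G t 0) (G t 0) ≤ β t) : RateBounds E G α β where
  continuous_field := hG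
  continuous_rate := hα
  continuous_source := hβ
  source_nonneg t := (mul_nonneg (inv_nonneg.2 hκ.le) (E.nonneg _)).trans (h0 t)
  monotone t x y := (hm t x y).trans
    (mul_le_mul_of_nonneg_right (by linarith) (E.nonneg _))
  growth t x := by
    have h1 := hm t x 0
    have h2 := E.two_mul_form_le hκ x (G t 0)
    have h3 := h0 t
    rw [sub_zero, map_sub] at h1
    linarith

/-! ### The cyclic Laplacian -/

section Laplacian

variable {N : ℕ} [NeZero N] {H : Type*} [NormedAddCommGroup H] [InnerProductSpace ℝ H]

/-- The cyclic Laplacian. -/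
def lap (x : Fin N → H) (j : Fin N) : H := x (j - 1) - (2 : ℝ) • x j + x (j + 1)

/-- The cyclic Dirichlet form. -/
def dirichlet (x : Fin N → H) : ℝ := ∑ j, ‖x (j + 1) - x j‖ ^ 2

theorem sum_add_one {M : Type*} [AddCommMonoid M] (g : Fin N → M) :
    ∑ j, g (j + 1) = ∑ j, g j := Equiv.sum_comp (Equiv.addRight (1 : Fin N)) g

theorem sum_sub_one {M : Type*} [AddCommMonoid M] (g : Fin N → M) :
    ∑ j, g (j - 1) = ∑ j, g j := Equiv.sum_comp (Equiv.subRight (1 : Fin N)) g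

theorem sum_lap (x : Fin N → H) : ∑ j, lap x j = 0 := by
  simp only [lap, Finset.sum_add_distrib, Finset.sum_sub_distrib, sum_add_one, sum_sub_one,
    two_smul]
  abel

theorem lap_sub (x y : Fin N → H) (j : Fin N) : lap (x - y) j = lap x j - lap y j := by
  simp only [lap, Pi.sub_apply, smul_sub]
  abel

theorem lap_const (c : H) (j : Fin N) : lap (fun _ => c) j = 0 := by
  simp only [lap, two_smul]
  abel

/-- Summation by parts on the cycle. -/
theorem sum_inner_lap (x : Fin N → H) : ∑ j, inner ℝ (x j) (lap x j) = -dirichlet x := by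
  have h1 : ∑ j, inner ℝ (x j) (x (j - 1)) = ∑ j, inner ℝ (x (j + 1)) (x j) := by
    rw [← sum_add_one fun j => inner ℝ (x j) (x (j - 1))]
    simp
  have h2 : ∑ j, ‖x (j + 1)‖ ^ 2 = ∑ j, ‖x j‖ ^ 2 := sum_add_one fun j => ‖x j‖ ^ 2
  have h3 : ∀ j, ‖x (j + 1) - x j‖ ^ 2 =
      ‖x (j + 1)‖ ^ 2 - 2 * inner ℝ (x (j + 1)) (x j) + ‖x j‖ ^ 2 := fun j =>
    norm_sub_sq_real _ _
  have h4 : ∀ j, inner ℝ (x j) (lap x j) =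
      inner ℝ (x j) (x (j - 1)) - 2 * ‖x j‖ ^ 2 + inner ℝ (x (j + 1)) (x j) := fun j => by
    rw [lap, inner_add_right, inner_sub_right, inner_smul_right, real_inner_self_eq_norm_sq,
      real_inner_comm (x j) (x (j + 1))]
  simp only [dirichlet, h3, h4, Finset.sum_add_distrib, Finset.sum_sub_distrib, ← Finset.mul_sum,
    h1, h2]
  ring

/-- Telescope along the chain from `0` to `j`, enlarge to the full cycle, and apply the
Cauchy-Schwarz inequality to its `N` increments. -/
theorem norm_sub_zero_sq_le (x : Fin N → H) (j : Fin N) :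
    ‖x j - x 0‖ ^ 2 ≤ N * dirichlet x := by
  have h1 : ∀ k : ℕ, ‖x (Fin.ofNat N k) - x 0‖ ≤
      ∑ i ∈ Finset.range k, ‖x (Fin.ofNat N i + 1) - x (Fin.ofNat N i)‖ := by
    intro k
    induction k with
    | zero => simp
    | succ k ih =>
      rw [Finset.sum_range_succ]
      have e : Fin.ofNat N (k + 1) = Fin.ofNat N k + 1 := by
        apply Fin.ext
        simp [Fin.val_add, Fin.ofNat]
      rw [e]
      calc _ = ‖(x (Fin.ofNat N k) - x 0) + (x (Fin.ofNat N k + 1) - x (Fin.ofNat N k))‖ := by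
            congr 1; abel
        _ ≤ _ := (norm_add_le _ _).trans (by linarith)
  have hj : Fin.ofNat N (j : ℕ) = j := by
    apply Fin.ext
    simp [Fin.ofNat, Nat.mod_eq_of_lt j.2]
  have h2 : ‖x j - x 0‖ ≤ ∑ i : Fin N, ‖x (i + 1) - x i‖ := by
    have := h1 j
    rw [hj] at this
    refine this.trans ?_
    have e : ∑ i : Fin N, ‖x (i + 1) - x i‖ =
        ∑ i ∈ Finset.range N, ‖x (Fin.ofNat N i + 1) - x (Fin.ofNat N i)‖ := by
      rw [← Fin.sum_univ_eq_sum_range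
        (fun i => ‖x (Fin.ofNat N i + 1) - x (Fin.ofNat N i)‖) N]
      refine Finset.sum_congr rfl fun i _ => ?_
      have hi : Fin.ofNat N (i : ℕ) = i := by
        apply Fin.ext
        simp [Fin.ofNat, Nat.mod_eq_of_lt i.2]
      rw [hi]
    rw [e]
    exact Finset.sum_le_sum_of_subset_of_nonneg (Finset.range_mono j.2.le)
      fun _ _ _ => norm_nonneg _
  refine (pow_le_pow_left₀ (norm_nonneg _) h2 2).trans ?_
  simpa [dirichlet] using
    sq_sum_le_card_mul_sum_sq (s := Finset.univ) (f := fun i : Fin N => ‖x (i + 1) - x i‖)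

/-- The average of a finite family. -/
def avg (x : Fin N → H) : H := (1 / (N : ℝ)) • ∑ j, x j

theorem natCast_pos' : (0 : ℝ) < N := Nat.cast_pos.2 (NeZero.pos N)

theorem sum_sub_avg (x : Fin N → H) : ∑ j, (x j - avg x) = 0 := by
  have := (natCast_pos' (N := N)).ne'
  rw [Finset.sum_sub_distrib, Finset.sum_const, Finset.card_univ, Fintype.card_fin,
    ← Nat.cast_smul_eq_nsmul ℝ, avg, smul_smul, mul_one_div_cancel this, one_smul, sub_self]

theorem sum_norm_sub_avg_sq (x : Fin N → H) :
    ∑ j, ‖x j - avg x‖ ^ 2 = ∑ j, ‖x j‖ ^ 2 - N * ‖avg x‖ ^ 2 := by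
  have h1 : ∑ j, inner ℝ (x j - avg x) (avg x) = 0 := by
    rw [← sum_inner, sum_sub_avg, inner_zero_left]
  have h2 : ∀ j, ‖x j‖ ^ 2 = ‖x j - avg x‖ ^ 2 + 2 * inner ℝ (x j - avg x) (avg x)
      + ‖avg x‖ ^ 2 := fun j => by
    rw [← norm_add_sq_real, sub_add_cancel]
  simp only [h2, Finset.sum_add_distrib, ← Finset.mul_sum, h1, Finset.sum_const, Finset.card_univ,
    Fintype.card_fin, nsmul_eq_mul]
  ring

theorem norm_avg_sq_le (x : Fin N → H) : ‖avg x‖ ^ 2 ≤ ∑ j, ‖x j‖ ^ 2 := by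
  have h1 : 0 ≤ ∑ j, ‖x j - avg x‖ ^ 2 := Finset.sum_nonneg fun _ _ => sq_nonneg _
  rw [sum_norm_sub_avg_sq] at h1
  have h2 : (1 : ℝ) ≤ N := Nat.one_le_cast.2 (NeZero.pos N)
  nlinarith [sq_nonneg ‖avg x‖]

/-- The Poincaré inequality of the cyclic graph. -/
theorem sum_norm_sq_le_dirichlet {y : Fin N → H} (hy : ∑ j, y j = 0) :
    ∑ j, ‖y j‖ ^ 2 ≤ (N : ℝ) ^ 2 * dirichlet y := by
  have h1 : ∑ j, ‖y j - y 0‖ ^ 2 ≤ (N : ℝ) ^ 2 * dirichlet y := by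
    refine (Finset.sum_le_sum fun j _ => norm_sub_zero_sq_le y j).trans_eq ?_
    rw [Finset.sum_const, Finset.card_univ, Fintype.card_fin, nsmul_eq_mul]
    ring
  -- For a family with sum zero, recentring at `y 0` adds `N ‖y 0‖²` to the sum of squares, hence
  -- can only increase it.
  refine le_trans ?_ h1
  have h2 : ∑ j, inner ℝ (y j) (y 0) = 0 := by rw [← sum_inner, hy, inner_zero_left]
  simp only [norm_sub_sq_real, Finset.sum_add_distrib, Finset.sum_sub_distrib, ← Finset.mul_sum, h2]
  have : 0 ≤ ∑ _j : Fin N, ‖y 0‖ ^ 2 := Finset.sum_nonneg fun _ _ => sq_nonneg _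
  linarith

/-- Strong coupling averages a diagonal quadratic form. -/
theorem sum_mul_norm_sq_le (o : Fin N → ℝ) (w : Fin N → H) {ν : ℝ} (hν : 0 < ν) :
    2 * ∑ j, o j * ‖w j‖ ^ 2 - 2 * ν * dirichlet w ≤
      (2 * avg o + 2 * N ^ 2 / ν * ∑ j, o j ^ 2) * ∑ j, ‖w j‖ ^ 2 := by
  have hN := natCast_pos' (N := N)
  set Q := ∑ j, ‖w j‖ ^ 2 with hQ
  have hQj : ∀ j, ‖w j‖ ^ 2 ≤ Q := fun j =>
    Finset.single_le_sum (f := fun j => ‖w j‖ ^ 2) (fun _ _ => sq_nonneg _) (Finset.mem_univ j)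
  set D := dirichlet w with hD
  have hsum : ∑ j, (o j - avg o) = 0 := sum_sub_avg o
  -- The deviations `o j - avg o` sum to zero, so `‖w 0‖²` may be subtracted from every `‖w j‖²`.
  -- The difference of squares contains the factor `‖w j - w 0‖`, which the Dirichlet form controls.
  -- Young's weights are chosen so that the `N` terms together use exactly `2 ν D`.
  have hterm : ∀ j, 2 * ((o j - avg o) * (‖w j‖ ^ 2 - ‖w 0‖ ^ 2)) ≤
      2 * ν / N * D + 2 * N ^ 2 / ν * Q * (o j - avg o) ^ 2 := by
    intro j
    set a := o j - avg o
    have h1 : |‖w j‖ ^ 2 - ‖w 0‖ ^ 2| ≤ ‖w j - w 0‖ * (‖w j‖ + ‖w 0‖) := by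
      rw [sq_sub_sq, abs_mul, abs_of_nonneg (by positivity : 0 ≤ ‖w j‖ + ‖w 0‖), mul_comm]
      exact mul_le_mul_of_nonneg_right (abs_norm_sub_norm_le _ _) (by positivity)
    set δ := ‖w j - w 0‖
    set S := ‖w j‖ + ‖w 0‖
    have h2 : a * (‖w j‖ ^ 2 - ‖w 0‖ ^ 2) ≤ |a| * (δ * S) :=
      (le_abs_self _).trans (by rw [abs_mul]; exact mul_le_mul_of_nonneg_left h1 (abs_nonneg a))
    have h3 : δ ^ 2 ≤ N * D := norm_sub_zero_sq_le w j
    have h4 : S ^ 2 ≤ 4 * Q := by nlinarith [hQj j, hQj 0, sq_nonneg (‖w j‖ - ‖w 0‖)]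
    have h5 : 2 * (|a| * (δ * S)) ≤ 2 * ν / N ^ 2 * δ ^ 2 + N ^ 2 / (2 * ν) * (a ^ 2 * S ^ 2) := by
      have e : 2 * ν / N ^ 2 * δ ^ 2 + N ^ 2 / (2 * ν) * (a ^ 2 * S ^ 2) - 2 * (|a| * (δ * S)) =
          N ^ 2 / (2 * ν) * (2 * ν / N ^ 2 * δ - |a| * S) ^ 2 := by
        rw [← sq_abs a]
        field_simp
        ring
      have : 0 ≤ (N : ℝ) ^ 2 / (2 * ν) * (2 * ν / N ^ 2 * δ - |a| * S) ^ 2 := by positivity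
      linarith
    have h6 : 2 * ν / N ^ 2 * δ ^ 2 ≤ 2 * ν / N * D := by
      calc _ ≤ 2 * ν / N ^ 2 * (N * D) := by gcongr
        _ = _ := by field_simp
    have h7 : (N : ℝ) ^ 2 / (2 * ν) * (a ^ 2 * S ^ 2) ≤ 2 * N ^ 2 / ν * Q * a ^ 2 := by
      calc _ ≤ (N : ℝ) ^ 2 / (2 * ν) * (a ^ 2 * (4 * Q)) := by gcongr
        _ = _ := by field_simp; ring
    linarith
  have h1 := Finset.sum_le_sum fun j (_ : j ∈ Finset.univ) => hterm j
  have e1 : ∑ j, 2 * ((o j - avg o) * (‖w j‖ ^ 2 - ‖w 0‖ ^ 2)) =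
      2 * ∑ j, o j * ‖w j‖ ^ 2 - 2 * avg o * Q := by
    have : ∀ j, 2 * ((o j - avg o) * (‖w j‖ ^ 2 - ‖w 0‖ ^ 2)) =
        2 * (o j * ‖w j‖ ^ 2) - 2 * avg o * ‖w j‖ ^ 2 - 2 * ‖w 0‖ ^ 2 * (o j - avg o) :=
      fun j => by ring
    simp only [this, Finset.sum_sub_distrib (f := fun j => 2 * (o j * ‖w j‖ ^ 2) -
      2 * avg o * ‖w j‖ ^ 2), ← Finset.mul_sum, hsum, mul_zero, sub_zero]
    rw [Finset.sum_sub_distrib, ← Finset.mul_sum, ← Finset.mul_sum]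
  have e2 : ∑ _j : Fin N, 2 * ν / N * D = 2 * ν * D := by
    rw [Finset.sum_const, Finset.card_univ, Fintype.card_fin, nsmul_eq_mul]
    field_simp
  have h2 : ∑ j, (o j - avg o) ^ 2 ≤ ∑ j, o j ^ 2 := by
    have := sum_norm_sub_avg_sq o
    simp only [Real.norm_eq_abs, sq_abs] at this
    have h3 : 0 ≤ (N : ℝ) * avg o ^ 2 := by positivity
    linarith
  have hQ0 : 0 ≤ Q := (sq_nonneg _).trans (hQj 0)
  have h3 : 2 * N ^ 2 / ν * Q * ∑ j, (o j - avg o) ^ 2 ≤ 2 * N ^ 2 / ν * Q * ∑ j, o j ^ 2 := by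
    gcongr
  rw [Finset.sum_add_distrib, e1, e2, ← Finset.mul_sum] at h1
  linarith

end Laplacian

/-! ### Rate bounds of the coupled and of the averaged system -/

section Fields

variable {N d : ℕ} [NeZero N]

/-- The coupled field for given noise paths `o`. -/
def coupledPathField (f : Fin N → EuclideanSpace ℝ (Fin d) → EuclideanSpace ℝ (Fin d))
    (o : Fin N → ℝ → ℝ) (ν t : ℝ) (x : Fin N → EuclideanSpace ℝ (Fin d)) :
    Fin N → EuclideanSpace ℝ (Fin d) :=
  fun j => conjugateField (f j) (o j t) (x j) + ν • lap x j

/-- The averaged field for given noise paths `o`. -/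
def averagedPathField (f : Fin N → EuclideanSpace ℝ (Fin d) → EuclideanSpace ℝ (Fin d))
    (o : Fin N → ℝ → ℝ) (t : ℝ) (z : EuclideanSpace ℝ (Fin d)) : EuclideanSpace ℝ (Fin d) :=
  avg fun j => conjugateField (f j) (o j t) z

/-- The common contraction rate of the coupled systems with coupling at least `ν` and of the
averaged system. -/
def pathRate (L ν : ℝ) (o : Fin N → ℝ → ℝ) (t : ℝ) : ℝ :=
  -L + (2 * avg (fun j => o j t) + 2 * N ^ 2 / ν * ∑ j, o j t ^ 2)

/-- The common source term of the coupled and of the averaged systems. -/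
def pathSource (L : ℝ) (f : Fin N → EuclideanSpace ℝ (Fin d) → EuclideanSpace ℝ (Fin d))
    (o : Fin N → ℝ → ℝ) (t : ℝ) : ℝ :=
  L⁻¹ * ∑ j, ‖conjugateField (f j) (o j t) 0‖ ^ 2

variable {f : Fin N → EuclideanSpace ℝ (Fin d) → EuclideanSpace ℝ (Fin d)}
  {o : Fin N → ℝ → ℝ} {L ν₀ ν : ℝ}

theorem continuous_conjugateField (hf : ∀ j, Continuous (f j)) (ho : ∀ j, Continuous (o j))
    (j : Fin N) :
    Continuous fun p : ℝ × EuclideanSpace ℝ (Fin d) => conjugateField (f j) (o j p.1) p.2 := by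
  have := hf j
  have := ho j
  unfold conjugateField
  fun_prop

/-- Apply dissipativity of `g` at the points `e^a x` and `e^a y`; the scalings cancel and leave
`-L`, while the linear term contributes `a`. -/
theorem inner_conjugateField_le {g : EuclideanSpace ℝ (Fin d) → EuclideanSpace ℝ (Fin d)}
    (hg : ∀ x y, inner ℝ (x - y) (g x - g y) ≤ -L * ‖x - y‖ ^ 2) (a : ℝ)
    (x y : EuclideanSpace ℝ (Fin d)) :
    inner ℝ (x - y) (conjugateField g a x - conjugateField g a y) ≤
      (-L + a) * ‖x - y‖ ^ 2 := by
  have h1 := hg (Real.exp a • x) (Real.exp a • y)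
  rw [← smul_sub, norm_smul, inner_smul_left, Real.norm_of_nonneg (Real.exp_pos a).le] at h1
  have h2 := mul_le_mul_of_nonneg_left h1 (mul_pos (Real.exp_pos (-a)) (Real.exp_pos (-a))).le
  have he : Real.exp (-a) * Real.exp a = 1 := by rw [← Real.exp_add, neg_add_cancel, Real.exp_zero]
  have e : conjugateField g a x - conjugateField g a y =
      Real.exp (-a) • (g (Real.exp a • x) - g (Real.exp a • y)) + a • (x - y) := by
    simp only [conjugateField, smul_sub]
    abel
  rw [e, inner_add_right, inner_smul_right, inner_smul_right, real_inner_self_eq_norm_sq]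
  simp only [conj_trivial] at h2
  have e1 : Real.exp (-a) * Real.exp (-a) * (Real.exp a *
      inner ℝ (x - y) (g (Real.exp a • x) - g (Real.exp a • y))) =
      (Real.exp (-a) * Real.exp a) * (Real.exp (-a) *
        inner ℝ (x - y) (g (Real.exp a • x) - g (Real.exp a • y))) := by ring
  have e2 : Real.exp (-a) * Real.exp (-a) * (-L * (Real.exp a * ‖x - y‖) ^ 2) =
      (Real.exp (-a) * Real.exp a) ^ 2 * (-L * ‖x - y‖ ^ 2) := by ring
  rw [e1, e2, he] at h2
  linarith

theorem continuous_pathRate (ho : ∀ j, Continuous (o j)) : Continuous (pathRate L ν o) := by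
  unfold pathRate avg
  fun_prop

theorem continuous_pathSource (hf : ∀ j, Continuous (f j)) (ho : ∀ j, Continuous (o j)) :
    Continuous (pathSource L f o) := by
  have : ∀ j, Continuous fun t => conjugateField (f j) (o j t) 0 := fun j =>
    (continuous_conjugateField hf ho j).comp (Continuous.prodMk_left 0)
  unfold pathSource
  fun_prop

/-- Twice the dissipation is `2 L`: one half stays in the rate, the other is the `κ` of
`RateBounds.of_monotone`. The noise correction decreases in `ν`, so the rate at `ν₀` serves for
every `ν ≥ ν₀`. The coupling vanishes at the zero state, hence the source does not involve `ν`. -/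
theorem rateBounds_coupled (hL : 0 < L) (hf : ∀ j, Continuous (f j))
    (hd : ∀ j x y, inner ℝ (x - y) (f j x - f j y) ≤ -L * ‖x - y‖ ^ 2)
    (ho : ∀ j, Continuous (o j)) (hν₀ : 0 < ν₀) (hν : ν₀ ≤ ν) :
    RateBounds (sumForm _ (Fin N)) (coupledPathField f o ν) (pathRate L ν₀ o)
      (pathSource L f o) := by
  refine RateBounds.of_monotone hL ?_ (continuous_pathRate ho) (continuous_pathSource hf ho)
    (fun t x y => ?_) fun t => ?_
  · refine continuous_pi fun j => Continuous.add ?_ (Continuous.const_smul ?_ ν)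
    · exact (continuous_conjugateField hf ho j).comp
        (continuous_fst.prodMk ((continuous_apply j).comp continuous_snd))
    · unfold lap
      fun_prop
  · rw [sumForm_self, sumForm_apply]
    have h1 : ∀ j, inner ℝ ((x - y) j) ((coupledPathField f o ν t x -
        coupledPathField f o ν t y) j) ≤
        (-L + o j t) * ‖(x - y) j‖ ^ 2 + ν * inner ℝ ((x - y) j) (lap (x - y) j) := by
      intro j
      have e : (coupledPathField f o ν t x - coupledPathField f o ν t y) j =
          (conjugateField (f j) (o j t) (x j) - conjugateField (f j) (o j t) (y j)) +
            ν • lap (x - y) j := by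
        simp only [coupledPathField, Pi.sub_apply, lap_sub, smul_sub]
        abel
      rw [e, inner_add_right, inner_smul_right]
      exact add_le_add_left (inner_conjugateField_le (hd j) _ _ _) _
    have h2 := Finset.sum_le_sum fun j (_ : j ∈ Finset.univ) => h1 j
    rw [Finset.sum_add_distrib, ← Finset.mul_sum, sum_inner_lap] at h2
    have h3 := sum_mul_norm_sq_le (fun j => o j t) (x - y) (hν₀.trans_le hν)
    have h4 : ∑ j, (-L + o j t) * ‖(x - y) j‖ ^ 2 =
        -L * ∑ j, ‖(x - y) j‖ ^ 2 + ∑ j, o j t * ‖(x - y) j‖ ^ 2 := by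
      simp only [add_mul, Finset.sum_add_distrib, Finset.mul_sum]
    have h5 : (2 * avg (fun j => o j t) + 2 * N ^ 2 / ν * ∑ j, o j t ^ 2) *
        ∑ j, ‖(x - y) j‖ ^ 2 ≤
        (2 * avg (fun j => o j t) + 2 * N ^ 2 / ν₀ * ∑ j, o j t ^ 2) *
        ∑ j, ‖(x - y) j‖ ^ 2 := by
      gcongr
    rw [pathRate]
    linarith
  · rw [sumForm_self, pathSource]
    simp [coupledPathField, lap]

/-- Averaging the one-sided bounds gives the rate `-2 L + 2 avg o`. The nonnegative quadratic noise
term is added only to match the rate of the coupled systems. -/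
theorem averaged_monotone
    (hd : ∀ j x y, inner ℝ (x - y) (f j x - f j y) ≤ -L * ‖x - y‖ ^ 2)
    (hν₀ : 0 < ν₀) (t : ℝ) (x y : EuclideanSpace ℝ (Fin d)) :
    2 * inner ℝ (x - y) (averagedPathField f o t x - averagedPathField f o t y) ≤
      (pathRate L ν₀ o t - L) * ‖x - y‖ ^ 2 := by
  have hN := natCast_pos' (N := N)
  have e : averagedPathField f o t x - averagedPathField f o t y =
      (1 / (N : ℝ)) • ∑ j, (conjugateField (f j) (o j t) x - conjugateField (f j) (o j t) y) := by
    simp only [averagedPathField, avg, ← smul_sub, Finset.sum_sub_distrib]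
  have h1 := Finset.sum_le_sum fun j (_ : j ∈ Finset.univ) =>
    inner_conjugateField_le (hd j) (o j t) x y
  rw [← inner_sum] at h1
  have h2 := mul_le_mul_of_nonneg_left h1 (by positivity : 0 ≤ 1 / (N : ℝ))
  have h3 : 1 / (N : ℝ) * ∑ j, (-L + o j t) * ‖x - y‖ ^ 2 =
      (-L + avg fun j => o j t) * ‖x - y‖ ^ 2 := by
    rw [← Finset.sum_mul, Finset.sum_add_distrib, Finset.sum_const, Finset.card_univ,
      Fintype.card_fin, nsmul_eq_mul, avg, smul_eq_mul]
    field_simp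
  rw [e, inner_smul_right, pathRate]
  have h4 : 0 ≤ 2 * N ^ 2 / ν₀ * ∑ j, o j t ^ 2 * ‖x - y‖ ^ 2 := by positivity
  rw [← Finset.sum_mul] at h4
  linarith

theorem rateBounds_averaged (hL : 0 < L) (hf : ∀ j, Continuous (f j))
    (hd : ∀ j x y, inner ℝ (x - y) (f j x - f j y) ≤ -L * ‖x - y‖ ^ 2)
    (ho : ∀ j, Continuous (o j)) (hν₀ : 0 < ν₀) :
    RateBounds (innerForm _) (averagedPathField f o) (pathRate L ν₀ o) (pathSource L f o) := by
  refine RateBounds.of_monotone hL ?_ (continuous_pathRate ho) (continuous_pathSource hf ho)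
    (fun t x y => ?_) fun t => ?_
  · have h : Continuous fun p : ℝ × EuclideanSpace ℝ (Fin d) =>
        ∑ j, conjugateField (f j) (o j p.1) p.2 :=
      continuous_finsetSum Finset.univ fun j _ => continuous_conjugateField hf ho j
    exact h.const_smul (1 / (N : ℝ))
  · rw [innerForm_apply, innerForm_apply, real_inner_self_eq_norm_sq]
    exact averaged_monotone hd hν₀ t x y
  · rw [innerForm_apply, real_inner_self_eq_norm_sq]
    exact mul_le_mul_of_nonneg_left (norm_avg_sq_le _) (inv_nonneg.2 hL.le)

end Fields

/-! ### Synchronization of entire solutions -/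

section Synchronization

variable {N d : ℕ} [NeZero N]
  {f : Fin N → EuclideanSpace ℝ (Fin d) → EuclideanSpace ℝ (Fin d)}
  {o : Fin N → ℝ → ℝ} {L ν₀ ν : ℝ}

theorem tail_mono {α β : ℝ → ℝ} (hα : Continuous α) (hβ : Continuous β) (hβ0 : ∀ t, 0 ≤ β t)
    (h : PastDecay α β) : Monotone (tail α β) := fun _ t hst =>
  setIntegral_mono_set (integrableOn_tail hα hβ hβ0 h t)
    (Eventually.of_forall fun r => mul_nonneg (Real.exp_pos _).le (hβ0 r))
    (Eventually.of_forall fun _ hr => le_trans hr hst)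

/-- The pullback energy bound is bounded on bounded time intervals. -/
theorem exists_energy_bound {α β : ℝ → ℝ} (hα : Continuous α) (hβ : Continuous β)
    (hβ0 : ∀ t, 0 ≤ β t) (h : PastDecay α β) (S T : ℝ) :
    ∃ R, 0 ≤ R ∧ ∀ t ∈ Set.Icc S T, Real.exp (prim α t) * tail α β t ≤ R ^ 2 := by
  have hc : Continuous fun t => Real.exp (prim α t) :=
    Real.continuous_exp.comp (continuous_prim hα)
  obtain ⟨K, hK⟩ := (isCompact_Icc (a := S) (b := T)).exists_bound_of_continuousOn hc.continuousOn
  refine ⟨Real.sqrt (|K| * tail α β T), Real.sqrt_nonneg _, fun t ht => ?_⟩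
  rw [Real.sq_sqrt (mul_nonneg (abs_nonneg _) (tail_nonneg hβ0 T))]
  exact mul_le_mul ((le_abs_self _).trans ((hK t ht).trans (le_abs_self K)))
    (tail_mono hα hβ hβ0 h ht.2) (tail_nonneg hβ0 t) (abs_nonneg _)

/-- Components and averages are bounded by the energy. -/
theorem norm_le_of_energy {x : Fin N → EuclideanSpace ℝ (Fin d)} {R : ℝ} (hR : 0 ≤ R)
    (h : (sumForm _ (Fin N)).form x x ≤ R ^ 2) : (∀ j, ‖x j‖ ≤ R) ∧ ‖avg x‖ ≤ R := by
  rw [sumForm_self] at h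
  exact ⟨fun j => le_of_sq_le_sq ((Finset.single_le_sum (f := fun j => ‖x j‖ ^ 2)
      (fun _ _ => sq_nonneg _) (Finset.mem_univ j)).trans h) hR,
    le_of_sq_le_sq ((norm_avg_sq_le x).trans h) hR⟩

theorem hasDerivAt_avg {H : Type*} [NormedAddCommGroup H] [InnerProductSpace ℝ H]
    {x : ℝ → Fin N → H} {x' : Fin N → H} {t : ℝ}
    (h : ∀ j, HasDerivAt (fun t => x t j) (x' j) t) :
    HasDerivAt (fun t => avg (x t)) (avg x') t := by
  have h1 : HasDerivAt (fun t => ∑ j, x t j) (∑ j, x' j) t := HasDerivAt.fun_sum fun j _ => h j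
  exact h1.const_smul (1 / (N : ℝ))

/-- The deviations from the mean contract at a rate proportional to the coupling strength. -/
theorem deviation_le (hν : 1 < 2 * ν / N ^ 2) {x : ℝ → Fin N → EuclideanSpace ℝ (Fin d)}
    (hx : IsSolutionOn (coupledPathField f o ν) Set.univ x) {S T M : ℝ}
    (hM : ∀ t ∈ Set.Icc S T, ∑ j, ‖conjugateField (f j) (o j t) (x t j)‖ ^ 2 ≤ M)
    {t : ℝ} (ht : t ∈ Set.Icc S T) :
    ∑ j, ‖x t j - avg (x t)‖ ^ 2 ≤
      Real.exp (-(2 * ν / N ^ 2 - 1) * (t - S)) * ∑ j, ‖x S j - avg (x S)‖ ^ 2 +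
        M / (2 * ν / N ^ 2 - 1) := by
  have hN := natCast_pos' (N := N)
  -- The coupling contributes `2 ν / N²` through the Poincaré inequality; `1` is spent on Young's
  -- inequality for the inner product with the local fields.
  set l : ℝ := 2 * ν / N ^ 2 - 1 with hl
  have hl0 : 0 < l := by rw [hl]; linarith
  have hν0 : 0 < ν := by
    by_contra! h
    have : 2 * ν / (N : ℝ) ^ 2 ≤ 0 := div_nonpos_of_nonpos_of_nonneg (by linarith) (by positivity)
    linarith
  have hxj : ∀ t j, HasDerivAt (fun t => x t j) (coupledPathField f o ν t (x t) j) t := fun t j =>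
    (hasDerivAt_pi.1 ((hx t (Set.mem_univ t)).hasDerivAt univ_mem)) j
  have hav : ∀ t, HasDerivAt (fun t => avg (x t)) (avg (coupledPathField f o ν t (x t))) t :=
    fun t => hasDerivAt_avg (hxj t)
  have hy : ∀ t, HasDerivAt (fun t (j : Fin N) => x t j - avg (x t))
      (fun j => coupledPathField f o ν t (x t) j - avg (coupledPathField f o ν t (x t))) t :=
    fun t => hasDerivAt_pi.2 fun j => (hxj t j).sub (hav t)
  have hyc : Continuous fun t (j : Fin N) => x t j - avg (x t) :=
    continuous_iff_continuousAt.2 fun t => (hy t).continuousAt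
  have hA : ∀ t : ℝ, HasDerivAt (fun t => -l * t) (-l) t := fun t => by
    simpa using (hasDerivAt_id t).const_mul (-l)
  have key := (sumForm (EuclideanSpace ℝ (Fin d)) (Fin N)).gronwall (s := S) (T := T)
    (α := fun _ => -l) (β := fun _ => M) (A := fun t => -l * t) hyc.continuousOn
    (fun t _ => (hy t).hasDerivWithinAt) hA continuous_const (fun t ht => ?_) ht
  · simp only [sumForm_self] at key
    have h1 : ∫ r in S..t, Real.exp (-(-l * r)) * M =
        (Real.exp (l * t) / l - Real.exp (l * S) / l) * M := by
      have e : ∀ r, Real.exp (-(-l * r)) = Real.exp (l * r) := fun r => by congr 1; ring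
      have h : ∀ r ∈ Set.uIcc S t, HasDerivAt (fun r => Real.exp (l * r) / l)
          (Real.exp (l * r)) r := fun r _ => by
        have := (((hasDerivAt_id r).const_mul l).exp).div_const l
        simpa [hl0.ne'] using this
      simp only [e]
      rw [intervalIntegral.integral_mul_const, intervalIntegral.integral_eq_sub_of_hasDerivAt h
        (Continuous.intervalIntegrable (by fun_prop) _ _)]
    have hM0 : 0 ≤ M := (Finset.sum_nonneg fun _ _ => sq_nonneg _).trans (hM t ht)
    rw [h1] at key
    have h2 := mul_le_mul_of_nonneg_left key (Real.exp_pos (-l * t)).le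
    have e0 : Real.exp (-l * t) * Real.exp (-(-l * t)) = 1 := by
      rw [← Real.exp_add, add_neg_cancel, Real.exp_zero]
    have e1 : Real.exp (-l * t) * Real.exp (-(-l * S)) = Real.exp (-l * (t - S)) := by
      rw [← Real.exp_add]; congr 1; ring
    have e2 : Real.exp (-l * t) * Real.exp (l * t) = 1 := by
      rw [← Real.exp_add, neg_mul, neg_add_cancel, Real.exp_zero]
    have e3 : 0 ≤ Real.exp (-l * t) * (Real.exp (l * S) / l * M) := by positivity
    set p := ∑ j, ‖x t j - avg (x t)‖ ^ 2
    set q := ∑ j, ‖x S j - avg (x S)‖ ^ 2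
    have e4 : Real.exp (-l * t) * (Real.exp (-(-l * t)) * p) = p := by
      rw [← mul_assoc, e0, one_mul]
    have e5 : Real.exp (-l * t) * (Real.exp (-(-l * S)) * q +
        (Real.exp (l * t) / l - Real.exp (l * S) / l) * M) =
        Real.exp (-l * t) * Real.exp (-(-l * S)) * q +
          Real.exp (-l * t) * Real.exp (l * t) * (M / l) -
          Real.exp (-l * t) * (Real.exp (l * S) / l * M) := by ring
    rw [e4, e5, e1, e2] at h2
    linarith
  · have ht' : t ∈ Set.Icc S T := ⟨ht.1, ht.2.le⟩
    set y : Fin N → EuclideanSpace ℝ (Fin d) := fun j => x t j - avg (x t) with hydef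
    have hysum : ∑ j, y j = 0 := sum_sub_avg (x t)
    have hlap : ∀ j, lap (x t) j = lap y j := fun j => by
      have := lap_sub (x t) (fun _ => avg (x t)) j
      rw [lap_const, sub_zero] at this
      exact this.symm
    rw [sumForm_self, sumForm_apply]
    have h1 : ∑ j, inner ℝ (y j) (coupledPathField f o ν t (x t) j -
        avg (coupledPathField f o ν t (x t))) =
        ∑ j, inner ℝ (y j) (conjugateField (f j) (o j t) (x t j)) - ν * dirichlet y := by
      simp only [inner_sub_right, Finset.sum_sub_distrib]
      rw [← sum_inner, hysum, inner_zero_left, sub_zero]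
      simp only [coupledPathField, inner_add_right, inner_smul_right, Finset.sum_add_distrib,
        ← Finset.mul_sum, hlap, sum_inner_lap]
      ring
    have h2 : 2 * ∑ j, inner ℝ (y j) (conjugateField (f j) (o j t) (x t j)) ≤
        ∑ j, ‖y j‖ ^ 2 + M := by
      refine le_trans ?_ (add_le_add le_rfl (hM t ht'))
      rw [Finset.mul_sum, ← Finset.sum_add_distrib]
      refine Finset.sum_le_sum fun j _ => ?_
      have := real_inner_le_norm (y j) (conjugateField (f j) (o j t) (x t j))
      nlinarith [sq_nonneg (‖y j‖ - ‖conjugateField (f j) (o j t) (x t j)‖)]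
    have h3 := sum_norm_sq_le_dirichlet hysum
    have h4 : 2 * ν / N ^ 2 * ∑ j, ‖y j‖ ^ 2 ≤ 2 * ν * dirichlet y := by
      calc _ ≤ 2 * ν / N ^ 2 * (N ^ 2 * dirichlet y) := by gcongr
        _ = _ := by field_simp
    have e : -l * ∑ j, ‖y j‖ ^ 2 = ∑ j, ‖y j‖ ^ 2 - 2 * ν / N ^ 2 * ∑ j, ‖y j‖ ^ 2 := by
      rw [hl]; ring
    rw [e]
    refine le_trans (le_of_eq (congrArg (2 * ·) h1)) ?_
    linarith

variable {x : ℕ → ℝ → Fin N → EuclideanSpace ℝ (Fin d)} {νs : ℕ → ℝ} {R S T : ℝ}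

/-- The components of bounded solutions synchronize as the coupling tends to infinity. -/
theorem eventually_deviation_le (hf : ∀ j, Continuous (f j)) (ho : ∀ j, Continuous (o j))
    (hν : Tendsto νs atTop atTop)
    (hx : ∀ᶠ n in atTop, IsSolutionOn (coupledPathField f o (νs n)) Set.univ (x n))
    (hR : 0 ≤ R) (hb : ∀ᶠ n in atTop, ∀ t ∈ Set.Icc (S - 1) T,
      (sumForm _ (Fin N)).form (x n t) (x n t) ≤ R ^ 2) {η : ℝ} (hη : 0 < η) :
    ∀ᶠ n in atTop, ∀ t ∈ Set.Icc S T, ∑ j, ‖x n t j - avg (x n t)‖ ^ 2 ≤ η := by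
  have hN := natCast_pos' (N := N)
  have hK : IsCompact (Set.Icc (S - 1) T ×ˢ Metric.closedBall (0 : EuclideanSpace ℝ (Fin d)) R) :=
    isCompact_Icc.prod (isCompact_closedBall _ _)
  have hM : ∀ j, ∃ M, ∀ t ∈ Set.Icc (S - 1) T, ∀ v : EuclideanSpace ℝ (Fin d), ‖v‖ ≤ R →
      ‖conjugateField (f j) (o j t) v‖ ^ 2 ≤ M := by
    intro j
    obtain ⟨M, hM⟩ := hK.exists_bound_of_continuousOn (continuous_conjugateField hf ho j).continuousOn
    exact ⟨M ^ 2, fun t ht v hv =>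
      pow_le_pow_left₀ (norm_nonneg _) (hM (t, v) ⟨ht, by simpa using hv⟩) 2⟩
  choose M hM using hM
  have hl : Tendsto (fun n => 2 * νs n / (N : ℝ) ^ 2 - 1) atTop atTop :=
    tendsto_atTop_add_const_right _ _
      ((hν.const_mul_atTop two_pos).atTop_div_const (by positivity))
  have hlim : Tendsto (fun n => Real.exp (-(2 * νs n / (N : ℝ) ^ 2 - 1)) * R ^ 2 +
      (∑ j, M j) / (2 * νs n / (N : ℝ) ^ 2 - 1)) atTop (𝓝 0) := by
    have h1 : Tendsto (fun n => Real.exp (-(2 * νs n / (N : ℝ) ^ 2 - 1))) atTop (𝓝 0) :=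
      Real.tendsto_exp_neg_atTop_nhds_zero.comp hl
    simpa using (h1.mul_const (R ^ 2)).add (hl.const_div_atTop (∑ j, M j))
  filter_upwards [hx, hb, hlim.eventually (gt_mem_nhds hη), hl.eventually_gt_atTop 0]
    with n hxn hbn hn hln t ht
  -- The estimate starts one time unit before `S`, so on `[S, T]` the initial deviation is already
  -- damped by `e^{-l}`, where `l = 2 ν / N² - 1`.
  have ht' : t ∈ Set.Icc (S - 1) T := ⟨by linarith [ht.1], ht.2⟩
  have h1 := deviation_le (f := f) (o := o) (by linarith) hxn (M := ∑ j, M j) (fun t ht =>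
    Finset.sum_le_sum fun j _ => hM j t ht _ ((norm_le_of_energy hR (hbn t ht)).1 j)) ht'
  refine h1.trans (le_trans (add_le_add (mul_le_mul (Real.exp_le_exp.2 ?_) ?_ ?_ ?_) le_rfl) hn.le)
  · nlinarith [ht.1]
  · rw [sum_norm_sub_avg_sq, ← sumForm_self]
    have := hbn (S - 1) ⟨le_rfl, by linarith [ht.1, ht.2]⟩
    have h0 : 0 ≤ (N : ℝ) * ‖avg (x n (S - 1))‖ ^ 2 := by positivity
    linarith
  · exact Finset.sum_nonneg fun _ _ => sq_nonneg _
  · exact (Real.exp_pos _).le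

/-- The mean of synchronized solutions almost solves the averaged equation. -/
theorem eventually_defect_le (hf : ∀ j, Continuous (f j)) (ho : ∀ j, Continuous (o j))
    (hR : 0 ≤ R) (hb : ∀ᶠ n in atTop, ∀ t ∈ Set.Icc S T,
      (sumForm _ (Fin N)).form (x n t) (x n t) ≤ R ^ 2)
    (hdev : ∀ η, 0 < η → ∀ᶠ n in atTop, ∀ t ∈ Set.Icc S T,
      ∑ j, ‖x n t j - avg (x n t)‖ ^ 2 ≤ η) {η : ℝ} (hη : 0 < η) :
    ∀ᶠ n in atTop, ∀ t ∈ Set.Icc S T,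
      ‖avg (fun j => conjugateField (f j) (o j t) (x n t j)) -
        averagedPathField f o t (avg (x n t))‖ ≤ η := by
  have hN := natCast_pos' (N := N)
  have hK : IsCompact (Set.Icc S T ×ˢ Metric.closedBall (0 : EuclideanSpace ℝ (Fin d)) R) :=
    isCompact_Icc.prod (isCompact_closedBall _ _)
  have hU : ∀ j, ∃ δ > 0, ∀ t ∈ Set.Icc S T, ∀ u v : EuclideanSpace ℝ (Fin d), ‖u‖ ≤ R →
      ‖v‖ ≤ R → ‖u - v‖ ≤ δ →
        ‖conjugateField (f j) (o j t) u - conjugateField (f j) (o j t) v‖ ≤ η := by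
    intro j
    have := hK.uniformContinuousOn_of_continuous (continuous_conjugateField hf ho j).continuousOn
    rw [Metric.uniformContinuousOn_iff_le] at this
    obtain ⟨δ, hδ, h⟩ := this η hη
    refine ⟨δ, hδ, fun t ht u v hu hv huv => ?_⟩
    have := h (t, u) ⟨ht, by simpa using hu⟩ (t, v) ⟨ht, by simpa using hv⟩
      (by simpa [Prod.dist_eq, dist_eq_norm, hδ.le] using huv)
    rwa [dist_eq_norm] at this
  choose δ hδ hU using hU
  have hall : ∀ᶠ n in atTop, ∀ j, ∀ t ∈ Set.Icc S T,
      ∑ i, ‖x n t i - avg (x n t)‖ ^ 2 ≤ δ j ^ 2 :=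
    eventually_all.2 fun j => hdev _ (pow_pos (hδ j) 2)
  filter_upwards [hall, hb] with n hn hbn t ht
  obtain ⟨h1, h2⟩ := norm_le_of_energy hR (hbn t ht)
  have h3 : ∀ j, ‖conjugateField (f j) (o j t) (x n t j) -
      conjugateField (f j) (o j t) (avg (x n t))‖ ≤ η := fun j =>
    hU j t ht _ _ (h1 j) h2 (le_of_sq_le_sq ((Finset.single_le_sum
      (f := fun i => ‖x n t i - avg (x n t)‖ ^ 2) (fun _ _ => sq_nonneg _)
      (Finset.mem_univ j)).trans (hn j t ht)) (hδ j).le)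
  rw [averagedPathField, avg, avg, ← smul_sub, ← Finset.sum_sub_distrib, norm_smul,
    Real.norm_of_nonneg (by positivity), one_div, inv_mul_le_iff₀ hN]
  refine (norm_sum_le _ _).trans ((Finset.sum_le_sum fun j _ => h3 j).trans_eq ?_)
  rw [Finset.sum_const, Finset.card_univ, Fintype.card_fin, nsmul_eq_mul]

/-- Entire solutions of the coupled systems with the pullback energy bound converge to an
entire solution of the averaged system, uniformly on bounded time intervals. -/
theorem tendstoUniformlyOn_entire (hL : 0 < L) (hf : ∀ j, Continuous (f j))
    (hd : ∀ j x y, inner ℝ (x - y) (f j x - f j y) ≤ -L * ‖x - y‖ ^ 2)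
    (ho : ∀ j, Continuous (o j)) (hν₀ : 0 < ν₀)
    (hdecay : PastDecay (pathRate L ν₀ o) (pathSource L f o)) (hν : Tendsto νs atTop atTop)
    (hx : ∀ᶠ n in atTop, IsSolutionOn (coupledPathField f o (νs n)) Set.univ (x n) ∧
      ∀ t, (sumForm _ (Fin N)).form (x n t) (x n t) ≤ Real.exp (prim (pathRate L ν₀ o) t) *
        tail (pathRate L ν₀ o) (pathSource L f o) t)
    {z : ℝ → EuclideanSpace ℝ (Fin d)} (hz : IsSolutionOn (averagedPathField f o) Set.univ z)
    (hzb : ∀ t, (innerForm _).form (z t) (z t) ≤ Real.exp (prim (pathRate L ν₀ o) t) *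
        tail (pathRate L ν₀ o) (pathSource L f o) t) (T₁ T₂ : ℝ) (j : Fin N) :
    TendstoUniformlyOn (fun n t => x n t j) z atTop (Set.Icc T₁ T₂) := by
  have hα := continuous_pathRate (L := L) (ν := ν₀) ho
  have hβ := continuous_pathSource (L := L) hf ho
  have hr := rateBounds_averaged hL hf hd ho hν₀
  have hβ0 := hr.source_nonneg
  set α := pathRate L ν₀ o with hαdef
  set β := pathSource L f o with hβdef
  rw [Metric.tendstoUniformlyOn_iff]
  intro ε hε
  obtain ⟨K, hK⟩ := (isCompact_Icc (a := T₁) (b := T₂)).exists_bound_of_continuousOn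
    (f := fun t => Real.exp (prim α t)) (Real.continuous_exp.comp (continuous_prim hα)).continuousOn
  -- Choices are made in the order `S`, `R`, `η`, then `n`. At time `S` the mean and `z` both have
  -- energy at most `e^{A(S)} * tail(S)`, so their weighted squared distance is at most four tails;
  -- `S` is taken so early that this remains small after transport to `[T₁, T₂]`.
  obtain ⟨S, hS, hST⟩ : ∃ S, (|K| + 1) * (4 * tail α β S) < (ε / 2) ^ 2 / 2 ∧ S ≤ T₁ := by
    have h1 := ((tendsto_tail hα hβ hβ0 hdecay).const_mul 4).const_mul (|K| + 1)
    rw [mul_zero, mul_zero] at h1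
    exact ((h1.eventually (gt_mem_nhds (by positivity : 0 < (ε / 2) ^ 2 / 2))).and
      (eventually_le_atBot T₁)).exists
  obtain ⟨R, hR, hRb⟩ := exists_energy_bound hα hβ hβ0 hdecay (S - 1) T₂
  have hw : Continuous fun r => Real.exp (-prim α r) :=
    Real.continuous_exp.comp (continuous_prim hα).neg
  set I := ∫ r in S..T₂, Real.exp (-prim α r) with hI
  obtain ⟨η, hη, hηI⟩ : ∃ η > 0, (|K| + 1) * (L⁻¹ * η ^ 2 * |I|) < (ε / 2) ^ 2 / 2 := by
    have h1 : Tendsto (fun η : ℝ => (|K| + 1) * (L⁻¹ * η ^ 2 * |I|)) (𝓝[>] 0) (𝓝 0) := by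
      have : Continuous fun η : ℝ => (|K| + 1) * (L⁻¹ * η ^ 2 * |I|) := by fun_prop
      simpa using (this.tendsto 0).mono_left nhdsWithin_le_nhds
    exact ((h1.eventually (gt_mem_nhds (by positivity : 0 < (ε / 2) ^ 2 / 2))).and
      self_mem_nhdsWithin).exists.imp fun η h => ⟨h.2, h.1⟩
  have hb : ∀ᶠ n in atTop, ∀ t ∈ Set.Icc (S - 1) T₂,
      (sumForm _ (Fin N)).form (x n t) (x n t) ≤ R ^ 2 :=
    hx.mono fun n hn t ht => (hn.2 t).trans (hRb t ht)
  have hdev : ∀ η, 0 < η → ∀ᶠ n in atTop, ∀ t ∈ Set.Icc S T₂,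
      ∑ j, ‖x n t j - avg (x n t)‖ ^ 2 ≤ η := fun η hη =>
    eventually_deviation_le hf ho hν (hx.mono fun n hn => hn.1) hR hb hη
  have hb' : ∀ᶠ n in atTop, ∀ t ∈ Set.Icc S T₂,
      (sumForm _ (Fin N)).form (x n t) (x n t) ≤ R ^ 2 :=
    hb.mono fun n hn t ht => hn t ⟨by linarith [ht.1], ht.2⟩
  filter_upwards [hx, hdev ((ε / 4) ^ 2) (by positivity), eventually_defect_le hf ho hR hb' hdev hη]
    with n hxn hdn hen t ht
  have htS : t ∈ Set.Icc S T₂ := ⟨hST.trans ht.1, ht.2⟩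
  have h1 : ‖x n t j - avg (x n t)‖ ≤ ε / 4 :=
    le_of_sq_le_sq ((Finset.single_le_sum (f := fun i => ‖x n t i - avg (x n t)‖ ^ 2)
      (fun _ _ => sq_nonneg _) (Finset.mem_univ j)).trans (hdn t htS)) (by positivity)
  have hxj : ∀ t j, HasDerivAt (fun t => x n t j)
      (coupledPathField f o (νs n) t (x n t) j) t := fun t j =>
    (hasDerivAt_pi.1 ((hxn.1 t (Set.mem_univ t)).hasDerivAt univ_mem)) j
  have hav : ∀ t, HasDerivAt (fun t => avg (x n t))
      (avg fun j => conjugateField (f j) (o j t) (x n t j)) t := by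
    intro t
    have h : HasDerivAt (fun t => avg (x n t)) (avg (coupledPathField f o (νs n) t (x n t))) t :=
      hasDerivAt_avg (hxj t)
    -- The coupling drops out of the mean because the Laplacian sums to zero; no factor `ν`
    -- survives.
    have e : avg (coupledPathField f o (νs n) t (x n t)) =
        avg fun j => conjugateField (f j) (o j t) (x n t j) := by
      simp only [avg, coupledPathField, Finset.sum_add_distrib, ← Finset.smul_sum, sum_lap,
        smul_zero, add_zero]
    rwa [e] at h
  have hzd : ∀ t, HasDerivAt z (averagedPathField f o t (z t)) t := fun t =>
    (hz t (Set.mem_univ t)).hasDerivAt univ_mem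
  have hu : ∀ t, HasDerivAt (fun t => avg (x n t) - z t)
      ((avg fun j => conjugateField (f j) (o j t) (x n t j)) - averagedPathField f o t (z t)) t :=
    fun t => (hav t).sub (hzd t)
  have key := (innerForm (EuclideanSpace ℝ (Fin d))).gronwall (s := S) (T := T₂)
    (x := fun t => avg (x n t) - z t) (α := α) (β := fun _ => L⁻¹ * η ^ 2) (A := prim α)
    (continuous_iff_continuousAt.2 fun t => (hu t).continuousAt).continuousOn
    (fun t _ => (hu t).hasDerivWithinAt) (hasDerivAt_prim hα) continuous_const
    (fun t ht => ?_) htS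
  · simp only [innerForm_apply, real_inner_self_eq_norm_sq] at key
    have h2 : Real.exp (-prim α S) * ‖avg (x n S) - z S‖ ^ 2 ≤ 4 * tail α β S := by
      have e1 : ‖avg (x n S) - z S‖ ^ 2 ≤ 2 * ‖avg (x n S)‖ ^ 2 + 2 * ‖z S‖ ^ 2 := by
        have := (innerForm _).sub_self_le (avg (x n S)) (z S)
        simpa only [innerForm_apply, real_inner_self_eq_norm_sq] using this
      have e2 := (norm_avg_sq_le (x n S)).trans (sumForm_self (x n S) ▸ hxn.2 S)
      have e3 := hzb S
      rw [innerForm_apply, real_inner_self_eq_norm_sq] at e3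
      calc _ ≤ Real.exp (-prim α S) * (4 * (Real.exp (prim α S) * tail α β S)) :=
            mul_le_mul_of_nonneg_left (by linarith) (Real.exp_pos _).le
        _ = (Real.exp (-prim α S) * Real.exp (prim α S)) * (4 * tail α β S) := by ring
        _ = _ := by rw [← Real.exp_add, neg_add_cancel, Real.exp_zero, one_mul]
    have h3 : ∫ r in S..t, Real.exp (-prim α r) * (L⁻¹ * η ^ 2) ≤ L⁻¹ * η ^ 2 * |I| := by
      rw [intervalIntegral.integral_mul_const, mul_comm]
      refine mul_le_mul_of_nonneg_left (le_trans ?_ (le_abs_self I)) (by positivity)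
      exact intervalIntegral.integral_mono_interval le_rfl htS.1 ht.2
        (Eventually.of_forall fun r => (Real.exp_pos _).le) (hw.intervalIntegrable _ _)
    have h4 : ‖avg (x n t) - z t‖ ^ 2 ≤
        Real.exp (prim α t) * (4 * tail α β S + L⁻¹ * η ^ 2 * |I|) := by
      have := mul_le_mul_of_nonneg_left (key.trans (add_le_add h2 h3)) (Real.exp_pos (prim α t)).le
      rwa [← mul_assoc, ← Real.exp_add, add_neg_cancel, Real.exp_zero, one_mul] at this
    have h5 : Real.exp (prim α t) ≤ |K| + 1 :=
      (le_abs_self _).trans ((hK t ht).trans ((le_abs_self K).trans (by linarith)))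
    have h6 : ‖avg (x n t) - z t‖ ^ 2 < (ε / 2) ^ 2 := by
      refine h4.trans_lt ((mul_le_mul_of_nonneg_right h5 ?_).trans_lt (by linarith))
      have := tail_nonneg (α := α) hβ0 S
      positivity
    have h7 := lt_of_pow_lt_pow_left₀ 2 (by positivity) h6
    rw [dist_comm, dist_eq_norm]
    calc ‖x n t j - z t‖ = ‖(x n t j - avg (x n t)) + (avg (x n t) - z t)‖ := by congr 1; abel
      _ ≤ _ := norm_add_le _ _
      _ < ε := by linarith
  · have ht' : t ∈ Set.Icc S T₂ := ⟨ht.1, ht.2.le⟩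
    simp only [innerForm_apply, real_inner_self_eq_norm_sq]
    set e := (avg fun j => conjugateField (f j) (o j t) (x n t j)) -
      averagedPathField f o t (avg (x n t)) with he
    set u := avg (x n t) - z t with hudef
    have e1 : (avg fun j => conjugateField (f j) (o j t) (x n t j)) -
        averagedPathField f o t (z t) =
        (averagedPathField f o t (avg (x n t)) - averagedPathField f o t (z t)) + e := by
      rw [he]; abel
    have h1 := averaged_monotone hd hν₀ t (avg (x n t)) (z t) (o := o)
    -- The spare dissipation `L` of the averaged field absorbs the product with the defect.
    have h2 := (innerForm _).two_mul_form_le hL u e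
    simp only [innerForm_apply, real_inner_self_eq_norm_sq] at h2
    have h3 : L⁻¹ * ‖e‖ ^ 2 ≤ L⁻¹ * η ^ 2 :=
      mul_le_mul_of_nonneg_left (pow_le_pow_left₀ (norm_nonneg _) (hen t ht') 2)
        (inv_nonneg.2 hL.le)
    rw [e1, inner_add_right]
    rw [← hudef, ← hαdef] at h1
    linarith

end Synchronization

/-! ### Ornstein-Uhlenbeck paths of sublinear driving paths -/

/-- A path growing more slowly than every linear function. -/
def Sublinear (w : ℝ → ℝ) : Prop := ∀ ε > 0, ∃ C, ∀ t, |w t| ≤ ε * |t| + C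

/-- The Ornstein-Uhlenbeck path driven by `w`. -/
def ou (w : ℝ → ℝ) (t : ℝ) : ℝ :=
  Real.exp (-t) * (Real.exp t * w t - ∫ τ in Set.Iic t, Real.exp τ * w τ)

/-- The exponentially weighted past average of a path. -/
def pastMean (w : ℝ → ℝ) (t : ℝ) : ℝ := Real.exp (-t) * ∫ τ in Set.Iic t, Real.exp τ * w τ

theorem ou_eq (w : ℝ → ℝ) (t : ℝ) : ou w t = w t - pastMean w t := by
  rw [ou, pastMean, mul_sub, ← mul_assoc, ← Real.exp_add, neg_add_cancel, Real.exp_zero, one_mul]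

namespace Sublinear

variable {w v : ℝ → ℝ}

theorem zero : Sublinear fun _ => 0 := fun ε hε => ⟨0, fun t => by
  rw [abs_zero, add_zero]
  positivity⟩

theorem add (hw : Sublinear w) (hv : Sublinear v) : Sublinear fun t => w t + v t := by
  intro ε hε
  obtain ⟨C, hC⟩ := hw (ε / 2) (by positivity)
  obtain ⟨D, hD⟩ := hv (ε / 2) (by positivity)
  exact ⟨C + D, fun t => (abs_add_le _ _).trans (by linarith [hC t, hD t])⟩

theorem const_mul (hw : Sublinear w) (c : ℝ) : Sublinear fun t => c * w t := by
  intro ε hε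
  obtain ⟨C, hC⟩ := hw (ε / (|c| + 1)) (by positivity)
  refine ⟨(|c| + 1) * C, fun t => ?_⟩
  have h1 : |c| * |w t| ≤ (|c| + 1) * |w t| :=
    mul_le_mul_of_nonneg_right (by linarith) (abs_nonneg _)
  have h2 := mul_le_mul_of_nonneg_left (hC t) (by positivity : 0 ≤ |c| + 1)
  rw [mul_add, ← mul_assoc, mul_div_cancel₀ _ (by positivity : |c| + 1 ≠ 0)] at h2
  rw [abs_mul]
  exact h1.trans h2

theorem sum {ι : Type*} (s : Finset ι) {w : ι → ℝ → ℝ} (h : ∀ i ∈ s, Sublinear (w i)) :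
    Sublinear fun t => ∑ i ∈ s, w i t := by
  classical
  induction s using Finset.induction_on with
  | empty => simpa using zero
  | insert i s hi ih =>
    simp only [Finset.sum_insert hi]
    exact (h i (Finset.mem_insert_self i s)).add
      (ih fun j hj => h j (Finset.mem_insert_of_mem hj))

theorem sub_const (hw : Sublinear w) (c : ℝ) : Sublinear fun t => w t - c := by
  intro ε hε
  obtain ⟨C, hC⟩ := hw ε hε
  exact ⟨C + |c|, fun t => (abs_sub _ _).trans (by linarith [hC t])⟩

/-- The bound `|τ| ≤ |t| + |t - τ| ≤ |t| + 2 e^{(t - τ) / 2}` separates the dependence on `t` from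
an integrable weight in `τ`, without enlarging the slope `ε` in `|t|`. -/
theorem exp_mul_bound {ε C : ℝ} (hε : 0 < ε) (hC : ∀ t, |w t| ≤ ε * |t| + C) {t τ : ℝ}
    (hτ : τ ≤ t) : |Real.exp τ * w τ| ≤
      (ε * |t| + C) * Real.exp (1 * τ) + 2 * ε * Real.exp (t / 2) * Real.exp (1 / 2 * τ) := by
  have h1 : |τ| ≤ |t| + 2 * Real.exp ((t - τ) / 2) := by
    have e1 : |τ| ≤ |t| + |t - τ| := by
      have := abs_sub_abs_le_abs_sub τ t
      rw [abs_sub_comm] at this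
      linarith
    rw [abs_of_nonneg (sub_nonneg.2 hτ)] at e1
    have := Real.add_one_le_exp ((t - τ) / 2)
    linarith
  have h2 : |w τ| ≤ ε * (|t| + 2 * Real.exp ((t - τ) / 2)) + C :=
    (hC τ).trans (by gcongr)
  rw [abs_mul, Real.abs_exp]
  refine (mul_le_mul_of_nonneg_left h2 (Real.exp_pos τ).le).trans_eq ?_
  have e : Real.exp τ * Real.exp ((t - τ) / 2) = Real.exp (t / 2) * Real.exp (1 / 2 * τ) := by
    rw [← Real.exp_add, ← Real.exp_add]; congr 1; ring
  rw [one_mul]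
  linear_combination 2 * ε * e

theorem integrableOn_bound (a b t : ℝ) :
    IntegrableOn (fun τ => a * Real.exp (1 * τ) + b * Real.exp (1 / 2 * τ)) (Set.Iic t) :=
  ((integrableOn_exp_mul_Iic one_pos t).const_mul a).add
    ((integrableOn_exp_mul_Iic one_half_pos t).const_mul b)

theorem integrableOn (hw : Sublinear w) (hc : Continuous w) (t : ℝ) :
    IntegrableOn (fun τ => Real.exp τ * w τ) (Set.Iic t) := by
  obtain ⟨C, hC⟩ := hw 1 one_pos
  exact Integrable.mono' (integrableOn_bound _ _ t) (by fun_prop)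
    ((ae_restrict_mem measurableSet_Iic).mono fun τ hτ => exp_mul_bound one_pos hC hτ)

theorem abs_pastMean_le {ε C : ℝ} (hε : 0 < ε) (hC : ∀ t, |w t| ≤ ε * |t| + C) (t : ℝ) :
    |pastMean w t| ≤ ε * |t| + C + 4 * ε := by
  have h1 : ‖∫ τ in Set.Iic t, Real.exp τ * w τ‖ ≤ ∫ τ in Set.Iic t,
      ((ε * |t| + C) * Real.exp (1 * τ) + 2 * ε * Real.exp (t / 2) * Real.exp (1 / 2 * τ)) :=
    norm_integral_le_of_norm_le (integrableOn_bound _ _ t)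
      ((ae_restrict_mem measurableSet_Iic).mono fun τ hτ => exp_mul_bound hε hC hτ)
  rw [integral_add ((integrableOn_exp_mul_Iic one_pos t).const_mul _)
      ((integrableOn_exp_mul_Iic one_half_pos t).const_mul _), integral_const_mul,
    integral_const_mul, integral_exp_mul_Iic one_pos, integral_exp_mul_Iic one_half_pos] at h1
  rw [Real.norm_eq_abs] at h1
  rw [pastMean, abs_mul, Real.abs_exp]
  refine (mul_le_mul_of_nonneg_left h1 (Real.exp_pos (-t)).le).trans_eq ?_
  have e1 : Real.exp (-t) * Real.exp (1 * t) = 1 := by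
    rw [← Real.exp_add, one_mul, neg_add_cancel, Real.exp_zero]
  have e2 : Real.exp (-t) * (Real.exp (t / 2) * Real.exp (1 / 2 * t)) = 1 := by
    rw [← Real.exp_add, ← Real.exp_add, show -t + (t / 2 + 1 / 2 * t) = 0 by ring, Real.exp_zero]
  linear_combination (ε * |t| + C) * e1 + 4 * ε * e2

protected theorem pastMean (hw : Sublinear w) : Sublinear (pastMean w) := fun ε hε =>
  let ⟨C, hC⟩ := hw ε hε
  ⟨C + 4 * ε, fun t => (abs_pastMean_le hε hC t).trans_eq (by ring)⟩

protected theorem ou (hw : Sublinear w) : Sublinear (ou w) := by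
  have := hw.add (hw.pastMean.const_mul (-1))
  simpa only [neg_one_mul, ← sub_eq_add_neg, ← ou_eq] using this

/-- The past mean is a primitive of the Ornstein-Uhlenbeck path. Time integrals of the noise are
therefore differences of past means and grow sublinearly, which takes the place of an ergodic
theorem. -/
theorem hasDerivAt_pastMean (hw : Sublinear w) (hc : Continuous w) (t : ℝ) :
    HasDerivAt (pastMean w) (ou w t) t := by
  have hcc : Continuous fun τ => Real.exp τ * w τ := by fun_prop
  have h1 : ∀ t, ∫ τ in Set.Iic t, Real.exp τ * w τ =
      (∫ τ in Set.Iic 0, Real.exp τ * w τ) + ∫ τ in (0 : ℝ)..t, Real.exp τ * w τ := fun t => by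
    rw [← intervalIntegral.integral_Iic_sub_Iic (hw.integrableOn hc 0) (hw.integrableOn hc t)]
    ring
  have h2 : HasDerivAt (fun t => ∫ τ in Set.Iic t, Real.exp τ * w τ) (Real.exp t * w t) t := by
    rw [funext h1]
    exact (hcc.integral_hasStrictDerivAt 0 t).hasDerivAt.const_add _
  have h3 := ((hasDerivAt_id t).neg.exp).mul h2
  refine h3.congr_deriv ?_
  simp only [ou, id, Pi.neg_apply]
  ring

theorem continuous_pastMean (hw : Sublinear w) (hc : Continuous w) : Continuous (pastMean w) :=
  continuous_iff_continuousAt.2 fun t => (hw.hasDerivAt_pastMean hc t).continuousAt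

theorem continuous_ou (hw : Sublinear w) (hc : Continuous w) : Continuous (ou w) := by
  have : ou w = fun t => w t - pastMean w t := funext (ou_eq w)
  rw [this]
  exact hc.sub (hw.continuous_pastMean hc)

theorem integral_ou (hw : Sublinear w) (hc : Continuous w) (s t : ℝ) :
    ∫ r in s..t, ou w r = pastMean w t - pastMean w s :=
  intervalIntegral.integral_eq_sub_of_hasDerivAt (fun r _ => hw.hasDerivAt_pastMean hc r)
    ((hw.continuous_ou hc).intervalIntegrable _ _)

/-- The Ornstein-Uhlenbeck path of a shifted path is the shifted Ornstein-Uhlenbeck path. -/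
theorem ou_shift (hw : Sublinear w) (hc : Continuous w) (s t : ℝ) :
    ou (fun r => w (r + s) - w s) t = ou w (t + s) := by
  have h1 : ∫ τ in Set.Iic t, Real.exp τ * w (τ + s) =
      Real.exp (-s) * ∫ τ in Set.Iic (t + s), Real.exp τ * w τ := by
    have := (measurePreserving_add_right volume s).setIntegral_preimage_emb
      (measurableEmbedding_addRight s) (fun τ => Real.exp (-s) * (Real.exp τ * w τ)) (Set.Iic (t + s))
    rw [Set.preimage_add_const_Iic, add_sub_cancel_right] at this
    rw [← integral_const_mul, ← this]
    refine integral_congr_ae (Eventually.of_forall fun τ => ?_)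
    simp only [← mul_assoc, ← Real.exp_add]
    congr 2
    ring
  have hi : IntegrableOn (fun τ => Real.exp τ * w (τ + s)) (Set.Iic t) := by
    have := ((measurePreserving_add_right volume s).integrableOn_comp_preimage
      (measurableEmbedding_addRight s)).2 ((hw.integrableOn hc (t + s)).const_mul (Real.exp (-s)))
    simp only [Set.preimage_add_const_Iic, add_sub_cancel_right] at this
    refine this.congr_fun (fun τ _ => ?_) measurableSet_Iic
    simp only [Function.comp_apply, ← mul_assoc, ← Real.exp_add]
    congr 2
    ring
  have hi2 : IntegrableOn (fun τ => Real.exp τ * w s) (Set.Iic t) := by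
    have := (integrableOn_exp_mul_Iic one_pos t).mul_const (w s)
    simp only [one_mul] at this
    exact this
  have h2 : ∫ τ in Set.Iic t, Real.exp τ * w s = Real.exp t * w s := by
    rw [integral_mul_const, integral_exp_Iic]
  rw [ou, ou]
  simp only [mul_sub]
  rw [integral_sub hi hi2, h1, h2]
  have e1 : Real.exp (-t) * Real.exp t = 1 := by rw [← Real.exp_add, neg_add_cancel, Real.exp_zero]
  have e2 : Real.exp (-(t + s)) * Real.exp (t + s) = 1 := by
    rw [← Real.exp_add, neg_add_cancel, Real.exp_zero]
  have e3 : Real.exp (-(t + s)) = Real.exp (-t) * Real.exp (-s) := by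
    rw [← Real.exp_add]; congr 1; ring
  linear_combination (w (t + s) - w s + w s) * e1 - w (t + s) * e2 +
    (∫ τ in Set.Iic (t + s), Real.exp τ * w τ) * e3

end Sublinear

/-! ### Decay of the rates along noise paths -/

section Decay

variable {N d : ℕ} [NeZero N]
  {f : Fin N → EuclideanSpace ℝ (Fin d) → EuclideanSpace ℝ (Fin d)}
  {o : Fin N → ℝ → ℝ} {L ν₀ K : ℝ}

/-- The dissipation `L` is budgeted as follows: the mean of the noise takes `L / 4`, its square
takes `L / 4` by the choice of `ν₀`, and the weight `e^{-A(s)}` decays in the past with exponent `L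
/ 2`. The source may grow with exponent `L / 4`, and `κ = L / 4` remains. -/
theorem pastDecay_of_noise (hL : 0 < L) (ho : ∀ j, Continuous (o j)) (hs : ∀ j, Sublinear (o j))
    (hmean : ∀ j, Sublinear fun s => ∫ r in (0 : ℝ)..s, o j r)
    (hsq : ∃ C, ∀ s ≤ 0, ∑ j, ∫ r in s..(0 : ℝ), o j r ^ 2 ≤ K * |s| + C) (hν₀ : 0 < ν₀)
    (hK : 2 * N ^ 2 / ν₀ * K ≤ L / 4) :
    PastDecay (pathRate L ν₀ o) (pathSource L f o) := by
  have hN := natCast_pos' (N := N)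
  set k : ℝ := 2 * N ^ 2 / ν₀ with hk
  have hk0 : 0 < k := by positivity
  obtain ⟨C₁, hC₁⟩ := ((Sublinear.sum Finset.univ fun j _ => hmean j).const_mul (2 * (1 / (N : ℝ))))
    (L / 4) (by positivity)
  obtain ⟨C₂, hC₂⟩ := hsq
  -- The source contains `e^{-2 o}`, so a slope `L / 8` of the noise gives growth at exponent `L /
  -- 4`.
  choose C₃ hC₃ using fun j => hs j (L / 8) (by positivity)
  have hprim : ∀ s ≤ 0, -prim (pathRate L ν₀ o) s ≤ L / 2 * s + (C₁ + k * C₂) := by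
    intro s hs0
    have hi : ∀ j, IntervalIntegrable (o j) volume 0 s := fun j => (ho j).intervalIntegrable _ _
    have hi2 : ∀ j, IntervalIntegrable (fun r => o j r ^ 2) volume 0 s := fun j =>
      ((ho j).pow 2).intervalIntegrable _ _
    have hsum : Continuous fun r => ∑ j, o j r := continuous_finsetSum _ fun j _ => ho j
    have hsum2 : Continuous fun r => ∑ j, o j r ^ 2 :=
      continuous_finsetSum _ fun j _ => (ho j).pow 2
    have e : prim (pathRate L ν₀ o) s = -L * s + (2 * (1 / (N : ℝ)) *
        ∑ j, ∫ r in (0 : ℝ)..s, o j r) + k * ∑ j, ∫ r in (0 : ℝ)..s, o j r ^ 2 := by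
      have e0 : ∀ r, pathRate L ν₀ o r =
          (-L + 2 * (1 / (N : ℝ)) * ∑ j, o j r) + k * ∑ j, o j r ^ 2 := fun r => by
        rw [pathRate, avg, smul_eq_mul]
        ring
      simp only [prim, e0]
      rw [intervalIntegral.integral_add (Continuous.intervalIntegrable (by fun_prop) _ _)
        (Continuous.intervalIntegrable (by fun_prop) _ _),
        intervalIntegral.integral_add (Continuous.intervalIntegrable (by fun_prop) _ _)
        (Continuous.intervalIntegrable (by fun_prop) _ _), intervalIntegral.integral_const,
        intervalIntegral.integral_const_mul, intervalIntegral.integral_const_mul,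
        intervalIntegral.integral_finsetSum fun j _ => hi j,
        intervalIntegral.integral_finsetSum fun j _ => hi2 j, smul_eq_mul]
      ring
    have h1 := neg_abs_le (2 * (1 / (N : ℝ)) * ∑ j, ∫ r in (0 : ℝ)..s, o j r)
    have h2 := hC₁ s
    have h3 := mul_le_mul_of_nonneg_left (hC₂ s hs0) hk0.le
    have h4 : ∑ j, ∫ r in (0 : ℝ)..s, o j r ^ 2 = -∑ j, ∫ r in s..(0 : ℝ), o j r ^ 2 := by
      rw [← Finset.sum_neg_distrib]
      exact Finset.sum_congr rfl fun j _ => intervalIntegral.integral_symm _ _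
    rw [abs_of_nonpos hs0] at h2 h3
    rw [e, h4]
    have h5 : k * K * -s ≤ L / 4 * -s := mul_le_mul_of_nonneg_right hK (by linarith)
    linarith
  have hsource : ∀ s, pathSource L f o s ≤
      (L⁻¹ * ∑ j, Real.exp (2 * C₃ j) * ‖f j 0‖ ^ 2) * Real.exp (L / 4 * |s|) := by
    intro s
    rw [pathSource, mul_assoc, Finset.sum_mul]
    refine mul_le_mul_of_nonneg_left (Finset.sum_le_sum fun j _ => ?_) (inv_nonneg.2 hL.le)
    rw [conjugateField, smul_zero, smul_zero, add_zero, norm_smul, mul_pow,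
      Real.norm_of_nonneg (Real.exp_pos _).le, mul_right_comm, ← Real.exp_nat_mul, ← Real.exp_add]
    refine mul_le_mul_of_nonneg_right (Real.exp_le_exp.2 ?_) (sq_nonneg _)
    have := (neg_le_abs (o j s)).trans (hC₃ j s)
    push_cast
    linarith
  set B := L⁻¹ * ∑ j, Real.exp (2 * C₃ j) * ‖f j 0‖ ^ 2 with hB
  have hB0 : 0 ≤ B := by positivity
  set D := C₁ + k * C₂
  refine ⟨L / 4, Real.exp D * (1 + B), by positivity, fun s hs0 => ?_⟩
  have h1 : Real.exp (-prim (pathRate L ν₀ o) s) ≤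
      Real.exp D * (Real.exp (L / 4 * s) * Real.exp (L / 4 * s)) := by
    rw [← Real.exp_add, ← Real.exp_add]
    exact Real.exp_le_exp.2 (by linarith [hprim s hs0])
  have h2 : Real.exp (L / 4 * s) ≤ 1 :=
    Real.exp_le_one_iff.2 (mul_nonpos_of_nonneg_of_nonpos (by positivity) hs0)
  have hD := Real.exp_pos D
  have hE := Real.exp_pos (L / 4 * s)
  have h3 : Real.exp D * (Real.exp (L / 4 * s) * Real.exp (L / 4 * s)) ≤
      Real.exp D * Real.exp (L / 4 * s) := by
    rw [← mul_assoc]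
    exact mul_le_of_le_one_right (by positivity) h2
  constructor
  · have : 0 ≤ Real.exp D * B * Real.exp (L / 4 * s) := by positivity
    calc _ ≤ _ := h1.trans h3
      _ ≤ _ := by linarith
  · have h4 := hsource s
    rw [abs_of_nonpos hs0] at h4
    have e : Real.exp (L / 4 * s) * Real.exp (L / 4 * -s) = 1 := by
      rw [← Real.exp_add, mul_neg, add_neg_cancel, Real.exp_zero]
    calc _ ≤ Real.exp D * (Real.exp (L / 4 * s) * Real.exp (L / 4 * s)) *
          (B * Real.exp (L / 4 * -s)) :=
          mul_le_mul h1 h4 (by unfold pathSource; positivity) (by positivity)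
      _ = Real.exp D * B * Real.exp (L / 4 * s) *
          (Real.exp (L / 4 * s) * Real.exp (L / 4 * -s)) := by ring
      _ = Real.exp D * B * Real.exp (L / 4 * s) := by rw [e, mul_one]
      _ ≤ Real.exp D * (1 + B) * Real.exp (L / 4 * s) := by
          have : 0 ≤ Real.exp D * Real.exp (L / 4 * s) := by positivity
          linarith

end Decay

/-! ### Moments and laws of centred Gaussian families -/

section Gaussian

variable {Ω : Type*} {mΩ : MeasurableSpace Ω} {P : Measure Ω}

/-- The function is the moment generating function of a centred Gaussian of variance `v`; each
derivative is a polynomial times the same exponential. -/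
theorem iteratedDeriv_four_exp (v : ℝ) :
    iteratedDeriv 4 (fun t : ℝ => Real.exp (v * t ^ 2 / 2)) 0 = 3 * v ^ 2 := by
  have hp : ∀ t : ℝ, HasDerivAt (fun t : ℝ => Real.exp (v * t ^ 2 / 2))
      (v * t * Real.exp (v * t ^ 2 / 2)) t := fun t => by
    have h1 : HasDerivAt (fun t : ℝ => v * t ^ 2 / 2) (v * t) t := by
      refine ((hasDerivAt_pow 2 t).const_mul v |>.div_const 2).congr_deriv ?_
      norm_num
      ring
    refine h1.exp.congr_deriv ?_
    ring
  have hstep : ∀ (p p' : ℝ → ℝ), (∀ t, HasDerivAt p (p' t) t) →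
      deriv (fun t => p t * Real.exp (v * t ^ 2 / 2)) =
        fun t => (p' t + p t * (v * t)) * Real.exp (v * t ^ 2 / 2) := fun p p' h => by
    funext t
    exact ((h t).fun_mul (hp t)).deriv.trans (by ring)
  have h1 : deriv (fun t : ℝ => Real.exp (v * t ^ 2 / 2)) =
      fun t => (v * t) * Real.exp (v * t ^ 2 / 2) := funext fun t => (hp t).deriv
  have d1 : ∀ t : ℝ, HasDerivAt (fun t => v * t) v t := fun t => by
    simpa using (hasDerivAt_id t).const_mul v
  have d2 : ∀ t : ℝ, HasDerivAt (fun t => v + v * t * (v * t)) (2 * v ^ 2 * t) t := fun t => by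
    refine (((d1 t).mul (d1 t)).const_add v).congr_deriv ?_
    ring
  have d3 : ∀ t : ℝ, HasDerivAt (fun t => 2 * v ^ 2 * t + (v + v * t * (v * t)) * (v * t))
      (3 * v ^ 2 + 3 * v ^ 3 * t ^ 2) t := fun t => by
    refine (((hasDerivAt_id t).const_mul (2 * v ^ 2)).add ((d2 t).mul (d1 t))).congr_deriv ?_
    ring
  rw [iteratedDeriv_eq_iterate]
  simp only [Function.iterate_succ, Function.iterate_zero, Function.comp_apply, id]
  rw [h1, hstep _ _ d1, hstep _ _ d2, hstep _ _ d3]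
  simp

/-- The fourth moment of a centred Gaussian variable. -/
theorem integral_pow_four {X : Ω → ℝ} (hX : HasGaussianLaw X P) (h0 : ∫ ω, X ω ∂P = 0) :
    ∫ ω, X ω ^ 4 ∂P = 3 * (∫ ω, X ω ^ 2 ∂P) ^ 2 := by
  have := hX.isProbabilityMeasure
  have hv : Var[X; P] = ∫ ω, X ω ^ 2 ∂P := variance_of_integral_eq_zero hX.aemeasurable h0
  have hmap := hX.map_eq_gaussianReal
  rw [h0] at hmap
  have h1 : ∫ ω, X ω ^ 4 ∂P = ∫ x, x ^ 4 ∂(gaussianReal 0 Var[X; P].toNNReal) := by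
    rw [← hmap, integral_map hX.aemeasurable (by fun_prop)]
  have h2 := iteratedDeriv_mgf_zero (X := id) (μ := gaussianReal 0 Var[X; P].toNNReal)
    (by simp [integrableExpSet_id_gaussianReal]) 4
  rw [mgf_id_gaussianReal] at h2
  simp only [zero_mul, zero_add, Real.coe_toNNReal _ (variance_nonneg X P), Pi.pow_apply, id] at h2
  rw [iteratedDeriv_four_exp] at h2
  rw [h1, ← h2, hv]

/-- Isserlis' formula for the second moment of the squares. -/
theorem integral_sq_mul_sq {X Y : Ω → ℝ} (hXY : HasGaussianLaw (fun ω => (X ω, Y ω)) P)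
    (hX0 : ∫ ω, X ω ∂P = 0) (hY0 : ∫ ω, Y ω ∂P = 0) :
    Integrable (fun ω => X ω ^ 2 * Y ω ^ 2) P ∧ ∫ ω, X ω ^ 2 * Y ω ^ 2 ∂P =
      (∫ ω, X ω ^ 2 ∂P) * (∫ ω, Y ω ^ 2 ∂P) + 2 * (∫ ω, X ω * Y ω ∂P) ^ 2 := by
  have := hXY.isProbabilityMeasure
  have hX := hXY.fst
  have hY := hXY.snd
  have hA := hXY.fun_add
  have hS := hXY.fun_sub
  have hpow : ∀ {Z : Ω → ℝ}, HasGaussianLaw Z P → Integrable (fun ω => Z ω ^ 4) P := fun {Z} hZ => by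
    have h : MemLp Z ((4 : ℕ) : ℝ≥0∞) P := hZ.memLp (by simp)
    refine (h.integrable_norm_pow (by norm_num)).congr (Eventually.of_forall fun ω => ?_)
    exact Even.pow_abs (by decide) _
  have hsq : ∀ {Z : Ω → ℝ}, HasGaussianLaw Z P → Integrable (fun ω => Z ω ^ 2) P := fun hZ =>
    hZ.memLp_two.integrable_sq
  have hXi := hX.integrable
  have hYi := hY.integrable
  have hXYi : Integrable (fun ω => X ω * Y ω) P := hX.memLp_two.integrable_mul hY.memLp_two
  -- Polarization reduces the mixed moment to fourth moments of the Gaussian variables `X`, `Y` and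
  -- `X ± Y`.
  have e : ∀ ω, X ω ^ 2 * Y ω ^ 2 = (1 / 12) * ((X ω + Y ω) ^ 4 + (X ω - Y ω) ^ 4) -
      (1 / 6) * (X ω ^ 4 + Y ω ^ 4) := fun ω => by ring
  have hi1 : Integrable (fun ω => (1 / 12 : ℝ) * ((X ω + Y ω) ^ 4 + (X ω - Y ω) ^ 4)) P :=
    ((hpow hA).add (hpow hS)).const_mul _
  have hi2 : Integrable (fun ω => (1 / 6 : ℝ) * (X ω ^ 4 + Y ω ^ 4)) P :=
    ((hpow hX).add (hpow hY)).const_mul _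
  refine ⟨by simp only [e]; exact hi1.sub hi2, ?_⟩
  simp only [e]
  have hA0 : ∫ ω, (X ω + Y ω) ∂P = 0 := by rw [integral_add hXi hYi, hX0, hY0, add_zero]
  have hS0 : ∫ ω, (X ω - Y ω) ∂P = 0 := by rw [integral_sub hXi hYi, hX0, hY0, sub_zero]
  have hA2 : ∫ ω, (X ω + Y ω) ^ 2 ∂P =
      ∫ ω, X ω ^ 2 ∂P + 2 * ∫ ω, X ω * Y ω ∂P + ∫ ω, Y ω ^ 2 ∂P := by
    have hi : Integrable (fun ω => X ω ^ 2 + 2 * (X ω * Y ω)) P := (hsq hX).add (hXYi.const_mul 2)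
    rw [← integral_const_mul, ← integral_add (hsq hX) (hXYi.const_mul 2),
      ← integral_add hi (hsq hY)]
    exact integral_congr_ae (Eventually.of_forall fun ω => by ring)
  have hS2 : ∫ ω, (X ω - Y ω) ^ 2 ∂P =
      ∫ ω, X ω ^ 2 ∂P - 2 * ∫ ω, X ω * Y ω ∂P + ∫ ω, Y ω ^ 2 ∂P := by
    have hi : Integrable (fun ω => X ω ^ 2 - 2 * (X ω * Y ω)) P := (hsq hX).sub (hXYi.const_mul 2)
    rw [← integral_const_mul, ← integral_sub (hsq hX) (hXYi.const_mul 2),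
      ← integral_add hi (hsq hY)]
    exact integral_congr_ae (Eventually.of_forall fun ω => by ring)
  rw [integral_sub hi1 hi2, integral_const_mul, integral_const_mul,
    integral_add (hpow hA) (hpow hS), integral_add (hpow hX) (hpow hY), integral_pow_four hA hA0,
    integral_pow_four hS hS0, integral_pow_four hX hX0, integral_pow_four hY hY0, hA2, hS2]
  ring

/-- Centred Gaussian processes with the same covariance have the same law. -/
theorem identDistrib_of_covariance {T : Type*} {X Y : T → Ω → ℝ} (hX : IsGaussianProcess X P)
    (hY : IsGaussianProcess Y P) (hX0 : ∀ t, ∫ ω, X t ω ∂P = 0) (hY0 : ∀ t, ∫ ω, Y t ω ∂P = 0)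
    (hXm : ∀ t, Measurable (X t)) (hYm : ∀ t, Measurable (Y t))
    (hcov : ∀ s t, ∫ ω, X s ω * X t ω ∂P = ∫ ω, Y s ω * Y t ω ∂P) :
    IdentDistrib (fun ω t => X t ω) (fun ω t => Y t ω) P P := by
  classical
  have := hX.isProbabilityMeasure
  rw [identDistrib_iff_forall_finset_identDistrib (measurable_pi_iff.2 hXm).aemeasurable
    (measurable_pi_iff.2 hYm).aemeasurable]
  intro I
  refine ⟨(hX.hasGaussianLaw I).aemeasurable, (hY.hasGaussianLaw I).aemeasurable, ?_⟩
  have hfX := (hX.hasGaussianLaw I).isGaussian_map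
  have hfY := (hY.hasGaussianLaw I).isGaussian_map
  -- A Gaussian law is determined by the means and variances of its linear functionals, and these
  -- are computed from the covariances.
  refine Measure.ext_of_charFunDual (funext fun L => ?_)
  rw [(hX.hasGaussianLaw I).charFunDual_map_eq, (hY.hasGaussianLaw I).charFunDual_map_eq]
  have hL : ∀ Z : T → Ω → ℝ, (L ∘ fun ω => I.restrict fun t => Z t ω) =
      fun ω => ∑ i : I, L (Pi.single i 1) * Z i ω := by
    intro Z
    funext ω
    rw [Function.comp_apply, ← ContinuousLinearMap.coe_coe,
      LinearMap.pi_apply_eq_sum_univ (L : (I → ℝ) →ₗ[ℝ] ℝ)]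
    refine Finset.sum_congr rfl fun i _ => ?_
    rw [smul_eq_mul, mul_comm]
    congr 2
    funext j
    simp [Pi.single_apply, eq_comm]
  have hmean : ∀ {Z : T → Ω → ℝ}, IsGaussianProcess Z P → (∀ t, ∫ ω, Z t ω ∂P = 0) →
      ∫ ω, (L ∘ fun ω => I.restrict fun t => Z t ω) ω ∂P = 0 := by
    intro Z hZ hZ0
    rw [hL]
    beta_reduce
    rw [integral_finsetSum (f := fun (i : I) ω => L (Pi.single i 1) * Z i ω) Finset.univ
      fun i _ => (hZ.hasGaussianLaw_eval i).integrable.const_mul _]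
    simp [integral_const_mul, hZ0]
  have hvar : ∀ {Z : T → Ω → ℝ}, IsGaussianProcess Z P → (∀ t, ∫ ω, Z t ω ∂P = 0) →
      Var[L ∘ fun ω => I.restrict fun t => Z t ω; P] = ∑ i : I, ∑ j : I,
        L (Pi.single i 1) * L (Pi.single j 1) * ∫ ω, Z i ω * Z j ω ∂P := by
    intro Z hZ hZ0
    rw [variance_of_integral_eq_zero
      ((hZ.hasGaussianLaw I).map L).aemeasurable (hmean hZ hZ0), hL]
    have hi : ∀ i j : I, Integrable (fun ω =>
        L (Pi.single i 1) * L (Pi.single j 1) * (Z i ω * Z j ω)) P := fun i j =>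
      ((hZ.hasGaussianLaw_eval i).memLp_two.integrable_mul
        (hZ.hasGaussianLaw_eval j).memLp_two).const_mul _
    have e : ∀ ω, (∑ i : I, L (Pi.single i 1) * Z i ω) ^ 2 =
        ∑ i : I, ∑ j : I, L (Pi.single i 1) * L (Pi.single j 1) * (Z i ω * Z j ω) := fun ω => by
      rw [sq, Finset.sum_mul_sum]
      exact Finset.sum_congr rfl fun i _ => Finset.sum_congr rfl fun j _ => by ring
    simp only [e]
    rw [integral_finsetSum _ fun i _ => integrable_finsetSum _ fun j _ => hi i j]
    refine Finset.sum_congr rfl fun i _ => ?_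
    rw [integral_finsetSum _ fun j _ => hi i j]
    exact Finset.sum_congr rfl fun j _ => integral_const_mul _ _
  rw [hmean hX hX0, hmean hY hY0, hvar hX hX0, hvar hY hY0]
  simp only [hcov]

end Gaussian

/-! ### Two-sided Brownian motion: sublinear growth -/

section Brownian

variable {Ω : Type*} {mΩ : MeasurableSpace Ω} {P : Measure Ω} {W : ℝ → Ω → ℝ}

/-- A two-sided standard Brownian motion with continuous paths. -/
structure IsBrownian (W : ℝ → Ω → ℝ) (P : Measure Ω) : Prop where
  gaussian : IsGaussianProcess W P
  mean : ∀ t, ∫ ω, W t ω ∂P = 0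
  covariance : ∀ s t, ∫ ω, W s ω * W t ω ∂P = (|s| + |t| - |t - s|) / 2
  measurable : ∀ t, Measurable (W t)
  continuous : ∀ ω, Continuous fun t => W t ω
  zero : ∀ ω, W 0 ω = 0

/-- Time inversion: on positive times `q ↦ q W(σ / q)` is a centred Gaussian process with the
covariance of `W`. Continuity of `W` at `0` is thereby transferred to its growth at `σ ∞`. Times are
restricted to positive rationals so that the event is measurable for the product `σ`-algebra. -/
theorem IsBrownian.ae_small_at_infinity (hW : IsBrownian W P) {σ : ℝ} (hσ : |σ| = 1) :
    ∀ᵐ ω ∂P, ∀ k : ℕ, ∃ j : ℕ, ∀ t : ℝ, (j : ℝ) + 1 < t → |W (σ * t) ω| ≤ t / (k + 1) := by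
  have := hW.gaussian.isProbabilityMeasure
  let T := {q : ℚ // 0 < q}
  have hpos : ∀ q : T, (0 : ℝ) < (q.1 : ℝ) := fun q => by exact_mod_cast q.2
  let X : T → Ω → ℝ := fun q ω => W (q.1 : ℝ) ω
  let Y : T → Ω → ℝ := fun q ω => (q.1 : ℝ) * W (σ * (q.1 : ℝ)⁻¹) ω
  have hX : IsGaussianProcess X P := hW.gaussian.comp_right fun q : T => (q.1 : ℝ)
  have hY : IsGaussianProcess Y P :=
    (hW.gaussian.comp_right fun q : T => σ * (q.1 : ℝ)⁻¹).smul fun q : T => (q.1 : ℝ)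
  have hid : IdentDistrib (fun ω t => X t ω) (fun ω t => Y t ω) P P := by
    refine identDistrib_of_covariance hX hY (fun t => hW.mean _) (fun t => ?_)
      (fun t => hW.measurable _) (fun t => (hW.measurable _).const_mul _) fun s t => ?_
    · simp only [Y, integral_const_mul, hW.mean, mul_zero]
    · have e : ∀ ω, Y s ω * Y t ω =
          ((s.1 : ℝ) * t.1) * (W (σ * (s.1 : ℝ)⁻¹) ω * W (σ * (t.1 : ℝ)⁻¹) ω) := fun ω => by
        simp only [Y]
        ring
      simp only [e, integral_const_mul, X, hW.covariance]
      have hs := hpos s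
      have ht := hpos t
      rw [← mul_sub, abs_mul, abs_mul, abs_mul, hσ, abs_of_pos hs, abs_of_pos ht,
        abs_of_pos (inv_pos.2 hs), abs_of_pos (inv_pos.2 ht)]
      have h1 : (t.1 : ℝ)⁻¹ - (s.1 : ℝ)⁻¹ = (s.1 - t.1) * ((s.1 : ℝ)⁻¹ * (t.1 : ℝ)⁻¹) := by
        field_simp
      rw [h1, abs_mul, abs_of_pos (mul_pos (inv_pos.2 hs) (inv_pos.2 ht)),
        abs_sub_comm (s.1 : ℝ) t.1]
      field_simp
      ring
  let B : Set (T → ℝ) :=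
    ⋂ k : ℕ, ⋃ j : ℕ, ⋂ q : T, {x | (q.1 : ℝ) < 1 / ((j : ℝ) + 1) → |x q| ≤ 1 / ((k : ℝ) + 1)}
  have hB : MeasurableSet B := by
    refine MeasurableSet.iInter fun k => MeasurableSet.iUnion fun j => MeasurableSet.iInter fun q => ?_
    by_cases hq : (q.1 : ℝ) < 1 / ((j : ℝ) + 1)
    · simp only [hq, true_imp_iff]
      exact measurableSet_le (measurable_pi_apply q).norm measurable_const
    · simp only [hq, false_imp_iff]
      exact MeasurableSet.univ
  have hXB : ∀ ω, (fun t => X t ω) ∈ B := by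
    intro ω
    simp only [B, Set.mem_iInter, Set.mem_iUnion, Set.mem_ofPred_eq]
    intro k
    have hk : (0 : ℝ) < 1 / ((k : ℝ) + 1) := by positivity
    obtain ⟨δ, hδ, h⟩ := Metric.continuousAt_iff.1 ((hW.continuous ω).continuousAt (x := (0 : ℝ))) _ hk
    obtain ⟨j, hj⟩ := exists_nat_one_div_lt hδ
    refine ⟨j, fun q hq => ?_⟩
    have := h (x := (q.1 : ℝ)) (by
      rw [Real.dist_eq, sub_zero, abs_of_pos (hpos q)]
      exact hq.trans hj)
    rw [hW.zero, Real.dist_eq, sub_zero] at this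
    exact this.le
  have hYB : ∀ᵐ ω ∂P, (fun t => Y t ω) ∈ B := by
    have h1 := hid.measure_mem_eq hB
    have h2 : (fun ω t => X t ω) ⁻¹' B = Set.univ := Set.eq_univ_of_forall hXB
    rw [h2, measure_univ] at h1
    exact (prob_compl_eq_zero_iff
      (measurable_pi_iff.2 (fun t => (hW.measurable _).const_mul _) hB)).2 h1.symm
  filter_upwards [hYB] with ω hω k
  simp only [B, Set.mem_iInter, Set.mem_iUnion, Set.mem_ofPred_eq] at hω
  obtain ⟨j, hj⟩ := hω k
  refine ⟨j, fun t ht => ?_⟩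
  have hcl : IsClosed {t : ℝ | |W (σ * t) ω| ≤ t / (k + 1)} :=
    isClosed_le ((hW.continuous ω).comp (continuous_const.mul continuous_id)).abs
      (continuous_id.div_const _)
  -- For rational times the claim is the event `B` at `q = 1 / r`; continuity of the path extends it
  -- to real times.
  have hsub : Set.Ioi ((j : ℝ) + 1) ∩ Set.range ((↑) : ℚ → ℝ) ⊆
      {t : ℝ | |W (σ * t) ω| ≤ t / (k + 1)} := by
    rintro _ ⟨hr, r, rfl⟩
    have hr' : (j : ℝ) + 1 < r := hr
    have hj1 : (0 : ℝ) < (j : ℝ) + 1 := by positivity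
    have hr0 : (0 : ℝ) < r := hj1.trans hr'
    have hr0' : 0 < r := by exact_mod_cast hr0
    have h := hj ⟨r⁻¹, inv_pos.2 hr0'⟩ (by
      push_cast
      rw [one_div]
      exact inv_strictAnti₀ hj1 hr')
    simp only [Y, Rat.cast_inv, inv_inv, abs_mul, abs_of_pos (inv_pos.2 hr0)] at h
    rw [Set.mem_ofPred_eq, div_eq_mul_one_div]
    rwa [inv_mul_le_iff₀ hr0] at h
  exact closure_minimal hsub hcl
    ((Rat.isDenseEmbedding_coe_real.dense.open_subset_closure_inter isOpen_Ioi) ht)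

theorem IsBrownian.ae_sublinear (hW : IsBrownian W P) :
    ∀ᵐ ω ∂P, Sublinear fun t => W t ω := by
  filter_upwards [hW.ae_small_at_infinity (σ := 1) (by simp),
    hW.ae_small_at_infinity (σ := -1) (by simp)] with ω h1 h2 ε hε
  obtain ⟨k, hk⟩ := exists_nat_one_div_lt hε
  obtain ⟨j₁, hj₁⟩ := h1 k
  obtain ⟨j₂, hj₂⟩ := h2 k
  set J : ℝ := (j₁ : ℝ) + j₂ + 1 with hJ
  have hj₁0 : (0 : ℝ) ≤ j₁ := by positivity
  have hj₂0 : (0 : ℝ) ≤ j₂ := by positivity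
  obtain ⟨C, hC⟩ := (isCompact_Icc (a := -J) (b := J)).exists_bound_of_continuousOn
    (hW.continuous ω).continuousOn
  have hC0 : 0 ≤ C := (norm_nonneg _).trans (hC 0 ⟨by linarith, by linarith⟩)
  have hkt : ∀ t : ℝ, 0 ≤ t → t / (k + 1) ≤ ε * t := fun t ht => by
    rw [div_eq_mul_one_div, mul_comm]
    exact mul_le_mul_of_nonneg_right hk.le ht
  refine ⟨C, fun t => ?_⟩
  by_cases ht : |t| ≤ J
  · have := hC t (abs_le.1 ht)
    rw [Real.norm_eq_abs] at this
    have : 0 ≤ ε * |t| := by positivity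
    linarith
  · push Not at ht
    suffices h : |W t ω| ≤ |t| / (k + 1) from by linarith [hkt |t| (abs_nonneg t)]
    rcases le_total 0 t with h0 | h0
    · rw [abs_of_nonneg h0] at ht ⊢
      simpa using hj₁ t (by linarith)
    · rw [abs_of_nonpos h0] at ht ⊢
      simpa using hj₂ (-t) (by linarith)

end Brownian

/-! ### Second moment bounds for integrated squares of Gaussian processes -/

section SecondMoment

variable {Ω : Type*} {mΩ : MeasurableSpace Ω} {P : Measure Ω}
  {E : Type*} {mE : MeasurableSpace E} {μ : Measure E} [SFinite μ] {Y : E → Ω → ℝ}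

theorem lintegral_sq_eq (hY : Measurable (Function.uncurry Y)) (hYp : ∀ p, HasGaussianLaw (Y p) P) :
    ∫⁻ ω, ∫⁻ p, ENNReal.ofReal (Y p ω ^ 2) ∂μ ∂P =
      ∫⁻ p, ENNReal.ofReal (∫ ω, Y p ω ^ 2 ∂P) ∂μ := by
  have := fun p => (hYp p).isProbabilityMeasure
  rcases isEmpty_or_nonempty E with hE | ⟨⟨p₀⟩⟩
  · simp [lintegral_of_isEmpty]
  have := this p₀
  have hm : Measurable fun z : Ω × E => ENNReal.ofReal (Y z.2 z.1 ^ 2) :=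
    ((hY.comp measurable_swap).pow_const 2).ennreal_ofReal
  rw [lintegral_lintegral_swap hm.aemeasurable]
  exact lintegral_congr fun p => (ofReal_integral_eq_lintegral_ofReal
    (hYp p).memLp_two.integrable_sq (Eventually.of_forall fun ω => sq_nonneg _)).symm

/-- Isserlis' formula for the second moment of the integrated square. -/
theorem lintegral_sq_sq_eq (hY : Measurable (Function.uncurry Y))
    (hYpq : ∀ p q, HasGaussianLaw (fun ω => (Y p ω, Y q ω)) P) (hY0 : ∀ p, ∫ ω, Y p ω ∂P = 0)
    [IsProbabilityMeasure P] :
    ∫⁻ ω, (∫⁻ p, ENNReal.ofReal (Y p ω ^ 2) ∂μ) ^ 2 ∂P =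
      (∫⁻ p, ENNReal.ofReal (∫ ω, Y p ω ^ 2 ∂P) ∂μ) ^ 2 +
        2 * ∫⁻ p, ∫⁻ q, ENNReal.ofReal ((∫ ω, Y p ω * Y q ω ∂P) ^ 2) ∂μ ∂μ := by
  have hm : Measurable fun z : Ω × E => ENNReal.ofReal (Y z.2 z.1 ^ 2) :=
    ((hY.comp measurable_swap).pow_const 2).ennreal_ofReal
  have hm1 : ∀ p, Measurable fun ω => ENNReal.ofReal (Y p ω ^ 2) := fun p =>
    hm.comp (measurable_id.prodMk measurable_const)
  have hm2 : ∀ ω, Measurable fun p => ENNReal.ofReal (Y p ω ^ 2) := fun ω =>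
    hm.comp (measurable_const.prodMk measurable_id)
  have hS : Measurable fun ω => ∫⁻ p, ENNReal.ofReal (Y p ω ^ 2) ∂μ := hm.lintegral_prod_right'
  have hcov : Measurable fun z : E × E => ∫ ω, Y z.1 ω * Y z.2 ω ∂P := by
    have h : StronglyMeasurable fun w : (E × E) × Ω => Y w.1.1 w.2 * Y w.1.2 w.2 :=
      ((hY.comp ((measurable_fst.comp measurable_fst).prodMk measurable_snd)).mul
        (hY.comp ((measurable_snd.comp measurable_fst).prodMk measurable_snd))).stronglyMeasurable
    exact h.integral_prod_right'.measurable
  have hvar : Measurable fun p => ∫ ω, Y p ω ^ 2 ∂P := by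
    have h := hcov.comp (measurable_id.prodMk measurable_id)
    simpa only [Function.comp_def, id, ← sq] using h
  calc ∫⁻ ω, (∫⁻ p, ENNReal.ofReal (Y p ω ^ 2) ∂μ) ^ 2 ∂P
      = ∫⁻ ω, ∫⁻ p, ∫⁻ q, ENNReal.ofReal (Y p ω ^ 2 * Y q ω ^ 2) ∂μ ∂μ ∂P := by
        refine lintegral_congr fun ω => ?_
        rw [sq, ← lintegral_mul_const _ (hm2 ω)]
        refine lintegral_congr fun p => ?_
        rw [← lintegral_const_mul _ (hm2 ω)]
        exact lintegral_congr fun q => (ENNReal.ofReal_mul (sq_nonneg _)).symm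
    _ = ∫⁻ p, ∫⁻ q, ∫⁻ ω, ENNReal.ofReal (Y p ω ^ 2 * Y q ω ^ 2) ∂P ∂μ ∂μ := by
        have h3 : Measurable fun z : (Ω × E) × E =>
            ENNReal.ofReal (Y z.1.2 z.1.1 ^ 2 * Y z.2 z.1.1 ^ 2) :=
          (((hY.comp ((measurable_snd.comp measurable_fst).prodMk
            (measurable_fst.comp measurable_fst))).pow_const 2).mul
            ((hY.comp (measurable_snd.prodMk
              (measurable_fst.comp measurable_fst))).pow_const 2)).ennreal_ofReal
        rw [lintegral_lintegral_swap h3.lintegral_prod_right'.aemeasurable]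
        refine lintegral_congr fun p => ?_
        exact lintegral_lintegral_swap (h3.comp (((measurable_fst).prodMk
          measurable_const).prodMk measurable_snd)).aemeasurable
    _ = ∫⁻ p, ∫⁻ q, (ENNReal.ofReal (∫ ω, Y p ω ^ 2 ∂P) * ENNReal.ofReal (∫ ω, Y q ω ^ 2 ∂P) +
          2 * ENNReal.ofReal ((∫ ω, Y p ω * Y q ω ∂P) ^ 2)) ∂μ ∂μ := by
        refine lintegral_congr fun p => lintegral_congr fun q => ?_
        obtain ⟨hi, he⟩ := integral_sq_mul_sq (hYpq p q) (hY0 p) (hY0 q)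
        rw [← ofReal_integral_eq_lintegral_ofReal hi (Eventually.of_forall fun ω => by positivity),
          he, ENNReal.ofReal_add (mul_nonneg (integral_nonneg fun ω => sq_nonneg _)
            (integral_nonneg fun ω => sq_nonneg _)) (by positivity),
          ENNReal.ofReal_mul (integral_nonneg fun ω => sq_nonneg _),
          ENNReal.ofReal_mul zero_le_two, ENNReal.ofReal_ofNat]
    _ = _ := by
        have h4 : Measurable fun z : E × E =>
            2 * ENNReal.ofReal ((∫ ω, Y z.1 ω * Y z.2 ω ∂P) ^ 2) :=
          (hcov.pow_const 2).ennreal_ofReal.const_mul 2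
        have h5 : ∀ p, ∫⁻ q, (ENNReal.ofReal (∫ ω, Y p ω ^ 2 ∂P) *
            ENNReal.ofReal (∫ ω, Y q ω ^ 2 ∂P) +
              2 * ENNReal.ofReal ((∫ ω, Y p ω * Y q ω ∂P) ^ 2)) ∂μ =
            ENNReal.ofReal (∫ ω, Y p ω ^ 2 ∂P) * (∫⁻ q, ENNReal.ofReal (∫ ω, Y q ω ^ 2 ∂P) ∂μ) +
              2 * ∫⁻ q, ENNReal.ofReal ((∫ ω, Y p ω * Y q ω ∂P) ^ 2) ∂μ := fun p => by
          have h6 : Measurable fun q => ENNReal.ofReal ((∫ ω, Y p ω * Y q ω ∂P) ^ 2) :=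
            ((hcov.comp (measurable_const.prodMk measurable_id)).pow_const 2).ennreal_ofReal
          rw [lintegral_add_left (hvar.ennreal_ofReal.const_mul _),
            lintegral_const_mul _ hvar.ennreal_ofReal, lintegral_const_mul _ h6]
        simp only [h5]
        rw [lintegral_add_left (hvar.ennreal_ofReal.mul_const _),
          lintegral_mul_const _ hvar.ennreal_ofReal, ← sq, lintegral_const_mul]
        exact (hcov.pow_const 2).ennreal_ofReal.lintegral_prod_right'

/-- Chebyshev's inequality for the integrated square of a Gaussian process. -/
theorem measure_integrated_sq_ge_le [IsProbabilityMeasure P] (hY : Measurable (Function.uncurry Y))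
    (hYpq : ∀ p q, HasGaussianLaw (fun ω => (Y p ω, Y q ω)) P) (hY0 : ∀ p, ∫ ω, Y p ω ∂P = 0)
    {a b T : ℝ} (ha : 0 ≤ a) (hb : 0 ≤ b) (hT : 0 < T)
    (hYa : ∫⁻ p, ENNReal.ofReal (∫ ω, Y p ω ^ 2 ∂P) ∂μ ≤ ENNReal.ofReal a)
    (hYb : ∫⁻ p, ∫⁻ q, ENNReal.ofReal ((∫ ω, Y p ω * Y q ω ∂P) ^ 2) ∂μ ∂μ ≤ ENNReal.ofReal b) :
    P {ω | ENNReal.ofReal (a + T) ≤ ∫⁻ p, ENNReal.ofReal (Y p ω ^ 2) ∂μ} ≤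
      ENNReal.ofReal (2 * b / T ^ 2) := by
  set S : Ω → ℝ≥0∞ := fun ω => ∫⁻ p, ENNReal.ofReal (Y p ω ^ 2) ∂μ with hSdef
  have hm : Measurable fun z : Ω × E => ENNReal.ofReal (Y z.2 z.1 ^ 2) :=
    ((hY.comp measurable_swap).pow_const 2).ennreal_ofReal
  have hS : Measurable S := hm.lintegral_prod_right'
  have h1 := lintegral_sq_eq (μ := μ) hY fun p => (hYpq p p).fst
  have h2 := lintegral_sq_sq_eq (μ := μ) hY hYpq hY0
  set A := ∫⁻ p, ENNReal.ofReal (∫ ω, Y p ω ^ 2 ∂P) ∂μ with hA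
  set B := ∫⁻ p, ∫⁻ q, ENNReal.ofReal ((∫ ω, Y p ω * Y q ω ∂P) ^ 2) ∂μ ∂μ with hB
  have hAtop : A ≠ ∞ := ne_top_of_le_ne_top ENNReal.ofReal_ne_top hYa
  have hBtop : B ≠ ∞ := ne_top_of_le_ne_top ENNReal.ofReal_ne_top hYb
  have hSfin : ∀ᵐ ω ∂P, S ω < ∞ := ae_lt_top hS (by rw [h1]; exact hAtop)
  have hZint : ∫ ω, (S ω).toReal ∂P = A.toReal := by
    rw [integral_toReal hS.aemeasurable hSfin, h1]
  have hZ2 : ∫ ω, (S ω).toReal ^ 2 ∂P = A.toReal ^ 2 + 2 * B.toReal := by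
    simp only [← ENNReal.toReal_pow]
    rw [integral_toReal (hS.pow_const 2).aemeasurable
      (hSfin.mono fun ω h => ENNReal.pow_lt_top h), h2, ENNReal.toReal_add
      (ENNReal.pow_ne_top hAtop) (ENNReal.mul_ne_top (by simp) hBtop), ENNReal.toReal_pow,
      ENNReal.toReal_mul, ENNReal.toReal_ofNat]
  have hmem : MemLp (fun ω => (S ω).toReal) 2 P := by
    rw [memLp_two_iff_integrable_sq hS.ennreal_toReal.aestronglyMeasurable]
    simp only [← ENNReal.toReal_pow]
    refine integrable_toReal_of_lintegral_ne_top (hS.pow_const 2).aemeasurable ?_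
    rw [h2]
    exact ENNReal.add_ne_top.2 ⟨ENNReal.pow_ne_top hAtop, ENNReal.mul_ne_top (by simp) hBtop⟩
  have hAa : A.toReal ≤ a := ENNReal.toReal_le_of_le_ofReal ha hYa
  have hBb : B.toReal ≤ b := ENNReal.toReal_le_of_le_ofReal hb hYb
  -- In Isserlis' formula the square of the mean cancels, so only the integrated squared covariance
  -- remains.
  have hvar : Var[fun ω => (S ω).toReal; P] = 2 * B.toReal := by
    rw [variance_eq_sub hmem]
    simp only [Pi.pow_apply, hZ2, hZint]
    ring
  calc P {ω | ENNReal.ofReal (a + T) ≤ S ω}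
      ≤ P {ω | T ≤ |(S ω).toReal - ∫ ω, (S ω).toReal ∂P|} := by
        refine measure_mono_ae (hSfin.mono fun ω hω h => ?_)
        have h' : a + T ≤ (S ω).toReal := (ENNReal.ofReal_le_iff_le_toReal hω.ne).1 h
        refine le_trans ?_ (le_abs_self _)
        rw [hZint]
        linarith
    _ ≤ ENNReal.ofReal (Var[fun ω => (S ω).toReal; P] / T ^ 2) := meas_ge_le_variance_div_sq hmem hT
    _ ≤ ENNReal.ofReal (2 * b / T ^ 2) := by
        rw [hvar]
        exact ENNReal.ofReal_le_ofReal (by gcongr)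

end SecondMoment

/-! ### The exponential weight -/

/-- The exponential distribution on the half-line. -/
def expWeight : Measure ℝ :=
  (volume.restrict (Set.Ioi 0)).withDensity fun u => ENNReal.ofReal (Real.exp (-u))

theorem measurable_expDensity : Measurable fun u : ℝ => ENNReal.ofReal (Real.exp (-u)) := by
  fun_prop

theorem lintegral_exp_mul_Ioi {a : ℝ} (ha : a < 0) :
    ∫⁻ u in Set.Ioi (0 : ℝ), ENNReal.ofReal (Real.exp (a * u)) = ENNReal.ofReal (-1 / a) := by
  rw [← ofReal_integral_eq_lintegral_ofReal (integrableOn_exp_mul_Ioi ha 0)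
    (Eventually.of_forall fun u => (Real.exp_pos _).le), integral_exp_mul_Ioi ha, mul_zero,
    Real.exp_zero]

theorem lintegral_expWeight {g : ℝ → ℝ≥0∞} (hg : Measurable g) :
    ∫⁻ u, g u ∂expWeight = ∫⁻ u in Set.Ioi 0, ENNReal.ofReal (Real.exp (-u)) * g u := by
  rw [expWeight, lintegral_withDensity_eq_lintegral_mul _ measurable_expDensity hg]
  rfl

instance : IsProbabilityMeasure expWeight := ⟨by
  rw [← lintegral_one, lintegral_expWeight measurable_const]
  simp only [mul_one]
  have := lintegral_exp_mul_Ioi (a := -1) (by norm_num)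
  simpa using this⟩

theorem lintegral_exp_half_expWeight :
    ∫⁻ u, ENNReal.ofReal (Real.exp (u / 2)) ∂expWeight = 2 := by
  rw [lintegral_expWeight (by fun_prop)]
  have h : ∀ u : ℝ, ENNReal.ofReal (Real.exp (-u)) * ENNReal.ofReal (Real.exp (u / 2)) =
      ENNReal.ofReal (Real.exp (-(1 / 2) * u)) := fun u => by
    rw [← ENNReal.ofReal_mul (Real.exp_pos _).le, ← Real.exp_add]
    congr 2
    ring
  simp only [h]
  rw [lintegral_exp_mul_Ioi (by norm_num)]
  norm_num

theorem ae_nonneg_expWeight : ∀ᵐ u ∂expWeight, 0 ≤ u := by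
  have h : ∀ᵐ u : ℝ ∂volume.restrict (Set.Ioi 0), 0 ≤ u :=
    (ae_restrict_mem measurableSet_Ioi).mono fun u hu => le_of_lt hu
  exact (withDensity_absolutelyContinuous _ _).ae_le h

theorem integral_expWeight (g : ℝ → ℝ) :
    ∫ u, g u ∂expWeight = ∫ u in Set.Ioi 0, Real.exp (-u) * g u := by
  rw [expWeight, integral_withDensity_eq_integral_toReal_smul measurable_expDensity
    (Eventually.of_forall fun _ => ENNReal.ofReal_lt_top)]
  simp only [ENNReal.toReal_ofReal (Real.exp_pos _).le, smul_eq_mul]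

theorem integrable_expWeight {g : ℝ → ℝ}
    (h : IntegrableOn (fun u => Real.exp (-u) * g u) (Set.Ioi 0)) : Integrable g expWeight := by
  rw [expWeight, integrable_withDensity_iff_integrable_smul' measurable_expDensity
    (Eventually.of_forall fun _ => ENNReal.ofReal_lt_top)]
  simpa only [ENNReal.toReal_ofReal (Real.exp_pos _).le, smul_eq_mul,
    IntegrableOn] using h

/-- The bound is uniform in `t`: one of the two time integrals in the variance stays bounded, so the
variance is linear in the window length. -/
theorem lintegral_exp_neg_abs_sub (t : ℝ) :
    ∫⁻ s, ENNReal.ofReal (Real.exp (-|t - s| / 2)) ≤ 4 := by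
  rw [lintegral_sub_left_eq_self (fun x : ℝ => ENNReal.ofReal (Real.exp (-|x| / 2))) t,
    ← lintegral_add_compl _ (measurableSet_Ioi (a := (0 : ℝ))), Set.compl_Ioi]
  have h1 : ∫⁻ x in Set.Ioi (0 : ℝ), ENNReal.ofReal (Real.exp (-|x| / 2)) = 2 := by
    rw [setLIntegral_congr_fun measurableSet_Ioi (g := fun x =>
      ENNReal.ofReal (Real.exp (-(1 / 2) * x))), lintegral_exp_mul_Ioi (by norm_num)]
    · norm_num
    · intro x hx
      beta_reduce
      rw [abs_of_pos hx]
      congr 2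
      ring
  have h2 : ∫⁻ x in Set.Iic (0 : ℝ), ENNReal.ofReal (Real.exp (-|x| / 2)) = 2 := by
    rw [setLIntegral_congr_fun measurableSet_Iic (g := fun x =>
      ENNReal.ofReal (Real.exp ((1 / 2) * x))),
      ← ofReal_integral_eq_lintegral_ofReal (integrableOn_exp_mul_Iic (by norm_num) 0)
        (Eventually.of_forall fun u => (Real.exp_pos _).le), integral_exp_mul_Iic (by norm_num)]
    · norm_num
    · intro x hx
      beta_reduce
      rw [abs_of_nonpos hx]
      congr 2
      ring
  rw [h1, h2]
  norm_num

/-- The Ornstein-Uhlenbeck path as a weighted average of increments. -/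
theorem Sublinear.ou_eq_integral {w : ℝ → ℝ} (hw : Sublinear w) (hc : Continuous w) (t : ℝ) :
    ou w t = ∫ u, (w t - w (t - u)) ∂expWeight := by
  have hmp : MeasurePreserving (fun u : ℝ => t - u) volume volume :=
    Measure.measurePreserving_sub_left volume t
  have hemb : MeasurableEmbedding (fun u : ℝ => t - u) :=
    (Homeomorph.subLeft t).measurableEmbedding
  have hpre : (fun u : ℝ => t - u) ⁻¹' Set.Iio t = Set.Ioi 0 := by
    ext u
    simp
  have e : ∀ u, Real.exp (-t) * (Real.exp (t - u) * w (t - u)) = Real.exp (-u) * w (t - u) :=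
    fun u => by
      rw [← mul_assoc, ← Real.exp_add]
      congr 2
      ring
  have hint : IntegrableOn (fun u => Real.exp (-u) * w (t - u)) (Set.Ioi 0) := by
    have h := (hw.integrableOn hc t).mono_set Set.Iio_subset_Iic_self
    have h' := (hmp.integrableOn_comp_preimage hemb).2 h
    rw [hpre] at h'
    exact (h'.const_mul (Real.exp (-t))).congr (Eventually.of_forall e)
  have hval : pastMean w t = ∫ u in Set.Ioi 0, Real.exp (-u) * w (t - u) := by
    have h := hmp.setIntegral_preimage_emb hemb (fun τ => Real.exp (-t) * (Real.exp τ * w τ))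
      (Set.Iio t)
    rw [hpre] at h
    simp only [e] at h
    rw [h, integral_const_mul, pastMean, integral_Iic_eq_integral_Iio]
  rw [ou_eq, integral_sub (integrable_const _) (integrable_expWeight hint), integral_const,
    integral_expWeight, hval]
  simp

/-- Jensen's inequality, obtained from the comparison of the `L¹` and `L²` norms on a probability
space. -/
theorem ofReal_sq_integral_le {E : Type*} {mE : MeasurableSpace E} {μ : Measure E}
    [IsProbabilityMeasure μ] {g : E → ℝ} (hg : AEStronglyMeasurable g μ) :
    ENNReal.ofReal ((∫ x, g x ∂μ) ^ 2) ≤ ∫⁻ x, ENNReal.ofReal (g x ^ 2) ∂μ := by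
  have e : ∀ x : ℝ, ENNReal.ofReal (x ^ 2) = ‖x‖ₑ ^ 2 := fun x => by
    rw [← sq_abs, ENNReal.ofReal_pow (abs_nonneg x), Real.enorm_eq_ofReal_abs]
  simp only [e]
  have h1 : ‖∫ x, g x ∂μ‖ₑ ≤ eLpNorm g 1 μ := by
    rw [eLpNorm_one_eq_lintegral_enorm]
    exact enorm_integral_le_lintegral_enorm g
  have h2 := h1.trans (eLpNorm_le_eLpNorm_of_exponent_le one_le_two hg)
  have h3 := eLpNorm_nnreal_pow_eq_lintegral (f := g) (μ := μ) (p := 2) two_ne_zero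
  simp only [NNReal.coe_ofNat, ENNReal.rpow_ofNat, ENNReal.coe_ofNat] at h3
  rw [← h3]
  exact pow_le_pow_left' h2 2

/-! ### Linear growth of the squared Ornstein-Uhlenbeck process -/

section BrownianSquare

variable {Ω : Type*} {mΩ : MeasurableSpace Ω} {P : Measure Ω} {W : ℝ → Ω → ℝ}

/-- The window `(-T, 0]` weighted by the exponential distribution of the lags. -/
def windowMeasure (T : ℝ) : Measure (ℝ × ℝ) :=
  (volume.restrict (Set.Ioc (-T) 0)).prod expWeight

instance (T : ℝ) : SFinite (windowMeasure T) := by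
  unfold windowMeasure
  infer_instance

theorem ae_nonneg_windowMeasure (T : ℝ) : ∀ᵐ p ∂windowMeasure T, 0 ≤ p.2 :=
  Measure.quasiMeasurePreserving_snd.ae ae_nonneg_expWeight

/-- The constant 8 is the inverse of the quadratic coefficient in `e^{y / 2} ≥ y ^ 2 / 8`. -/
theorem sq_le_exp_half {x y : ℝ} (h0 : 0 ≤ x) (hxy : x ≤ max 0 y) :
    x ^ 2 ≤ 8 * Real.exp (y / 2) := by
  rcases le_total y 0 with hy | hy
  · rw [max_eq_left hy] at hxy
    have : x = 0 := le_antisymm hxy h0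
    rw [this, zero_pow two_ne_zero]
    positivity
  · rw [max_eq_right hy] at hxy
    have := Real.quadratic_le_exp_of_nonneg (by positivity : 0 ≤ y / 2)
    nlinarith

/-- The quantity being squared is the length of the overlap of the intervals `(t - u, t]` and `(s -
v, s]`. It is at most the positive part of `u - |t - s|` when `s ≤ t`, and of `v - |t - s|` when `t
≤ s`; this gives exponential decay in `|t - s|`. -/
theorem overlap_sq_le {t s u v : ℝ} (hu : 0 ≤ u) (hv : 0 ≤ v) :
    ((|t - (s - v)| + |t - u - s| - |t - s| - |t - u - (s - v)|) / 2) ^ 2 ≤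
      8 * (Real.exp (-|t - s| / 2) * (Real.exp (u / 2) + Real.exp (v / 2))) := by
  set r := (|t - (s - v)| + |t - u - s| - |t - s| - |t - u - (s - v)|) / 2 with hr
  have hr0 : 0 ≤ r := by
    rw [hr]
    rcases abs_cases (t - (s - v)) with h1 | h1 <;> rcases abs_cases (t - u - s) with h2 | h2 <;>
      rcases abs_cases (t - s) with h3 | h3 <;>
      rcases abs_cases (t - u - (s - v)) with h4 | h4 <;> linarith
  have hx : 0 < Real.exp (-|t - s| / 2) := Real.exp_pos _
  rcases le_total s t with h | h
  · have hr1 : r ≤ max 0 (u - |t - s|) := by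
      rw [hr, le_max_iff, abs_of_nonneg (sub_nonneg.2 h), abs_of_nonneg (by linarith : 0 ≤ t - (s - v))]
      by_cases hc : u ≤ t - s
      · left
        rw [abs_of_nonneg (by linarith : 0 ≤ t - u - s),
          abs_of_nonneg (by linarith : 0 ≤ t - u - (s - v))]
        linarith
      · right
        rw [abs_of_nonpos (by linarith : t - u - s ≤ 0)]
        linarith [neg_abs_le (t - u - (s - v)), le_abs_self (t - u - (s - v))]
    have h1 := sq_le_exp_half hr0 hr1
    have h2 : Real.exp ((u - |t - s|) / 2) = Real.exp (-|t - s| / 2) * Real.exp (u / 2) := by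
      rw [← Real.exp_add]
      congr 1
      ring
    rw [h2] at h1
    have : 0 ≤ Real.exp (-|t - s| / 2) * Real.exp (v / 2) := by positivity
    linarith
  · have hr1 : r ≤ max 0 (v - |t - s|) := by
      rw [hr, le_max_iff, abs_of_nonpos (sub_nonpos.2 h), abs_of_nonpos (by linarith : t - u - s ≤ 0)]
      by_cases hc : v ≤ s - t
      · left
        rw [abs_of_nonpos (by linarith : t - (s - v) ≤ 0),
          abs_of_nonpos (by linarith : t - u - (s - v) ≤ 0)]
        linarith
      · right
        rw [abs_of_nonneg (by linarith : 0 ≤ t - (s - v))]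
        linarith [neg_abs_le (t - u - (s - v)), le_abs_self (t - u - (s - v))]
    have h1 := sq_le_exp_half hr0 hr1
    have h2 : Real.exp ((v - |t - s|) / 2) = Real.exp (-|t - s| / 2) * Real.exp (v / 2) := by
      rw [← Real.exp_add]
      congr 1
      ring
    rw [h2] at h1
    have : 0 ≤ Real.exp (-|t - s| / 2) * Real.exp (u / 2) := by positivity
    linarith

namespace IsBrownian

theorem increment_covariance (hW : IsBrownian W P) (t t' s s' : ℝ) :
    ∫ ω, (W t ω - W t' ω) * (W s ω - W s' ω) ∂P =
      (|t - s'| + |t' - s| - |t - s| - |t' - s'|) / 2 := by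
  have hi : ∀ a b, Integrable (fun ω => W a ω * W b ω) P := fun a b =>
    (hW.gaussian.hasGaussianLaw_eval a).memLp_two.integrable_mul
      (hW.gaussian.hasGaussianLaw_eval b).memLp_two
  have e : ∀ ω, (W t ω - W t' ω) * (W s ω - W s' ω) =
      (W t ω * W s ω - W t ω * W s' ω) - (W t' ω * W s ω - W t' ω * W s' ω) := fun ω => by ring
  simp only [e]
  rw [integral_sub, integral_sub (hi _ _) (hi _ _), integral_sub (hi _ _) (hi _ _)]
  · simp only [hW.covariance, abs_sub_comm s t, abs_sub_comm s' t, abs_sub_comm s t',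
      abs_sub_comm s' t']
    ring
  · exact (hi _ _).sub (hi _ _)
  · exact (hi _ _).sub (hi _ _)

theorem measurable_uncurry (hW : IsBrownian W P) : Measurable (Function.uncurry W) :=
  measurable_uncurry_of_continuous_of_measurable hW.continuous hW.measurable

theorem measurable_increment (hW : IsBrownian W P) :
    Measurable (Function.uncurry fun (p : ℝ × ℝ) ω => W p.1 ω - W (p.1 - p.2) ω) := by
  have h1 : Measurable fun z : (ℝ × ℝ) × Ω => (z.1.1, z.2) := by fun_prop
  have h2 : Measurable fun z : (ℝ × ℝ) × Ω => (z.1.1 - z.1.2, z.2) := by fun_prop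
  exact (hW.measurable_uncurry.comp h1).sub (hW.measurable_uncurry.comp h2)

theorem gaussian_increment (hW : IsBrownian W P) (p q : ℝ × ℝ) :
    HasGaussianLaw (fun ω => (W p.1 ω - W (p.1 - p.2) ω, W q.1 ω - W (q.1 - q.2) ω)) P := by
  have h : IsGaussianProcess (fun (p : ℝ × ℝ) ω => W p.1 ω - W (p.1 - p.2) ω) P := by
    classical
    refine hW.gaussian.of_isGaussianProcess fun p => ⟨{p.1, p.1 - p.2},
      ContinuousLinearMap.proj ⟨p.1, by simp⟩ - ContinuousLinearMap.proj ⟨p.1 - p.2, by simp⟩,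
      fun ω => ?_⟩
    simp
  exact h.hasGaussianLaw_prodMk

/-- An increment with lag `u` has variance `u ≤ 2 e^{u / 2}`, and `e^{u / 2}` has mean 2 under the
exponential law. -/
theorem lintegral_variance_le (hW : IsBrownian W P) (T : ℝ) :
    ∫⁻ p, ENNReal.ofReal (∫ ω, (W p.1 ω - W (p.1 - p.2) ω) ^ 2 ∂P) ∂windowMeasure T ≤
      ENNReal.ofReal (4 * T) := by
  calc ∫⁻ p, ENNReal.ofReal (∫ ω, (W p.1 ω - W (p.1 - p.2) ω) ^ 2 ∂P) ∂windowMeasure T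
      ≤ ∫⁻ p : ℝ × ℝ, 2 * ENNReal.ofReal (Real.exp (p.2 / 2)) ∂windowMeasure T := by
        refine lintegral_mono_ae ((ae_nonneg_windowMeasure T).mono fun p hp => ?_)
        simp only [sq, hW.increment_covariance]
        rw [← ENNReal.ofReal_ofNat 2, ← ENNReal.ofReal_mul zero_le_two]
        refine ENNReal.ofReal_le_ofReal ?_
        have h1 := Real.add_one_le_exp (p.2 / 2)
        rw [sub_sub_cancel, sub_self, sub_self, sub_sub_cancel_left, abs_neg, abs_zero, abs_of_nonneg hp]
        linarith
    _ = ENNReal.ofReal (4 * T) := by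
        have hg : Measurable fun u : ℝ => ENNReal.ofReal (Real.exp (u / 2)) := by fun_prop
        rw [windowMeasure, lintegral_prod _ (by fun_prop)]
        simp only [lintegral_const_mul _ hg, lintegral_exp_half_expWeight, lintegral_const,
          Measure.restrict_apply_univ, Real.volume_Ioc]
        rw [sub_neg_eq_add, zero_add, ENNReal.ofReal_mul (by norm_num)]
        norm_num

/-- The squared covariance is bounded by `overlap_sq_le`. Its integral over one time variable is at
most 4, the exponential lags contribute `2 + 2`, and the other time variable gives `T`: in all `8 *
4 * 4 * T`. -/
theorem lintegral_covariance_sq_le (hW : IsBrownian W P) (T : ℝ) :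
    ∫⁻ p, ∫⁻ q, ENNReal.ofReal ((∫ ω, (W p.1 ω - W (p.1 - p.2) ω) *
      (W q.1 ω - W (q.1 - q.2) ω) ∂P) ^ 2) ∂windowMeasure T ∂windowMeasure T ≤
      ENNReal.ofReal (128 * T) := by
  have hg : Measurable fun u : ℝ => ENNReal.ofReal (Real.exp (u / 2)) := by fun_prop
  set g : ℝ → ℝ≥0∞ := fun u => ENNReal.ofReal (Real.exp (u / 2)) with hgdef
  set k : ℝ → ℝ → ℝ≥0∞ := fun t s => ENNReal.ofReal (Real.exp (-|t - s| / 2)) with hkdef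
  have hk : ∀ t, Measurable (k t) := fun t => by fun_prop
  have hinner : ∀ t u : ℝ, ∫⁻ q : ℝ × ℝ, 8 * (k t q.1 * (g u + g q.2)) ∂windowMeasure T ≤
      32 * (g u + 2) := fun t u => by
    have hm : Measurable fun q : ℝ × ℝ => k t q.1 * (g u + g q.2) :=
      ((hk t).comp measurable_fst).mul (measurable_const.add (hg.comp measurable_snd))
    rw [lintegral_const_mul _ hm, windowMeasure, lintegral_prod _ hm.aemeasurable]
    have h1 : ∀ s, ∫⁻ v, k t s * (g u + g v) ∂expWeight = k t s * (g u + 2) := fun s => by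
      have hm' : Measurable fun v => g u + g v := measurable_const.add hg
      rw [lintegral_const_mul _ hm', lintegral_add_left measurable_const,
        lintegral_exp_half_expWeight, lintegral_const, measure_univ, mul_one]
    simp only [h1]
    rw [lintegral_mul_const _ (hk t)]
    have h2 : ∫⁻ s in Set.Ioc (-T) 0, k t s ≤ 4 :=
      (setLIntegral_le_lintegral _ _).trans (lintegral_exp_neg_abs_sub t)
    calc 8 * ((∫⁻ s in Set.Ioc (-T) 0, k t s) * (g u + 2)) ≤ 8 * (4 * (g u + 2)) := by gcongr
      _ = 32 * (g u + 2) := by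
        rw [← mul_assoc]
        norm_num
  calc _ ≤ ∫⁻ p, ∫⁻ q : ℝ × ℝ, 8 * (k p.1 q.1 * (g p.2 + g q.2))
          ∂windowMeasure T ∂windowMeasure T := by
        refine lintegral_mono_ae ((ae_nonneg_windowMeasure T).mono fun p hp => ?_)
        refine lintegral_mono_ae ((ae_nonneg_windowMeasure T).mono fun q hq => ?_)
        simp only [hW.increment_covariance]
        refine (ENNReal.ofReal_le_ofReal (overlap_sq_le hp hq)).trans_eq ?_
        rw [ENNReal.ofReal_mul (by norm_num), ENNReal.ofReal_mul (Real.exp_pos _).le,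
          ENNReal.ofReal_add (Real.exp_pos _).le (Real.exp_pos _).le, ENNReal.ofReal_ofNat]
    _ ≤ ∫⁻ p : ℝ × ℝ, 32 * (g p.2 + 2) ∂windowMeasure T := lintegral_mono fun p => hinner p.1 p.2
    _ = ENNReal.ofReal (128 * T) := by
        have hm : Measurable fun u => g u + 2 := hg.add measurable_const
        have hm' : Measurable fun p : ℝ × ℝ => 32 * (g p.2 + 2) :=
          (hm.comp measurable_snd).const_mul _
        have hI : ∫⁻ u, 32 * (g u + 2) ∂expWeight = 128 := by
          rw [lintegral_const_mul _ hm, lintegral_add_left hg, lintegral_exp_half_expWeight,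
            lintegral_const, measure_univ]
          norm_num
        rw [windowMeasure, lintegral_prod _ hm'.aemeasurable]
        simp only [hI, lintegral_const, Measure.restrict_apply_univ, Real.volume_Ioc]
        rw [sub_neg_eq_add, zero_add, ENNReal.ofReal_mul (by norm_num)]
        norm_num

/-- The mean is at most `4 * 2^n` and the variance at most `256 * 2^n`. By Chebyshev's inequality an
excess of `2^n` has probability at most `256 / 2^n`, which is summable, and the Borel-Cantelli lemma
applies. -/
theorem ae_window_lt (hW : IsBrownian W P) :
    ∀ᵐ ω ∂P, ∀ᶠ n : ℕ in atTop,
      ∫⁻ p, ENNReal.ofReal ((W p.1 ω - W (p.1 - p.2) ω) ^ 2) ∂windowMeasure (2 ^ n) <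
        ENNReal.ofReal (5 * 2 ^ n) := by
  have := hW.gaussian.isProbabilityMeasure
  have hmean : ∀ p : ℝ × ℝ, ∫ ω, (W p.1 ω - W (p.1 - p.2) ω) ∂P = 0 := fun p => by
    rw [integral_sub (hW.gaussian.hasGaussianLaw_eval _).integrable
      (hW.gaussian.hasGaussianLaw_eval _).integrable, hW.mean, hW.mean, sub_zero]
  have hP : ∀ n : ℕ, P {ω | ENNReal.ofReal (5 * 2 ^ n) ≤
      ∫⁻ p, ENNReal.ofReal ((W p.1 ω - W (p.1 - p.2) ω) ^ 2) ∂windowMeasure (2 ^ n)} ≤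
      ENNReal.ofReal (256 * (1 / 2) ^ n) := fun n => by
    have hn : (0 : ℝ) < 2 ^ n := by positivity
    have h := measure_integrated_sq_ge_le (μ := windowMeasure (2 ^ n)) hW.measurable_increment
      hW.gaussian_increment hmean (a := 4 * 2 ^ n) (b := 128 * 2 ^ n) (by positivity)
      (by positivity) hn (hW.lintegral_variance_le _) (hW.lintegral_covariance_sq_le _)
    rw [show (4 * 2 ^ n + 2 ^ n : ℝ) = 5 * 2 ^ n by ring] at h
    refine h.trans (ENNReal.ofReal_le_ofReal (le_of_eq ?_))
    rw [one_div, inv_pow]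
    field_simp
    norm_num
  have hsum : ∑' n : ℕ, P {ω | ENNReal.ofReal (5 * 2 ^ n) ≤
      ∫⁻ p, ENNReal.ofReal ((W p.1 ω - W (p.1 - p.2) ω) ^ 2) ∂windowMeasure (2 ^ n)} ≠ ∞ := by
    refine ne_top_of_le_ne_top ?_ (ENNReal.tsum_le_tsum hP)
    rw [← ENNReal.ofReal_tsum_of_nonneg (fun n => by positivity)
      (summable_geometric_two.mul_left 256)]
    exact ENNReal.ofReal_ne_top
  filter_upwards [ae_eventually_notMem hsum] with ω hω
  exact hω.mono fun n hn => not_le.1 hn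

end IsBrownian

/-- The Ornstein-Uhlenbeck path averages increments over an exponential lag, so Jensen's inequality
bounds its square by the average of squared increments. The latter is a double integral of squares,
to which the second moment bound applies. -/
theorem Sublinear.ofReal_integral_ou_sq_le {w : ℝ → ℝ} (hw : Sublinear w) (hc : Continuous w)
    {T : ℝ} (hT : 0 ≤ T) : ENNReal.ofReal (∫ r in (-T)..0, ou w r ^ 2) ≤
      ∫⁻ p, ENNReal.ofReal ((w p.1 - w (p.1 - p.2)) ^ 2) ∂windowMeasure T := by
  have hm : Measurable fun p : ℝ × ℝ => ENNReal.ofReal ((w p.1 - w (p.1 - p.2)) ^ 2) := by fun_prop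
  have hi : IntegrableOn (fun r => ou w r ^ 2) (Set.Ioc (-T) 0) :=
    ((hw.continuous_ou hc).pow 2).integrableOn_Ioc
  rw [intervalIntegral.integral_of_le (by linarith), ofReal_integral_eq_lintegral_ofReal hi
    (Eventually.of_forall fun r => sq_nonneg _), windowMeasure, lintegral_prod _ hm.aemeasurable]
  refine lintegral_mono fun r => ?_
  rw [hw.ou_eq_integral hc]
  exact ofReal_sq_integral_le (by fun_prop)

/-- The integral increases with the window, so the next power of two dominates `n`; this doubles the
slope from 5 to 10. The finitely many small windows go into the constant. -/
theorem IsBrownian.ae_integral_ou_sq_le (hW : IsBrownian W P) :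
    ∀ᵐ ω ∂P, ∃ C : ℝ, ∀ n : ℕ, ∫ r in (-(n : ℝ))..0, ou (fun t => W t ω) r ^ 2 ≤ 10 * n + C := by
  filter_upwards [hW.ae_sublinear, hW.ae_window_lt] with ω hs hω
  obtain ⟨K, hK⟩ := eventually_atTop.1 hω
  set w : ℝ → ℝ := fun t => W t ω with hw
  have hc := hs.continuous_ou (hW.continuous ω)
  set F : ℝ → ℝ := fun T => ∫ r in (-T)..0, ou w r ^ 2 with hF
  have hmono : ∀ S T, 0 ≤ S → S ≤ T → F S ≤ F T := fun S T hS hST => by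
    refine intervalIntegral.integral_mono_interval (by linarith) (by linarith) le_rfl
      (Eventually.of_forall fun r => sq_nonneg _) ((hc.pow 2).intervalIntegrable _ _)
  have hpow : ∀ k, K ≤ k → F (2 ^ k) ≤ 5 * 2 ^ k := fun k hk => by
    have h1 := (hs.ofReal_integral_ou_sq_le (hW.continuous ω) (T := 2 ^ k) (by positivity)).trans_lt
      (hK k hk)
    exact ((ENNReal.ofReal_lt_ofReal_iff (by positivity)).1 h1).le
  have hF0 : 0 ≤ F (2 ^ K) := intervalIntegral.integral_nonneg
    (by simp) fun r _ => sq_nonneg _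
  refine ⟨F (2 ^ K), fun n => ?_⟩
  change F n ≤ _
  have hn0 : (0 : ℝ) ≤ n := n.cast_nonneg
  rcases le_total n (2 ^ K) with h | h
  · have h' : (n : ℝ) ≤ 2 ^ K := by exact_mod_cast h
    linarith [hmono n _ hn0 h']
  · have hn : n ≠ 0 := (lt_of_lt_of_le (by positivity) h).ne'
    have h1 : 2 ^ Nat.log 2 n ≤ n := Nat.pow_log_le_self 2 hn
    have h2 : n < 2 ^ (Nat.log 2 n + 1) := Nat.lt_pow_succ_log_self one_lt_two n
    have h3 : K ≤ Nat.log 2 n := (Nat.le_log_iff_pow_le one_lt_two hn).2 h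
    have h1' : (2 : ℝ) ^ Nat.log 2 n ≤ n := by exact_mod_cast h1
    have h2' : (n : ℝ) ≤ 2 ^ (Nat.log 2 n + 1) := by exact_mod_cast h2.le
    have h4 := (hmono n _ hn0 h2').trans (hpow _ (h3.trans (Nat.le_succ _)))
    rw [pow_succ] at h4
    linarith

end BrownianSquare

/-! ### The invariant set of regular paths -/

/-- Countable quantifiers express sublinear growth through evaluations at rational times, which
makes it a measurable property of the path. -/
theorem sublinear_iff_rat {w : ℝ → ℝ} (hc : Continuous w) :
    Sublinear w ↔ ∀ k : ℕ, ∃ C : ℕ, ∀ q : ℚ, |w q| ≤ 1 / ((k : ℝ) + 1) * |(q : ℝ)| + C := by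
  constructor
  · intro h k
    obtain ⟨C, hC⟩ := h (1 / ((k : ℝ) + 1)) (by positivity)
    obtain ⟨n, hn⟩ := exists_nat_ge C
    exact ⟨n, fun q => (hC q).trans (by linarith)⟩
  · intro h ε hε
    obtain ⟨k, hk⟩ := exists_nat_one_div_lt hε
    obtain ⟨C, hC⟩ := h k
    refine ⟨C, fun t => ?_⟩
    have hcl : IsClosed {t : ℝ | |w t| ≤ 1 / ((k : ℝ) + 1) * |t| + C} :=
      isClosed_le hc.abs (by fun_prop)
    have hsub : Set.range ((↑) : ℚ → ℝ) ⊆ {t : ℝ | |w t| ≤ 1 / ((k : ℝ) + 1) * |t| + C} := by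
      rintro _ ⟨q, rfl⟩
      exact hC q
    have ht : |w t| ≤ 1 / ((k : ℝ) + 1) * |t| + C :=
      closure_minimal hsub hcl (Rat.isDenseEmbedding_coe_real.dense t)
    have := mul_le_mul_of_nonneg_right hk.le (abs_nonneg t)
    linarith

theorem Sublinear.comp_add {w : ℝ → ℝ} (hw : Sublinear w) (s : ℝ) :
    Sublinear fun t => w (t + s) := by
  intro ε hε
  obtain ⟨C, hC⟩ := hw ε hε
  refine ⟨ε * |s| + C, fun t => (hC _).trans ?_⟩
  have := mul_le_mul_of_nonneg_left (abs_add_le t s) hε.le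
  linarith

theorem Sublinear.tendsto_div {w : ℝ → ℝ} (hw : Sublinear w) {l : Filter ℝ}
    (hl : Tendsto (fun t : ℝ => |t|) l atTop) : Tendsto (fun t => w t / t) l (𝓝 0) := by
  rw [Metric.tendsto_nhds]
  intro ε hε
  obtain ⟨C, hC⟩ := hw (ε / 2) (by positivity)
  filter_upwards [hl.eventually_gt_atTop (2 * C / ε), hl.eventually_gt_atTop 0] with t h1 h2
  rw [Real.dist_eq, sub_zero, abs_div, div_lt_iff₀ h2]
  rw [div_lt_iff₀ hε] at h1
  linarith [hC t]

theorem measurable_ou {Ω : Type*} [MeasurableSpace Ω] {W : ℝ → Ω → ℝ}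
    (hW : Measurable (Function.uncurry W)) :
    Measurable fun z : ℝ × Ω => ou (fun t => W t z.2) z.1 := by
  have h1 : Measurable fun y : (ℝ × Ω) × ℝ =>
      (Set.Iic y.1.1).indicator (fun τ => Real.exp τ * W τ y.1.2) y.2 := by
    have hs : MeasurableSet {y : (ℝ × Ω) × ℝ | y.2 ≤ y.1.1} :=
      measurableSet_le measurable_snd (measurable_fst.comp measurable_fst)
    have hg : Measurable fun y : (ℝ × Ω) × ℝ => Real.exp y.2 * W y.2 y.1.2 :=
      (Real.measurable_exp.comp measurable_snd).mul
        (hW.comp (measurable_snd.prodMk (measurable_snd.comp measurable_fst)))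
    exact hg.indicator hs
  have h2 : Measurable fun z : ℝ × Ω => ∫ τ in Set.Iic z.1, Real.exp τ * W τ z.2 := by
    have h := h1.stronglyMeasurable.integral_prod_right' (ν := volume)
    simp only [integral_indicator measurableSet_Iic] at h
    exact h.measurable
  unfold ou
  exact (Real.measurable_exp.comp measurable_fst.neg).mul
    (((Real.measurable_exp.comp measurable_fst).mul (hW.comp measurable_id)).sub h2)

theorem measurable_integral_ou_sq {Ω : Type*} [MeasurableSpace Ω] {W : ℝ → Ω → ℝ}
    (hW : Measurable (Function.uncurry W)) (a : ℝ) :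
    Measurable fun ω => ∫ r in (-a)..0, ou (fun t => W t ω) r ^ 2 := by
  have h : StronglyMeasurable fun z : Ω × ℝ => ou (fun t => W t z.1) z.2 ^ 2 :=
    (((measurable_ou hW).comp measurable_swap).pow_const 2).stronglyMeasurable
  simp only [intervalIntegral]
  exact (h.integral_prod_right'.measurable).sub h.integral_prod_right'.measurable

/-- The paths of sublinear growth whose Ornstein-Uhlenbeck paths have linearly growing square
integrals. -/
def regularPaths (m : ℕ) : Set (WienerSpace m) :=
  {ω | ∀ i, Sublinear (fun t => ω.1 t i) ∧
    ∃ C : ℝ, ∀ n : ℕ, ∫ r in (-(n : ℝ))..0, ou (fun t => ω.1 t i) r ^ 2 ≤ 10 * n + C}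

section Paths

variable {m : ℕ}

theorem continuous_coord (ω : WienerSpace m) (i : Fin m) : Continuous fun t => ω.1 t i :=
  (continuous_apply i).comp ω.1.continuous

theorem measurable_coord (i : Fin m) (t : ℝ) : Measurable fun ω : WienerSpace m => ω.1 t i := by
  have h : Continuous fun ω : WienerSpace m => ω.1 t i :=
    (continuous_apply i).comp ((continuous_eval_const t).comp continuous_subtype_val)
  exact h.measurable

theorem measurable_uncurry_coord (i : Fin m) :
    Measurable (Function.uncurry fun (t : ℝ) (ω : WienerSpace m) => ω.1 t i) :=
  measurable_uncurry_of_continuous_of_measurable (fun ω => continuous_coord ω i)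
    (measurable_coord i)

theorem measurableSet_regularPaths : MeasurableSet (regularPaths m) := by
  have e : regularPaths m = ⋂ i : Fin m,
      ((⋂ k : ℕ, ⋃ C : ℕ, ⋂ q : ℚ,
        {ω : WienerSpace m | |ω.1 q i| ≤ 1 / ((k : ℝ) + 1) * |(q : ℝ)| + C}) ∩
      ⋃ C : ℕ, ⋂ n : ℕ, {ω : WienerSpace m |
        ∫ r in (-(n : ℝ))..0, ou (fun t => ω.1 t i) r ^ 2 ≤ 10 * n + C}) := by
    ext ω
    simp only [regularPaths, Set.mem_iInter, Set.mem_inter_iff, Set.mem_iUnion, Set.mem_ofPred_eq,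
      sublinear_iff_rat (continuous_coord ω _)]
    refine forall_congr' fun i => and_congr_right fun _ => ⟨?_, ?_⟩
    · rintro ⟨C, hC⟩
      obtain ⟨k, hk⟩ := exists_nat_ge C
      exact ⟨k, fun n => (hC n).trans (by linarith)⟩
    · rintro ⟨C, hC⟩
      exact ⟨C, hC⟩
  rw [e]
  refine MeasurableSet.iInter fun i => MeasurableSet.inter ?_ ?_
  · exact MeasurableSet.iInter fun k => MeasurableSet.iUnion fun C => MeasurableSet.iInter fun q =>
      measurableSet_le (measurable_coord i q).norm measurable_const
  · exact MeasurableSet.iUnion fun C => MeasurableSet.iInter fun n =>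
      measurableSet_le (measurable_integral_ou_sq (measurable_uncurry_coord i) _) measurable_const

theorem IsWienerMeasure.isBrownian {P : Measure (WienerSpace m)} (hP : IsWienerMeasure P)
    (i : Fin m) : IsBrownian (fun t (ω : WienerSpace m) => ω.1 t i) P where
  gaussian := hP.gaussian.comp_right fun t : ℝ => (i, t)
  mean := hP.mean i
  covariance s t := by rw [hP.covariance, if_pos rfl]
  measurable := measurable_coord i
  continuous ω := continuous_coord ω i
  zero ω := by rw [ω.2]; rfl

theorem measure_compl_regularPaths {P : Measure (WienerSpace m)} (hP : IsWienerMeasure P) :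
    P (regularPaths m)ᶜ = 0 := by
  have h : ∀ᵐ ω ∂P, ω ∈ regularPaths m := by
    refine ae_all_iff.2 fun i => ?_
    filter_upwards [(hP.isBrownian i).ae_sublinear, (hP.isBrownian i).ae_integral_ou_sq_le]
      with ω h1 h2
    exact ⟨h1, h2⟩
  exact h

/-- Shifting moves the window by `s`; it stays inside the window lengthened by an integer `k ≥ |s|`
on both sides, so only the constant changes and the slope 10 is kept. -/
theorem shift_mem_regularPaths {ω : WienerSpace m} (hω : ω ∈ regularPaths m) (s : ℝ) :
    shift s ω ∈ regularPaths m := by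
  intro i
  obtain ⟨hw, C, hC⟩ := hω i
  have hc := continuous_coord ω i
  set w : ℝ → ℝ := fun t => ω.1 t i with hwdef
  have e : (fun t => (shift s ω).1 t i) = fun t => w (t + s) - w s := rfl
  rw [e]
  refine ⟨(hw.comp_add s).sub_const _, ?_⟩
  obtain ⟨k, hk⟩ := exists_nat_ge |s|
  have hq : Continuous fun r => ou w r ^ 2 := (hw.continuous_ou hc).pow 2
  refine ⟨10 * k + C + ∫ r in (0 : ℝ)..k, ou w r ^ 2, fun n => ?_⟩
  simp only [hw.ou_shift hc]
  rw [intervalIntegral.integral_comp_add_right (fun r => ou w r ^ 2), zero_add]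
  have h1 : ∫ r in (-(n : ℝ) + s)..s, ou w r ^ 2 ≤ ∫ r in (-((n + k : ℕ) : ℝ))..k, ou w r ^ 2 := by
    refine intervalIntegral.integral_mono_interval ?_ ?_ ((le_abs_self s).trans hk)
      (Eventually.of_forall fun r => sq_nonneg _) (hq.intervalIntegrable _ _)
    · push_cast
      linarith [neg_abs_le s]
    · linarith [n.cast_nonneg (α := ℝ)]
  have h2 := hC (n + k)
  have h3 := intervalIntegral.integral_add_adjacent_intervals (μ := volume)
    (hq.intervalIntegrable (-((n + k : ℕ) : ℝ)) 0) (hq.intervalIntegrable 0 k)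
  push_cast at h1 h2 h3 ⊢
  linarith

theorem shift_neg_shift (s : ℝ) (ω : WienerSpace m) : shift (-s) (shift s ω) = ω := by
  refine Subtype.ext (ContinuousMap.ext fun r => ?_)
  change ω.1 (r + -s + s) - ω.1 s - (ω.1 (-s + s) - ω.1 s) = ω.1 r
  rw [neg_add_cancel_right, neg_add_cancel, ω.2, sub_sub_sub_cancel_right, sub_zero]

theorem preimage_shift_regularPaths (s : ℝ) : shift s ⁻¹' regularPaths m = regularPaths m := by
  ext ω
  refine ⟨fun h => ?_, fun h => shift_mem_regularPaths h s⟩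
  rw [← shift_neg_shift s ω]
  exact shift_mem_regularPaths h (-s)

theorem sublinear_norm {ω : WienerSpace m} (hω : ω ∈ regularPaths m) :
    Sublinear fun t => ‖ω.1 t‖ := by
  intro ε hε
  choose C hC using fun i => (hω i).1 ε hε
  refine ⟨∑ i, |C i|, fun t => ?_⟩
  rw [abs_norm]
  refine (pi_norm_le_iff_of_nonneg (by positivity)).2 fun i => (hC i t).trans ?_
  have := Finset.single_le_sum (f := fun i => |C i|) (fun _ _ => abs_nonneg _) (Finset.mem_univ i)
  linarith [le_abs_self (C i)]

/-! ### The Ornstein-Uhlenbeck processes on regular paths -/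

variable {N : ℕ} (c : Fin N → Fin m → ℝ)

theorem ouProcess_eq (j : Fin N) (t : ℝ) (ω : WienerSpace m) :
    ouProcess c j t ω = ∑ i, c j i * ou (fun r => ω.1 r i) t := rfl

theorem measurable_ouProcess (j : Fin N) (t : ℝ) : Measurable (ouProcess c j t) := by
  refine Finset.measurable_fun_sum _ fun i _ => Measurable.const_mul ?_ _
  exact (measurable_ou (measurable_uncurry_coord i)).comp (measurable_const.prodMk measurable_id)

theorem ouProcess_shift {ω : WienerSpace m} (hω : ω ∈ regularPaths m) (j : Fin N) (s t : ℝ) :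
    ouProcess c j t (shift s ω) = ouProcess c j (t + s) ω := by
  rw [ouProcess_eq, ouProcess_eq]
  refine Finset.sum_congr rfl fun i _ => ?_
  rw [← (hω i).1.ou_shift (continuous_coord ω i)]
  rfl

end Paths

/-! ### The random differential equations on regular paths -/

section Systems

variable {m N d : ℕ} (c : Fin N → Fin m → ℝ) {ω : WienerSpace m}

theorem continuous_ouProcess (hω : ω ∈ regularPaths m) (j : Fin N) :
    Continuous fun t => ouProcess c j t ω :=
  continuous_finsetSum _ fun i _ =>
    ((hω i).1.continuous_ou (continuous_coord ω i)).const_mul (c j i)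

theorem sublinear_ouProcess (hω : ω ∈ regularPaths m) (j : Fin N) :
    Sublinear fun t => ouProcess c j t ω :=
  Sublinear.sum Finset.univ fun i _ => (hω i).1.ou.const_mul (c j i)

theorem sublinear_integral_ouProcess (hω : ω ∈ regularPaths m) (j : Fin N) :
    Sublinear fun s => ∫ r in (0 : ℝ)..s, ouProcess c j r ω := by
  have e : ∀ s, ∫ r in (0 : ℝ)..s, ouProcess c j r ω =
      ∑ i, c j i * (pastMean (fun t => ω.1 t i) s - pastMean (fun t => ω.1 t i) 0) := fun s => by
    simp only [ouProcess_eq]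
    rw [intervalIntegral.integral_finsetSum fun i _ =>
      (((hω i).1.continuous_ou (continuous_coord ω i)).const_mul (c j i)).intervalIntegrable _ _]
    refine Finset.sum_congr rfl fun i _ => ?_
    rw [intervalIntegral.integral_const_mul, (hω i).1.integral_ou (continuous_coord ω i)]
  simp only [e]
  exact Sublinear.sum Finset.univ fun i _ =>
    ((hω i).1.pastMean.sub_const _).const_mul (c j i)

/-- The growth constant of the integrated squared noise. -/
def noiseConst (c : Fin N → Fin m → ℝ) : ℝ := (∑ j, ∑ i, c j i ^ 2) * (10 * m)

theorem noiseConst_nonneg : 0 ≤ noiseConst c := by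
  unfold noiseConst
  positivity

/-- The Cauchy-Schwarz inequality over the `m` driving components gives the factor `∑ c²`; each
component has slope 10, and rounding `|s|` up to an integer adds at most 10 to the constant. -/
theorem exists_sum_integral_ouProcess_sq_le (hω : ω ∈ regularPaths m) :
    ∃ C, ∀ s ≤ 0, ∑ j, ∫ r in s..(0 : ℝ), ouProcess c j r ω ^ 2 ≤ noiseConst c * |s| + C := by
  choose C hC using fun i => (hω i).2
  set c₂ : ℝ := ∑ j, ∑ i, c j i ^ 2 with hc₂
  have hc₂0 : 0 ≤ c₂ := by positivity
  set q : Fin m → ℝ → ℝ := fun i r => ou (fun t => ω.1 t i) r ^ 2 with hq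
  have hqc : ∀ i, Continuous (q i) := fun i =>
    ((hω i).1.continuous_ou (continuous_coord ω i)).pow 2
  refine ⟨c₂ * (10 * m + ∑ i, C i), fun s hs => ?_⟩
  have hi : ∀ i, ∫ r in s..(0 : ℝ), q i r ≤ 10 * |s| + 10 + C i := fun i => by
    have h1 : |s| ≤ (⌈|s|⌉₊ : ℝ) := Nat.le_ceil _
    have h2 : (⌈|s|⌉₊ : ℝ) < |s| + 1 := Nat.ceil_lt_add_one (abs_nonneg s)
    have h3 : ∫ r in s..(0 : ℝ), q i r ≤ ∫ r in (-(⌈|s|⌉₊ : ℝ))..0, q i r :=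
      intervalIntegral.integral_mono_interval (by linarith [neg_abs_le s]) hs le_rfl
        (Eventually.of_forall fun r => sq_nonneg _) ((hqc i).intervalIntegrable _ _)
    have h4 := hC i ⌈|s|⌉₊
    have h5 : ∫ r in (-(⌈|s|⌉₊ : ℝ))..0, q i r ≤ 10 * (⌈|s|⌉₊ : ℝ) + C i := h4
    linarith
  have hpt : ∀ r, ∑ j, ouProcess c j r ω ^ 2 ≤ c₂ * ∑ i, q i r := fun r => by
    rw [hc₂, Finset.sum_mul]
    exact Finset.sum_le_sum fun j _ => by
      rw [ouProcess_eq]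
      exact Finset.sum_mul_sq_le_sq_mul_sq _ _ _
  calc ∑ j, ∫ r in s..(0 : ℝ), ouProcess c j r ω ^ 2
      = ∫ r in s..(0 : ℝ), ∑ j, ouProcess c j r ω ^ 2 :=
        (intervalIntegral.integral_finsetSum fun j _ =>
          ((continuous_ouProcess c hω j).pow 2).intervalIntegrable _ _).symm
    _ ≤ ∫ r in s..(0 : ℝ), c₂ * ∑ i, q i r :=
        intervalIntegral.integral_mono_on hs
          ((continuous_finsetSum _ fun j _ =>
            (continuous_ouProcess c hω j).pow 2).intervalIntegrable _ _)
          (((continuous_finsetSum _ fun i _ => hqc i).const_mul c₂).intervalIntegrable _ _)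
          fun r _ => hpt r
    _ = c₂ * ∑ i, ∫ r in s..(0 : ℝ), q i r := by
        rw [intervalIntegral.integral_const_mul, intervalIntegral.integral_finsetSum fun i _ =>
          (hqc i).intervalIntegrable _ _]
    _ ≤ c₂ * ∑ i, (10 * |s| + 10 + C i) :=
        mul_le_mul_of_nonneg_left (Finset.sum_le_sum fun i _ => hi i) hc₂0
    _ = noiseConst c * |s| + c₂ * (10 * m + ∑ i, C i) := by
        rw [Finset.sum_add_distrib, Finset.sum_const, Finset.card_univ, Fintype.card_fin,
          nsmul_eq_mul, noiseConst, ← hc₂]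
        ring

variable {f : Fin N → EuclideanSpace ℝ (Fin d) → EuclideanSpace ℝ (Fin d)} {L ν₀ ν : ℝ}

theorem averagedField_shift (hω : ω ∈ regularPaths m) (s : ℝ) :
    averagedField c f (shift s ω) = fun r => averagedField c f ω (r + s) := by
  funext r x
  simp only [averagedField, ouProcess_shift c hω]

/-- A coupling strength beyond which the noise cannot destroy the dissipativity. -/
theorem exists_coupling (hL : 0 < L) :
    ∃ ν₀ : ℝ, 0 < ν₀ ∧ 2 * (N : ℝ) ^ 2 / ν₀ * noiseConst c ≤ L / 4 := by
  have hK := noiseConst_nonneg c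
  -- The summand 1 keeps `ν₀` positive when the noise coefficients vanish.
  have h0 : 0 < 8 * (N : ℝ) ^ 2 * noiseConst c / L + 1 := by positivity
  refine ⟨_, h0, ?_⟩
  rw [div_mul_eq_mul_div, div_le_iff₀ h0, mul_add, mul_div_assoc']
  have : L / 4 * (8 * (N : ℝ) ^ 2 * noiseConst c) / L = 2 * (N : ℝ) ^ 2 * noiseConst c := by
    field_simp
    ring
  rw [this]
  linarith

variable [NeZero N]

/-- The noise paths of the coupled systems. -/
def noisePath (c : Fin N → Fin m → ℝ) (ω : WienerSpace m) : Fin N → ℝ → ℝ :=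
  fun j t => ouProcess c j t ω

theorem pastDecay_noisePath (hL : 0 < L) (hν₀ : 0 < ν₀)
    (hK : 2 * N ^ 2 / ν₀ * noiseConst c ≤ L / 4) (hω : ω ∈ regularPaths m) :
    PastDecay (pathRate L ν₀ (noisePath c ω)) (pathSource L f (noisePath c ω)) :=
  pastDecay_of_noise hL (continuous_ouProcess c hω) (sublinear_ouProcess c hω)
    (sublinear_integral_ouProcess c hω) (exists_sum_integral_ouProcess_sq_le c hω) hν₀ hK

/-- The fields depend on `ω` only through the current noise values and are continuous in these and
the state, so composition suffices. -/
theorem measurable_noise_comp {V : Type*} [TopologicalSpace V] [SecondCountableTopology V]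
    [MeasurableSpace V] [BorelSpace V] {F : (Fin N → ℝ) × V → V} (hF : Continuous F) (t : ℝ)
    {X : regularPaths m → V} (hX : Measurable X) :
    Measurable fun ω : regularPaths m => F (fun j => ouProcess c j t ω, X ω) := by
  have ho : Measurable fun (ω : regularPaths m) (j : Fin N) => ouProcess c j t ω :=
    measurable_pi_iff.2 fun j => (measurable_ouProcess c j t).comp measurable_subtype_coe
  exact hF.measurable.comp (ho.prodMk hX)

theorem continuous_coupledPathField_noise (hf : ∀ j, Continuous (f j)) (t : ℝ) :
    Continuous fun p : (Fin N → ℝ) × (Fin N → EuclideanSpace ℝ (Fin d)) =>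
      coupledPathField f (fun j _ => p.1 j) ν t p.2 := by
  unfold coupledPathField conjugateField lap
  refine continuous_pi fun j => ?_
  have := hf j
  fun_prop

theorem continuous_averagedPathField_noise (hf : ∀ j, Continuous (f j)) (t : ℝ) :
    Continuous fun p : (Fin N → ℝ) × EuclideanSpace ℝ (Fin d) =>
      averagedPathField f (fun j _ => p.1 j) t p.2 := by
  unfold averagedPathField conjugateField avg
  have h : ∀ j, Continuous fun p : (Fin N → ℝ) × EuclideanSpace ℝ (Fin d) =>
      Real.exp (-p.1 j) • f j (Real.exp (p.1 j) • p.2) + p.1 j • p.2 := fun j => by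
    have := hf j
    fun_prop
  exact (continuous_finsetSum Finset.univ fun j _ => h j).const_smul (1 / (N : ℝ))

theorem rateBounds_coupledField (hL : 0 < L) (hf : ∀ j, Continuous (f j))
    (hd : ∀ j x y, inner ℝ (x - y) (f j x - f j y) ≤ -L * ‖x - y‖ ^ 2) (hν₀ : 0 < ν₀)
    (hν : ν₀ ≤ ν) (hω : ω ∈ regularPaths m) :
    RateBounds (sumForm _ (Fin N)) (coupledField c f ν ω) (pathRate L ν₀ (noisePath c ω))
      (pathSource L f (noisePath c ω)) :=
  rateBounds_coupled (o := noisePath c ω) hL hf hd (continuous_ouProcess c hω) hν₀ hν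

theorem rateBounds_averagedField (hL : 0 < L) (hf : ∀ j, Continuous (f j))
    (hd : ∀ j x y, inner ℝ (x - y) (f j x - f j y) ≤ -L * ‖x - y‖ ^ 2) (hν₀ : 0 < ν₀)
    (hω : ω ∈ regularPaths m) :
    RateBounds (innerForm _) (averagedField c f ω) (pathRate L ν₀ (noisePath c ω))
      (pathSource L f (noisePath c ω)) :=
  rateBounds_averaged (o := noisePath c ω) hL hf hd (continuous_ouProcess c hω) hν₀

theorem coupledField_shift (hω : ω ∈ regularPaths m) (s : ℝ) :
    coupledField c f ν (shift s ω) = fun r => coupledField c f ν ω (r + s) := by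
  funext r x j
  simp only [coupledField, ouProcess_shift c hω]

theorem dissipativeRODE_coupled (hL : 0 < L) (hf : ∀ j, Continuous (f j))
    (hd : ∀ j x y, inner ℝ (x - y) (f j x - f j y) ≤ -L * ‖x - y‖ ^ 2) (hν₀ : 0 < ν₀)
    (hK : 2 * N ^ 2 / ν₀ * noiseConst c ≤ L / 4) (hν : ν₀ ≤ ν) :
    DissipativeRODE (regularPaths m) (sumForm (EuclideanSpace ℝ (Fin d)) (Fin N))
      (coupledField c f ν)
      (fun ω => pathRate L ν₀ (noisePath c ω)) (fun ω => pathSource L f (noisePath c ω)) where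
  shift_mem _ hω s := shift_mem_regularPaths hω s
  cocycle _ hω s := coupledField_shift c hω s
  rateBounds _ hω := rateBounds_coupledField c hL hf hd hν₀ hν hω
  pastDecay _ hω := pastDecay_noisePath c hL hν₀ hK hω
  measurable := fun t _ hX =>
    measurable_noise_comp c (continuous_coupledPathField_noise hf t) t hX

theorem dissipativeRODE_averaged (hL : 0 < L) (hf : ∀ j, Continuous (f j))
    (hd : ∀ j x y, inner ℝ (x - y) (f j x - f j y) ≤ -L * ‖x - y‖ ^ 2) (hν₀ : 0 < ν₀)
    (hK : 2 * N ^ 2 / ν₀ * noiseConst c ≤ L / 4) :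
    DissipativeRODE (regularPaths m) (innerForm (EuclideanSpace ℝ (Fin d))) (averagedField c f)
      (fun ω => pathRate L ν₀ (noisePath c ω)) (fun ω => pathSource L f (noisePath c ω)) where
  shift_mem _ hω s := shift_mem_regularPaths hω s
  cocycle _ hω s := averagedField_shift c hω s
  rateBounds _ hω := rateBounds_averagedField c hL hf hd hν₀ hω
  pastDecay _ hω := pastDecay_noisePath c hL hν₀ hK hω
  measurable := fun t _ hX =>
    measurable_noise_comp c (continuous_averagedPathField_noise hf t) t hX

end Systems

end CoupledRODE

end

/-! ### The synchronization theorem. -/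

theorem mainTheorem2 {m N d : ℕ} [NeZero N]
    (P : Measure (CoupledRODE.WienerSpace m)) (hP : CoupledRODE.IsWienerMeasure P)
    (c : Fin N → Fin m → ℝ) :
    -- the invariant set of full measure on which everything holds pathwise
    ∃ Ω' : Set (CoupledRODE.WienerSpace m),
      MeasurableSet Ω' ∧ P Ω'ᶜ = 0 ∧
      (∀ t : ℝ, CoupledRODE.shift t ⁻¹' Ω' = Ω') ∧
      (∀ ω ∈ Ω', Tendsto (fun t : ℝ => ‖ω.1 t‖ / t) atTop (𝓝 0) ∧
        Tendsto (fun t : ℝ => ‖ω.1 t‖ / t) atBot (𝓝 0)) ∧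
      ∀ (L : ℝ) (f : Fin N → EuclideanSpace ℝ (Fin d) → EuclideanSpace ℝ (Fin d)),
        0 < L →
        (∀ j, Continuous (f j)) →
        (∀ j x₁ x₂, inner ℝ (x₁ - x₂) (f j x₁ - f j x₂) ≤ -L * ‖x₁ - x₂‖ ^ 2) →
        -- the two equations generate dynamical systems
        (∀ ω ∈ Ω', (∀ ν : ℝ, 0 < ν → CoupledRODE.IsWellPosed (CoupledRODE.coupledField c f ν ω)) ∧
          CoupledRODE.IsWellPosed (CoupledRODE.averagedField c f ω)) ∧
        -- they have singleton random attractors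
        (∃ ν₀ : ℝ, 0 < ν₀ ∧ ∀ ν : ℝ, ν₀ ≤ ν →
          ∃ xbar : CoupledRODE.WienerSpace m → Fin N → EuclideanSpace ℝ (Fin d),
            CoupledRODE.IsSingletonAttractor Ω'
              (CoupledRODE.solutionFlow (CoupledRODE.coupledField c f ν)) xbar) ∧
        (∃ zbar : CoupledRODE.WienerSpace m → EuclideanSpace ℝ (Fin d),
          CoupledRODE.IsSingletonAttractor Ω'
            (CoupledRODE.solutionFlow (CoupledRODE.averagedField c f)) zbar) ∧
        -- the synchronization statement
        ∀ zbar : CoupledRODE.WienerSpace m → EuclideanSpace ℝ (Fin d),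
          CoupledRODE.IsSingletonAttractor Ω'
            (CoupledRODE.solutionFlow (CoupledRODE.averagedField c f)) zbar →
          (∀ ω ∈ Ω', CoupledRODE.IsSolutionOn (CoupledRODE.averagedField c f ω) Set.univ
            (fun t => zbar (CoupledRODE.shift t ω))) ∧
          ∀ (ν : ℕ → ℝ) (xbar : ℕ → CoupledRODE.WienerSpace m →
              Fin N → EuclideanSpace ℝ (Fin d)),
            Tendsto ν atTop atTop →
            (∀ᶠ n in atTop, CoupledRODE.IsSingletonAttractor Ω'
              (CoupledRODE.solutionFlow (CoupledRODE.coupledField c f (ν n))) (xbar n)) →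
            ∀ ω ∈ Ω', ∀ (T₁ T₂ : ℝ) (j : Fin N),
              TendstoUniformlyOn (fun n t => xbar n (CoupledRODE.shift t ω) j)
                (fun t => zbar (CoupledRODE.shift t ω)) atTop (Set.Icc T₁ T₂) := by
  refine ⟨CoupledRODE.regularPaths m, CoupledRODE.measurableSet_regularPaths,
    CoupledRODE.measure_compl_regularPaths hP, CoupledRODE.preimage_shift_regularPaths,
    fun ω hω => ⟨(CoupledRODE.sublinear_norm hω).tendsto_div tendsto_abs_atTop_atTop,
      (CoupledRODE.sublinear_norm hω).tendsto_div tendsto_abs_atBot_atTop⟩, ?_⟩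
  intro L f hL hf hd
  obtain ⟨ν₀, hν₀, hK⟩ := CoupledRODE.exists_coupling (N := N) c hL
  have hav := CoupledRODE.dissipativeRODE_averaged c hL hf hd hν₀ hK
  refine ⟨fun ω hω => ⟨fun ν hν => ?_, (hav.rateBounds ω hω).isWellPosed⟩,
    ⟨ν₀, hν₀, fun ν hν =>
      (CoupledRODE.dissipativeRODE_coupled c hL hf hd hν₀ hK hν).exists_attractor⟩,
    hav.exists_attractor, fun zbar hz => ⟨fun ω hω => (hav.isSolutionOn_attractor hz hω).1, ?_⟩⟩
  -- Well-posedness does not need decay of the rate, so `ν` itself serves as the reference coupling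
  -- and every `ν > 0` is admitted.
  · exact (CoupledRODE.rateBounds_coupledField c hL hf hd hν le_rfl hω).isWellPosed
  · intro ν xbar hν hx ω hω T₁ T₂ j
    obtain ⟨h1, h2⟩ := hav.isSolutionOn_attractor hz hω
    refine CoupledRODE.tendstoUniformlyOn_entire hL hf hd
      (CoupledRODE.continuous_ouProcess c hω) hν₀
      (CoupledRODE.pastDecay_noisePath c hL hν₀ hK hω) hν
      (o := CoupledRODE.noisePath c ω) (x := fun n t => xbar n (CoupledRODE.shift t ω)) ?_ h1 h2 T₁ T₂ j
    -- From `ν n ≥ ν₀` on, the given attractors are the pullback limits and obey the energy bound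
    -- with the common rate and source at `ν₀`.
    filter_upwards [hx, hν.eventually_ge_atTop ν₀] with n hn hnν
    exact (CoupledRODE.dissipativeRODE_coupled c hL hf hd hν₀ hK hnν).isSolutionOn_attractor hn hω
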